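/- Let $N\ge 1$. Let $\mathcal A_N$ be the set of all $\Psi\in L^2((\mathbb R^3\times\mathbb Z_2)^N;\mathbb C)$ with weak gradient $\nabla\Psi\in L^2$, with $\|\Psi\|_{L^2}=1$, and which are antisymmetric: $\Psi(z_{\sigma(1)},\dots,z_{\sigma(N)})=\operatorname{sgn}(\sigma)\,\Psi(z_1,\dots,z_N)$ for all permutations $\sigma$, where $z_i=(x_i,s_i)\in\mathbb R^3\times\mathbb Z_2$. For $\Psi\in\mathcal A_N$ write $\Psi\mapsto\rho$ if $$\rho(x_1)=N\int_{\mathbb R^{3(N-1)}}\sum_{s_1,\dots,s_N\in\mathbb Z_2}|\Psi(x_1,s_1,\dots,x_N,s_N)|^2\,dx_2\cdots dx_N\quad\text{for a.e. }x_1\in\mathbb R^3,$$ and let $\mathcal R_N$ be the set of all $\rho:\mathbb R^3\to\mathbb R$ such that $\Psi\mapsto\rho$ for some $\Psi\in\mathcal A_N$. Let $$T[\Psi]=\int_{\mathbb R^{3N}}\sum_{s_1,\dots,s_N}\sum_{i=1}^N|\nabla_{x_i}\Psi|^2\,dx_1\cdots dx_N,\qquad V_{ee}[\Psi]=\int_{\mathbb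 R^{3N}}\sum_{1\le i<j\le N}\frac1{|x_i-x_j|}\sum_{s_1,\dots,s_N}|\Psi|^2\,dx_1\cdots dx_N .$$ **Theorem B.** Let $\rho\in\mathcal R_N$, let $(\alpha_k)_{k\in\mathbb N}$ be any sequence of positive numbers with $\alpha_k\to0$, and for each $k$ let $\Psi_{\alpha_k}$ be a minimizer of $\alpha_kT+V_{ee}$ over all $\Psi\in\mathcal A_N$ with $\Psi\mapsto\rho$. Then there exist a subsequence $(\alpha_{k_j})_j$ and a Borel probability measure $\gamma$ on $\mathbb R^{3N}$ such that, as $j\to\infty$, the $N$-body position densities $\sum_{s_1,\dots,s_N}|\Psi_{\alpha_{k_j}}|^2$ converge weakly to $\gamma$ as probability measures, that is, $$\lim_{j\to\infty}\int_{\mathbb R^{3N}}f\sum_{s_1,\dots,s_N\in\mathbb Z_2}|\Psi_{\alpha_{k_j}}|^2\,dx_1\cdots dx_N=\int_{\mathbb R^{3N}}f\,d\gamma\quad\text{for all bounded continuous }f:\mathbb R^{3N}\to\mathbb R,$$ and $\gamma$ is a minimizer of the Coulomb multi-marginal optimal transport problem: $\gamma$ minimizes $$\int_{\mathbb R^{3N}}\sum_{1\le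 i<j\le N}\frac1{|x_i-x_j|}\,d\gamma(x_1,\dots,x_N)$$ (where $1/0=+\infty$) among all Borel probability measures $\gamma$ on $\mathbb R^{3N}$ that are symmetric, i.e. $\gamma(A_1\times\cdots\times A_N)=\gamma(A_{\sigma(1)}\times\cdots\times A_{\sigma(N)})$ for all measurable $A_1,\dots,A_N\subseteq\mathbb R^3$ and all permutations $\sigma$, and whose one-particle marginal has density $\rho/N$, i.e. $\gamma(A\times\mathbb R^{3(N-1)})=\int_A\frac{\rho(x)}N\,dx$ for all measurable $A\subseteq\mathbb R^3$. -/

import Mathlib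

open MeasureTheory Filter Topology
open scoped ENNReal ContDiff

noncomputable section

namespace HohenbergKohn

/-- Physical space `ℝ³` with the Euclidean norm. -/
abbrev Space : Type := EuclideanSpace ℝ (Fin 3)

/-- Positions of `N` particles, i.e. `ℝ^{3N}`. The topology is the usual one and `volume` is
Lebesgue measure. -/
abbrev Positions (N : ℕ) : Type := Fin N → Space

/-- Spins of `N` particles. -/
abbrev Spins (N : ℕ) : Type := Fin N → ZMod 2

/-- Functions on `(ℝ³ × ℤ₂)^N`, written with the positions `x` and the spins `s` as separate
arguments: `Ψ x s` is `Ψ (x₁, s₁, …, x_N, s_N)`. -/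
abbrev WaveFunction (N : ℕ) : Type := Positions N → Spins N → ℂ

variable {N : ℕ}

/-! ### Weak derivatives -/

/-- The unit vector of `ℝ^{3N}` in the direction of the `c`-th coordinate of the `i`-th particle. -/
def direction (i : Fin N) (c : Fin 3) : Positions N :=
  Pi.single i (EuclideanSpace.single c (1 : ℝ))

/-- `g` is a weak (distributional) partial derivative of `u` with respect to the `c`-th coordinate
of the `i`-th particle. (Used for `u` and `g` in `L²` only, so that both integrals converge.) -/
def HasWeakPartial (u : Positions N → ℂ) (i : Fin N) (c : Fin 3) (g : Positions N → ℂ) : Prop :=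
  ∀ φ : Positions N → ℝ, ContDiff ℝ ∞ φ → HasCompactSupport φ →
    ∫ x, (fderiv ℝ φ x (direction i c)) • u x = - ∫ x, φ x • g x

open Classical in
/-- The weak partial derivative of `u`, if it exists in `L²`; it is then unique up to a null set.
(Only used where it exists.) -/
def weakPartial (u : Positions N → ℂ) (i : Fin N) (c : Fin 3) : Positions N → ℂ :=
  if h : ∃ g : Positions N → ℂ, MemLp g 2 volume ∧ HasWeakPartial u i c g then h.choose else 0

/-! ### Wavefunctions and their densities -/

/-- The `N`-body position density `ρ_N^Ψ(x) = ∑_s |Ψ(x, s)|²`. -/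
def positionDensity (Ψ : WaveFunction N) (x : Positions N) : ℝ :=
  ∑ s : Spins N, ‖Ψ x s‖ ^ 2

/-- `Ψ(z_{σ(1)}, …, z_{σ(N)}) = sgn(σ) Ψ(z₁, …, z_N)` for all permutations `σ`, where
`z_i = (x_i, s_i)`. Elements of `L²` being defined up to null sets, this is required for almost
every `x`. -/
def IsAntisymmetric (Ψ : WaveFunction N) : Prop :=
  ∀ σ : Equiv.Perm (Fin N), ∀ᵐ x : Positions N, ∀ s : Spins N,
    Ψ (x ∘ σ) (s ∘ σ) = ((Equiv.Perm.sign σ : ℤ) : ℂ) * Ψ x s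

/-- The class `𝒜_N` of admissible wavefunctions: `Ψ ∈ L²`, `∇Ψ ∈ L²`, `Ψ` antisymmetric,
`‖Ψ‖_{L²} = 1`. -/
structure IsAdmissible (Ψ : WaveFunction N) : Prop where
  memLp : ∀ s, MemLp (fun x => Ψ x s) 2 volume
  weakPartial_memLp : ∀ s i c, ∃ g : Positions N → ℂ,
    MemLp g 2 volume ∧ HasWeakPartial (fun x => Ψ x s) i c g
  antisymm : IsAntisymmetric Ψ
  norm_eq_one : ∫ x, positionDensity Ψ x = 1

/-- The configuration with first particle at `x₁` and all others at the positions given by `y`. -/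
def consPosition [NeZero N] (x₁ : Space) (y : {j : Fin N // j ≠ 0} → Space) : Positions N :=
  fun j => if h : j = 0 then x₁ else y ⟨j, h⟩

/-- The one-body density `ρ^Ψ(x₁) = N ∫ ∑_s |Ψ(x₁, s₁, …, x_N, s_N)|² dx₂ … dx_N`. -/
def oneBodyDensity [NeZero N] (Ψ : WaveFunction N) (x₁ : Space) : ℝ :=
  (N : ℝ) * ∫ y : {j : Fin N // j ≠ 0} → Space, positionDensity Ψ (consPosition x₁ y)

/-- `Ψ ↦ ρ`: the one-body density of `Ψ` is `ρ` (as usual up to a null set). -/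
def HasDensity [NeZero N] (Ψ : WaveFunction N) (ρ : Space → ℝ) : Prop :=
  oneBodyDensity Ψ =ᵐ[volume] ρ

/-- The class `ℛ_N` of one-body densities: the image of `𝒜_N` under `Ψ ↦ ρ^Ψ`. -/
def densityClass (N : ℕ) [NeZero N] : Set (Space → ℝ) :=
  {ρ | ∃ Ψ : WaveFunction N, IsAdmissible Ψ ∧ HasDensity Ψ ρ}

/-! ### The constrained-search problem -/

/-- The Coulomb cost `∑_{i<j} 1/|x_i - x_j|`, equal to `∞` if two particles coincide. -/
def coulombCost (x : Positions N) : ℝ≥0∞ :=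
  ∑ i : Fin N, ∑ j ∈ Finset.Ioi i, ‖x i - x j‖ₑ⁻¹

/-- The kinetic energy `T[Ψ] = ∫ ∑_s ∑_i |∇_{x_i} Ψ|²`. -/
def kineticEnergy (Ψ : WaveFunction N) : ℝ≥0∞ :=
  ∫⁻ x, ∑ s : Spins N, ∑ i : Fin N, ∑ c : Fin 3, ‖weakPartial (fun x' => Ψ x' s) i c x‖ₑ ^ 2

/-- The interaction energy `V_ee[Ψ] = ∫ ∑_{i<j} 1/|x_i - x_j| ∑_s |Ψ|²`. -/
def interactionEnergy (Ψ : WaveFunction N) : ℝ≥0∞ :=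
  ∫⁻ x, coulombCost x * ∑ s : Spins N, ‖Ψ x s‖ₑ ^ 2

/-- `Ψ` is a minimizer of `α T + V_ee` over `𝒜_N` subject to `Ψ ↦ ρ`. -/
def IsConstrainedMinimizer [NeZero N] (α : ℝ) (ρ : Space → ℝ) (Ψ : WaveFunction N) : Prop :=
  (IsAdmissible Ψ ∧ HasDensity Ψ ρ) ∧
    ∀ Φ : WaveFunction N, IsAdmissible Φ → HasDensity Φ ρ →
      ENNReal.ofReal α * kineticEnergy Ψ + interactionEnergy Ψ ≤
        ENNReal.ofReal α * kineticEnergy Φ + interactionEnergy Φ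

/-! ### The optimal transport problem -/

/-- `γ` is a symmetric probability measure on `ℝ^{3N}` all of whose `ℝ³`-marginals have density
`ρ / N`. -/
structure IsPlan [NeZero N] (ρ : Space → ℝ) (γ : Measure (Positions N)) : Prop where
  isProbabilityMeasure : IsProbabilityMeasure γ
  symm : ∀ (A : Fin N → Set Space), (∀ i, MeasurableSet (A i)) → ∀ σ : Equiv.Perm (Fin N),
    γ (Set.univ.pi A) = γ (Set.univ.pi fun i => A (σ i))
  marginal : ∀ A : Set Space, MeasurableSet A → γ.real {x | x 0 ∈ A} = ∫ x in A, ρ x / N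

/-- The transport cost `∫ ∑_{i<j} 1/|x_i - x_j| dγ`. -/
def transportCost (γ : Measure (Positions N)) : ℝ≥0∞ := ∫⁻ x, coulombCost x ∂γ

/-- `γ` is a minimizer of the Coulomb optimal transport problem with one-body density `ρ`. -/
def IsOptimalPlan [NeZero N] (ρ : Space → ℝ) (γ : Measure (Positions N)) : Prop :=
  IsPlan ρ γ ∧ ∀ γ' : Measure (Positions N), IsPlan ρ γ' → transportCost γ ≤ transportCost γ'

end HohenbergKohn

end

/-! The position densities of the `Ψ k` are symmetric probability measures with one fixed
one-particle marginal `ρ / N`. Hence they are tight, and a subsequence converges weakly to a plan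
`γ`. The Coulomb cost is a supremum of bounded continuous truncations, so the transport cost is
lower semicontinuous. By minimality, for every admissible `Φ ↦ ρ`, the cost of `γ` is at most `lim
(α T[Φ] + V_ee[Φ]) = V_ee[Φ]`; of `T[Φ]` only finiteness is used. Everything thus rests on a
recovery statement, `exists_wavefunction_interaction_le`: a plan of finite cost can be matched in
cost, up to `ε`, by an admissible wavefunction with exactly the density `ρ`.

Plans may be singular, so they have to be smoothed without disturbing the marginal. Write `ρ = N
u²`, and cut `u²` by a partition of unity into normalized pieces `ψ_c²` supported in small cells,
apart from one exceptional piece of small mass. Where the particles are well separated, the plan is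
replaced by a mixture of products `∏ ψ_{k i}²(X_i)`, weighted by the mass it gives to each block of
cells; this barely changes the Coulomb cost. The small mass that remains is completed to the correct
marginal by an independent coupling. The energy of that coupling is small because the Newtonian
potential of `u²` on small balls is uniformly small.

To make the square root of this mixture antisymmetric it is multiplied by a Vandermonde determinant
in a unimodular function `E`, with all spins equal. If `E^a conj(E)^b` has mean zero in each `ψ_c²`
for distinct `a, b < N`, the determinant integrates out and the one-body density is exactly that of
the mixture. Such an `E` comes from the distribution function of the first coordinate under `u²`,
which is Lipschitz. Multiplied by a large integer frequency, it makes the relevant modes of each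
cell so small that a slight change of the cell removes them.

Sobolev regularity is handled through quadratic bounds on translation increments in `L²`. These pass
to norms, Lipschitz multiples and tensor products by elementary inequalities, so no chain rule is
needed. -/

noncomputable section

namespace HohenbergKohn

set_option linter.unusedSectionVars false

/-! ### Weak derivatives in `L²` and translation increments -/

section Translation

variable {E : Type*} [NormedAddCommGroup E] [NormedSpace ℝ E] [FiniteDimensional ℝ E]
  [MeasurableSpace E] [BorelSpace E] {μ : Measure E} [μ.IsAddHaarMeasure]

/-- Pairing a translated test function with a locally integrable function is differentiable in the
translation parameter. -/
theorem hasDerivAt_integral_translate {φ u : E → ℂ} (hφ : ContDiff ℝ ∞ φ)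
    (hc : HasCompactSupport φ) (hu : LocallyIntegrable u μ) (v : E) (t : ℝ) :
    HasDerivAt (fun t : ℝ => ∫ x, φ (x - t • v) * u x ∂μ)
      (-∫ x, fderiv ℝ φ (x - t • v) v * u x ∂μ) t := by
  -- After reflecting `φ`, the pairing is the convolution `u ⋆ g` evaluated at `t • v`, so
  -- differentiability of convolutions applies; the reflection accounts for the sign.
  set g : E → ℂ := fun y => φ (-y) with hg
  have hgc : HasCompactSupport g := hc.comp_homeomorph (Homeomorph.neg E)
  have hgd : ContDiff ℝ 1 g := (hφ.comp contDiff_neg).of_le (by exact_mod_cast le_top)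
  have key := hgc.hasFDerivAt_convolution_right (ContinuousLinearMap.mul ℝ ℂ) hu hgd (t • v)
  have h2 : HasDerivAt (fun t : ℝ => t • v) v t := by
    simpa using (hasDerivAt_id t).smul_const v
  have h3 := key.comp_hasDerivAt t h2
  rw [convolution_precompR_apply _ hu (hgc.fderiv ℝ) (hgd.continuous_fderiv one_ne_zero)] at h3
  have hfd : ∀ y, fderiv ℝ g y v = - fderiv ℝ φ (-y) v := by
    intro y
    have h4 : HasFDerivAt g ((fderiv ℝ φ (-y)).comp (-ContinuousLinearMap.id ℝ E)) y :=
      ((hφ.differentiable (by simp)) (-y)).hasFDerivAt.comp y (hasFDerivAt_id y).neg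
    rw [h4.fderiv]; simp
  have e1 : (convolution u g (ContinuousLinearMap.mul ℝ ℂ) μ ∘ fun t : ℝ => t • v)
      = fun t : ℝ => ∫ x, φ (x - t • v) * u x ∂μ := by
    funext s
    simp only [Function.comp, convolution_def, ContinuousLinearMap.mul_apply', hg, neg_sub]
    exact integral_congr_ae (ae_of_all _ fun x => mul_comm _ _)
  have e2 : convolution u (fun a => fderiv ℝ g a v) (ContinuousLinearMap.mul ℝ ℂ) μ (t • v)
      = -∫ x, fderiv ℝ φ (x - t • v) v * u x ∂μ := by
    simp only [convolution_def, ContinuousLinearMap.mul_apply', hfd, neg_sub]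
    rw [← integral_neg]
    exact integral_congr_ae (ae_of_all _ fun x => by simp only; ring)
  rw [e1, e2] at h3
  exact h3

/-- A quantitative `L²` bound on the increments of `u` in the direction `v`. -/
def HasTranslationBound (μ : Measure E) {F : Type*} [NormedAddCommGroup F] (u : E → F) (v : E) :
    Prop :=
  ∃ C : NNReal, ∀ t : ℝ, ∫⁻ x, ‖u (x + t • v) - u x‖ₑ ^ 2 ∂μ ≤ C * ‖t‖ₑ ^ 2

theorem memLp_translate {F : Type*} [NormedAddCommGroup F] {u : E → F} {p : ℝ≥0∞}
    (hu : MemLp u p μ) (a : E) : MemLp (fun x => u (x + a)) p μ :=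
  hu.comp_measurePreserving (measurePreserving_add_right μ a)

theorem eLpNorm_two_sq {α : Type*} [MeasurableSpace α] {F : Type*} [NormedAddCommGroup F]
    (μ : Measure α) (f : α → F) : eLpNorm f 2 μ ^ 2 = ∫⁻ x, ‖f x‖ₑ ^ 2 ∂μ := by
  have := eLpNorm_nnreal_pow_eq_lintegral (f := f) (μ := μ) (p := 2) (by norm_num)
  simpa using this

theorem integral_mul_translate_sub {φ u : E → ℂ} (hφ : Continuous φ)
    (hc : HasCompactSupport φ) (hu : LocallyIntegrable u μ) (a : E) :
    ∫ x, φ x * (u (x + a) - u x) ∂μ = ∫ x, φ (x - a) * u x ∂μ - ∫ x, φ x * u x ∂μ := by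
  have hi : Integrable (fun x => φ x * u x) μ :=
    hu.integrable_smul_left_of_hasCompactSupport hφ hc
  have hi2 : Integrable (fun x => φ (x - a) * u x) μ :=
    hu.integrable_smul_left_of_hasCompactSupport (g := fun x => φ (x - a))
      (hφ.comp (continuous_sub_right a)) (hc.comp_homeomorph (Homeomorph.subRight a))
  have hi3 : Integrable (fun x => φ x * u (x + a)) μ := by
    have := hi2.comp_add_right a
    simpa using this
  have : ∫ x, φ x * u (x + a) ∂μ = ∫ x, φ (x - a) * u x ∂μ := by
    rw [← integral_add_right_eq_self (fun x => φ (x - a) * u x) a]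
    simp
  simp_rw [mul_sub]
  rw [integral_sub hi3 hi, this]

theorem norm_integral_mul_le {φ g : E → ℂ} (hφ : MemLp φ 2 μ) (hg : MemLp g 2 μ) :
    ‖∫ x, φ x * g x ∂μ‖ ≤ (eLpNorm φ 2 μ).toReal * (eLpNorm g 2 μ).toReal := by
  have h1 := eLpNorm_smul_le_mul_eLpNorm (p := 2) (q := 2) (r := 1) hg.1 hφ.1
  rw [← ENNReal.toReal_mul]
  refine (norm_integral_le_lintegral_norm _).trans ?_
  refine ENNReal.toReal_mono (ENNReal.mul_ne_top hφ.eLpNorm_ne_top hg.eLpNorm_ne_top) ?_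
  refine le_trans (le_of_eq ?_) h1
  rw [eLpNorm_one_eq_lintegral_enorm]
  simp [Pi.smul_apply']

/-- The `L²` norm is controlled by pairings with test functions. -/
theorem eLpNorm_le_of_forall_test {w : E → ℂ} (hw : MemLp w 2 μ) {K : ℝ} (hK0 : 0 ≤ K)
    (h : ∀ φ : E → ℂ, ContDiff ℝ ∞ φ → HasCompactSupport φ →
      ‖∫ x, φ x * w x ∂μ‖ ≤ K * (eLpNorm φ 2 μ).toReal) :
    (eLpNorm w 2 μ).toReal ≤ K := by
  have hK : ∀ f : Lp ℂ 2 μ, ‖inner ℂ f (hw.toLp w)‖ ≤ K * ‖f‖ := by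
    have hcl : IsClosed {f : Lp ℂ 2 μ | ‖inner ℂ f (hw.toLp w)‖ ≤ K * ‖f‖} :=
      isClosed_le (by fun_prop) (by fun_prop)
    have hd := Lp.dense_hasCompactSupport_contDiff (F := ℂ) (μ := μ) (p := 2) (by simp)
    intro f
    refine hcl.closure_subset_iff.2 ?_ (hd f)
    rintro f ⟨φ, hfφ, hc, hs⟩
    have h1 := h (fun x => starRingEnd ℂ (φ x)) (Complex.conjCLE.contDiff.comp hs)
      (hc.comp_left (g := starRingEnd ℂ) (by simp))
    have h2 : eLpNorm (fun x => starRingEnd ℂ (φ x)) 2 μ = eLpNorm f 2 μ := by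
      rw [eLpNorm_congr_ae hfφ]
      exact eLpNorm_congr_norm_ae (ae_of_all _ fun x => by simp)
    rw [h2, ← Lp.norm_def] at h1
    refine le_trans (le_of_eq ?_) h1
    rw [L2.inner_def]
    congr 1
    refine integral_congr_ae ?_
    filter_upwards [hfφ, hw.coeFn_toLp] with x hx hx2
    simp [hx, hx2, RCLike.inner_apply, mul_comm]
  -- By density the bound holds for every `L²` function; testing with `w` itself gives `‖w‖² ≤ K
  -- ‖w‖`.
  have h1 := hK (hw.toLp w)
  rw [← Lp.norm_toLp w hw]
  rw [inner_self_eq_norm_sq_to_K] at h1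
  simp only [norm_pow, RCLike.norm_ofReal, abs_norm] at h1
  rcases (norm_nonneg (hw.toLp w)).eq_or_lt with h0 | h0
  · rwa [← h0]
  · nlinarith

/-- Weak derivatives are tested against real functions only, whereas `L²` duality needs complex
ones; the real and imaginary parts are treated separately. -/
theorem integral_fderiv_mul_eq_of_weak {u g : E → ℂ} (hu : LocallyIntegrable u μ)
    (hg : LocallyIntegrable g μ) {v : E}
    (h : ∀ φ : E → ℝ, ContDiff ℝ ∞ φ → HasCompactSupport φ →
      ∫ x, (fderiv ℝ φ x v) • u x ∂μ = -∫ x, φ x • g x ∂μ)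
    {φ : E → ℂ} (hφ : ContDiff ℝ ∞ φ) (hc : HasCompactSupport φ) :
    ∫ x, fderiv ℝ φ x v * u x ∂μ = -∫ x, φ x * g x ∂μ := by
  have hre : ContDiff ℝ ∞ (fun x => (φ x).re) := Complex.reCLM.contDiff.comp hφ
  have him : ContDiff ℝ ∞ (fun x => (φ x).im) := Complex.imCLM.contDiff.comp hφ
  have hcre : HasCompactSupport (fun x => (φ x).re) := hc.comp_left (g := Complex.re) rfl
  have hcim : HasCompactSupport (fun x => (φ x).im) := hc.comp_left (g := Complex.im) rfl
  have hd : ∀ x, HasFDerivAt φ (fderiv ℝ φ x) x := fun x =>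
    (hφ.differentiable (by simp) x).hasFDerivAt
  have dre : ∀ x, fderiv ℝ (fun x => (φ x).re) x v = (fderiv ℝ φ x v).re := fun x => by
    have := (Complex.reCLM.hasFDerivAt.comp x (hd x)).fderiv
    exact congrArg (fun L => L v) this
  have dim : ∀ x, fderiv ℝ (fun x => (φ x).im) x v = (fderiv ℝ φ x v).im := fun x => by
    have := (Complex.imCLM.hasFDerivAt.comp x (hd x)).fderiv
    exact congrArg (fun L => L v) this
  have key : ∀ {ψ : E → ℝ} {f : E → ℂ}, Continuous ψ → HasCompactSupport ψ →
      LocallyIntegrable f μ → Integrable (fun x => ψ x • f x) μ := fun h1 h2 h3 =>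
    h3.integrable_smul_left_of_hasCompactSupport h1 h2
  have hcont : ∀ {ψ : E → ℝ}, ContDiff ℝ ∞ ψ → Continuous (fun x => fderiv ℝ ψ x v) := fun h =>
    (h.continuous_fderiv (by simp)).clm_apply continuous_const
  have i1 := key (hcont hre) (hcre.fderiv_apply ℝ v) hu
  have i2 := key (hcont him) (hcim.fderiv_apply ℝ v) hu
  have i3 := key hre.continuous hcre hg
  have i4 := key him.continuous hcim hg
  have e1 : ∀ x, fderiv ℝ φ x v * u x = (fderiv ℝ (fun x => (φ x).re) x v) • u x
      + Complex.I * ((fderiv ℝ (fun x => (φ x).im) x v) • u x) := fun x => by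
    rw [dre, dim]
    conv_lhs => rw [← Complex.re_add_im (fderiv ℝ φ x v)]
    simp only [Complex.real_smul]; ring
  have e2 : ∀ x, φ x * g x = (φ x).re • g x + Complex.I * ((φ x).im • g x) := fun x => by
    conv_lhs => rw [← Complex.re_add_im (φ x)]
    simp only [Complex.real_smul]; ring
  simp_rw [e1, e2]
  rw [integral_add i1 (i2.const_mul _), integral_add i3 (i4.const_mul _), integral_const_mul,
    integral_const_mul, h _ hre hcre, h _ him hcim]
  ring

theorem eLpNorm_translate {F : Type*} [NormedAddCommGroup F] {u : E → F}
    (hu : AEStronglyMeasurable u μ) (p : ℝ≥0∞) (a : E) :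
    eLpNorm (fun x => u (x - a)) p μ = eLpNorm u p μ :=
  eLpNorm_comp_measurePreserving hu (measurePreserving_sub_right μ a)

/-- A function in `L²` with a weak directional derivative in `L²` satisfies a translation bound. -/
theorem hasTranslationBound_of_weak {u g : E → ℂ} (hu : MemLp u 2 μ) (hg : MemLp g 2 μ) {v : E}
    (h : ∀ φ : E → ℝ, ContDiff ℝ ∞ φ → HasCompactSupport φ →
      ∫ x, (fderiv ℝ φ x v) • u x ∂μ = -∫ x, φ x • g x ∂μ) :
    HasTranslationBound μ u v := by
  have hul := hu.locallyIntegrable (by norm_num)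
  have hgl := hg.locallyIntegrable (by norm_num)
  set G := (eLpNorm g 2 μ).toReal with hG
  refine ⟨(eLpNorm g 2 μ).toNNReal ^ 2, fun t => ?_⟩
  have hw : MemLp (fun x => u (x + t • v) - u x) 2 μ := (memLp_translate hu _).sub hu
  have main : (eLpNorm (fun x => u (x + t • v) - u x) 2 μ).toReal ≤ |t| * G := by
    refine eLpNorm_le_of_forall_test hw (by positivity) fun φ hφ hc => ?_
    rw [integral_mul_translate_sub hφ.continuous hc hul]
    have hφ2 : MemLp φ 2 μ := hφ.continuous.memLp_of_hasCompactSupport hc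
    -- Tested against `φ`, the increment is the increment in `t` of `∫ φ(x - tv) u`, whose
    -- derivative is a pairing with `g` and is bounded by `‖φ‖ ‖g‖`. The mean value inequality
    -- concludes.
    have hmv := Convex.norm_image_sub_le_of_norm_hasDerivWithin_le (𝕜 := ℝ)
      (f := fun t : ℝ => ∫ x, φ (x - t • v) * u x ∂μ) (s := Set.univ) (x := 0) (y := t)
      (C := (eLpNorm φ 2 μ).toReal * G)
      (fun s _ => (hasDerivAt_integral_translate hφ hc hul v s).hasDerivWithinAt) ?_
      convex_univ trivial trivial
    · simp only [zero_smul, sub_zero, Real.norm_eq_abs] at hmv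
      linarith
    · intro s _
      have hφs : ContDiff ℝ ∞ (fun x => φ (x - s • v)) := hφ.comp (contDiff_id.sub contDiff_const)
      have hcs : HasCompactSupport (fun x => φ (x - s • v)) :=
        hc.comp_homeomorph (Homeomorph.subRight (s • v))
      have := integral_fderiv_mul_eq_of_weak hul hgl h hφs hcs
      simp_rw [fderiv_comp_sub] at this
      rw [this, neg_neg, ← eLpNorm_translate hφ2.1 2 (s • v)]
      exact norm_integral_mul_le (hφs.continuous.memLp_of_hasCompactSupport hcs) hg
  rw [← eLpNorm_two_sq]
  have : eLpNorm (fun x => u (x + t • v) - u x) 2 μ ≤ ‖t‖ₑ * eLpNorm g 2 μ := by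
    rw [← ENNReal.toReal_le_toReal hw.eLpNorm_ne_top (ENNReal.mul_ne_top (by simp)
      hg.eLpNorm_ne_top), ENNReal.toReal_mul]
    simpa using main
  calc _ ≤ (‖t‖ₑ * eLpNorm g 2 μ) ^ 2 := by gcongr
    _ = _ := by
      rw [mul_pow, mul_comm, ENNReal.coe_pow, ENNReal.coe_toNNReal hg.eLpNorm_ne_top]

/-- A function in `L²` with a translation bound has a weak directional derivative in `L²`. -/
theorem exists_weak_of_hasTranslationBound {u : E → ℂ} (hu : MemLp u 2 μ) {v : E}
    (h : HasTranslationBound μ u v) :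
    ∃ g : E → ℂ, MemLp g 2 μ ∧ ∀ φ : E → ℝ, ContDiff ℝ ∞ φ → HasCompactSupport φ →
      ∫ x, (fderiv ℝ φ x v) • u x ∂μ = -∫ x, φ x • g x ∂μ := by
  obtain ⟨C, hC⟩ := h
  have hul := hu.locallyIntegrable (by norm_num)
  set τ : ℕ → ℝ := fun n => ((n : ℝ) + 1)⁻¹ with hτ
  have hτ0 : ∀ n, 0 < τ n := fun n => by positivity
  set q : ℕ → E → ℂ := fun n => ((τ n)⁻¹ : ℂ) • fun x => u (x + τ n • v) - u x with hqd
  have hq : ∀ n, MemLp (q n) 2 μ := fun n => ((memLp_translate hu _).sub hu).const_smul _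
  have hb : ∀ n, ‖(hq n).toLp‖ ≤ NNReal.sqrt C := by
    intro n
    rw [Lp.norm_toLp]
    refine ENNReal.toReal_le_coe_of_le_coe ?_
    have h1 : eLpNorm (q n) 2 μ ^ 2 ≤ ((NNReal.sqrt C : NNReal) : ℝ≥0∞) ^ 2 := by
      rw [hqd, eLpNorm_const_smul, mul_pow, eLpNorm_two_sq]
      calc _ ≤ ‖((τ n)⁻¹ : ℂ)‖ₑ ^ 2 * (C * ‖τ n‖ₑ ^ 2) := by gcongr; exact hC _
        _ = C * (‖((τ n)⁻¹ : ℂ)‖ₑ * ‖τ n‖ₑ) ^ 2 := by ring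
        _ = C := by
          have : ‖((τ n)⁻¹ : ℂ)‖ₑ * ‖τ n‖ₑ = 1 := by
            rw [← enorm_norm, norm_inv, Complex.norm_real, ← enorm_norm (τ n), ← enorm_mul,
              inv_mul_cancel₀ (by simpa using (hτ0 n).ne')]
            simp
          rw [this]; simp
        _ = _ := by rw [← ENNReal.coe_pow, NNReal.sq_sqrt]
    exact (ENNReal.pow_le_pow_left_iff two_ne_zero).1 h1
  set Q : ℕ → WeakDual ℂ (Lp ℂ 2 μ) := fun n =>
    StrongDual.toWeakDual (innerSL ℂ ((hq n).toLp)) with hQ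
  -- The difference quotients lie in a fixed ball of the dual, which is weak-* compact by
  -- Banach–Alaoglu. A limit along a non-principal ultrafilter replaces the extraction of a
  -- subsequence, and the Riesz representative of `G` is the weak derivative.
  obtain ⟨G, -, hG⟩ := (WeakDual.isCompact_closedBall (0 : StrongDual ℂ (Lp ℂ 2 μ))
    (NNReal.sqrt C)).ultrafilter_le_nhds' ((hyperfilter ℕ).map Q) (by
      rw [Ultrafilter.mem_map]
      refine Filter.univ_mem' fun n => ?_
      simpa [hQ] using hb n)
  have hG' : Tendsto Q (hyperfilter ℕ) (𝓝 G) := hG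
  set γ : Lp ℂ 2 μ := (InnerProductSpace.toDual ℂ _).symm (WeakDual.toStrongDual G) with hγ
  refine ⟨γ, Lp.memLp γ, fun φ hφ hc => ?_⟩
  set f : E → ℂ := fun x => (φ x : ℂ) with hf
  have hfs : ContDiff ℝ ∞ f := Complex.ofRealCLM.contDiff.comp hφ
  have hfc : HasCompactSupport f := hc.comp_left (g := fun r : ℝ => (r : ℂ)) (by simp)
  have hf2 : MemLp f 2 μ := hfs.continuous.memLp_of_hasCompactSupport hfc
  have hinner : ∀ w : Lp ℂ 2 μ, inner ℂ w hf2.toLp = starRingEnd ℂ (∫ x, f x * w x ∂μ) := by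
    intro w
    rw [L2.inner_def, ← integral_conj]
    refine integral_congr_ae ?_
    filter_upwards [hf2.coeFn_toLp] with x hx
    rw [hx]
    simp [RCLike.inner_apply, hf]
  have t1 : Tendsto (fun n => inner ℂ (hq n).toLp hf2.toLp) (hyperfilter ℕ)
      (𝓝 (inner ℂ γ hf2.toLp)) := by
    have := ((WeakDual.eval_continuous (hf2.toLp)).tendsto G).comp hG'
    have e : inner ℂ γ hf2.toLp = G hf2.toLp := by
      rw [← InnerProductSpace.toDual_apply_apply, hγ, LinearIsometryEquiv.apply_symm_apply]
      rfl
    rw [e]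
    exact this
  have hder := hasDerivAt_integral_translate hfs hfc hul v 0
  have t2 : Tendsto (fun n => ∫ x, f x * q n x ∂μ) atTop (𝓝 (-∫ x, fderiv ℝ f x v * u x ∂μ)) := by
    have h1 := hder.tendsto_slope_zero_right
    have h2 : Tendsto τ atTop (𝓝[>] 0) :=
      tendsto_nhdsWithin_iff.2 ⟨by simpa [hτ] using tendsto_one_div_add_atTop_nhds_zero_nat (𝕜 := ℝ),
        Eventually.of_forall hτ0⟩
    have h3 := h1.comp h2
    simp only [zero_smul, sub_zero, zero_add] at h3
    refine h3.congr fun n => ?_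
    simp only [Function.comp]
    rw [← integral_mul_translate_sub hfs.continuous hfc hul, ← integral_smul]
    refine integral_congr_ae (ae_of_all _ fun x => ?_)
    simp only [hqd, Pi.smul_apply, smul_eq_mul, Complex.real_smul]
    push_cast; ring
  have t3 : Tendsto (fun n => inner ℂ (hq n).toLp hf2.toLp) (hyperfilter ℕ)
      (𝓝 (starRingEnd ℂ (-∫ x, fderiv ℝ f x v * u x ∂μ))) := by
    refine ((Complex.continuous_conj.tendsto _).comp
      (t2.mono_left Nat.hyperfilter_le_atTop)).congr fun n => ?_
    simp only [Function.comp]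
    rw [hinner]
    congr 1
    refine integral_congr_ae ?_
    filter_upwards [(hq n).coeFn_toLp] with x hx
    rw [hx]
  have := tendsto_nhds_unique t1 t3
  rw [hinner] at this
  have h5 := (starRingEnd ℂ).injective this
  have h6 : ∀ x, fderiv ℝ f x v = ((fderiv ℝ φ x v : ℝ) : ℂ) := fun x => by
    have := (Complex.ofRealCLM.hasFDerivAt.comp x
      (hφ.differentiable (by simp) x).hasFDerivAt).fderiv
    exact congrArg (fun L => L v) this
  simp only [h6] at h5
  simp only [Complex.real_smul]
  rw [← neg_eq_iff_eq_neg.2 h5]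

end Translation

/-! ### The square root of the one-body density -/

theorem measurePreserving_consPosition (N : ℕ) [NeZero N] :
    MeasurePreserving (fun p : Space × ({j : Fin N // j ≠ 0} → Space) => consPosition p.1 p.2)
      (volume.prod volume) volume := by
  have h1 := (volume_preserving_piEquivPiSubtypeProd (fun _ : Fin N => Space) (fun j => j = 0)).symm
  have h2 : MeasurePreserving (MeasurableEquiv.funUnique {j : Fin N // j = 0} Space).symm volume
      (@volume _ (@MeasureSpace.pi {j : Fin N // j = 0} (Subtype.fintype fun j => j = 0)
        (fun _ => Space) fun _ => measureSpaceOfInnerProductSpace)) := by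
    convert (volume_preserving_funUnique {j : Fin N // j = 0} Space).symm
  have h3 := MeasurePreserving.comp (μb := Measure.prod _ _) h1 (h2.prod (MeasurePreserving.id
    (volume : Measure ({j : Fin N // j ≠ 0} → Space))))
  exact h3

theorem consPosition_add [h : NeZero N] (x : Space) (y : {j : Fin N // j ≠ 0} → Space) (t : ℝ)
    (c : Fin 3) : consPosition (x + t • EuclideanSpace.single c (1 : ℝ)) y
      = consPosition x y + t • direction 0 c := by
  funext j
  by_cases hj : j = 0
  · subst hj; simp [consPosition, direction]
  · simp [consPosition, direction, hj]

/-- Infinite values do no harm: if `d` is finite, `a` and `b` are infinite together, and both then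
have `toReal` zero. -/
theorem enorm_toReal_sub_le {a b d : ℝ≥0∞} (h1 : a ≤ b + d) (h2 : b ≤ a + d) :
    ‖a.toReal - b.toReal‖ₑ ≤ d := by
  by_cases hd : d = ⊤
  · simp [hd]
  by_cases ha : a = ⊤
  · have : b = ⊤ := by
      by_contra hb
      exact (ENNReal.add_lt_top.2 ⟨Ne.lt_top hb, Ne.lt_top hd⟩).not_ge (ha ▸ h1)
    simp [ha, this]
  by_cases hb : b = ⊤
  · exact absurd (hb ▸ h2) (ENNReal.add_lt_top.2 ⟨Ne.lt_top ha, Ne.lt_top hd⟩).not_ge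
  lift a to NNReal using ha
  lift b to NNReal using hb
  lift d to NNReal using hd
  norm_cast at h1 h2
  rw [Real.enorm_eq_ofReal_abs, ENNReal.ofReal_le_iff_le_toReal (by simp), abs_sub_le_iff]
  have h1' : (a : ℝ) ≤ b + d := by exact_mod_cast h1
  have h2' : (b : ℝ) ≤ a + d := by exact_mod_cast h2
  constructor <;> simp <;> linarith

/-- The reverse triangle inequality in `L²`. Through it `√(ρ/N)` inherits the regularity of the
wavefunction without differentiating a square root. -/
theorem enorm_eLpNorm_sub_sq_le {α F : Type*} [MeasurableSpace α] {μ : Measure α}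
    [NormedAddCommGroup F] {p q : α → F} (hp : AEStronglyMeasurable p μ)
    (hq : AEStronglyMeasurable q μ) :
    ‖(eLpNorm p 2 μ).toReal - (eLpNorm q 2 μ).toReal‖ₑ ^ 2 ≤ ∫⁻ x, ‖p x - q x‖ₑ ^ 2 ∂μ := by
  refine le_trans ?_ (eLpNorm_two_sq μ (p - q)).le
  gcongr
  refine enorm_toReal_sub_le ?_ ?_
  · simpa using eLpNorm_add_le hq (hp.sub hq) one_le_two
  · rw [eLpNorm_sub_comm]
    simpa using eLpNorm_add_le hp (hq.sub hp) one_le_two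

theorem enorm_toLp_sq {ι : Type*} [Fintype ι] {F : Type*} [NormedAddCommGroup F] (f : ι → F) :
    ‖(WithLp.toLp 2 f : PiLp 2 fun _ : ι => F)‖ₑ ^ 2 = ∑ s, ‖f s‖ₑ ^ 2 := by
  have h : ∀ {G : Type _} [NormedAddCommGroup G] (x : G), ‖x‖ₑ ^ 2 = ENNReal.ofReal (‖x‖ ^ 2) := by
    intro G _ x
    rw [ENNReal.ofReal_pow (norm_nonneg _), ofReal_norm]
  rw [h, PiLp.norm_sq_eq_of_L2, ENNReal.ofReal_sum_of_nonneg (fun _ _ => by positivity)]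
  exact Finset.sum_congr rfl fun s _ => by
    rw [ENNReal.ofReal_pow (norm_nonneg _), ofReal_norm]

/-- Densities of admissible wavefunctions are squares of functions with translation bounds. -/
theorem exists_sqrt_density {N : ℕ} [NeZero N] {ρ : Space → ℝ} (hρ : ρ ∈ densityClass N) :
    ∃ u : Space → ℝ, Measurable u ∧ (∀ x, 0 ≤ u x) ∧ (ρ =ᵐ[volume] fun x => N * u x ^ 2) ∧
      ∫⁻ x, ‖u x‖ₑ ^ 2 = 1 ∧
      ∀ c, HasTranslationBound volume u (EuclideanSpace.single c (1 : ℝ)) := by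
  obtain ⟨Ψ, hΨ, hd⟩ := hρ
  set f : Spins N → Positions N → ℂ := fun s => (hΨ.memLp s).1.mk with hf
  have hfm : ∀ s, Measurable (f s) := fun s => (hΨ.memLp s).1.stronglyMeasurable_mk.measurable
  have hfe : ∀ s, (fun x => Ψ x s) =ᵐ[volume] f s := fun s => (hΨ.memLp s).1.ae_eq_mk
  set V : Positions N → EuclideanSpace ℂ (Spins N) := fun x => WithLp.toLp 2 fun s => f s x with hV
  have hVm : Measurable V := (WithLp.measurable_toLp 2 _).comp (measurable_pi_lambda _ hfm)
  have hmp := measurePreserving_consPosition N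
  have hcm := hmp.measurable
  have hVc : ∀ x, Measurable fun y : {j : Fin N // j ≠ 0} → Space => V (consPosition x y) :=
    fun x => hVm.comp (hcm.comp measurable_prodMk_left)
  -- `U x` is the norm of the wavefunction in `L²` of the remaining positions and all spins, so `ρ =
  -- N U²`. Working with a measurable representative makes every slice measurable.
  set U : Space → ℝ≥0∞ := fun x =>
    eLpNorm (fun y : {j : Fin N // j ≠ 0} → Space => V (consPosition x y)) 2 volume with hU
  have hU2 : ∀ x, U x ^ 2 = ∫⁻ y : {j : Fin N // j ≠ 0} → Space, ‖V (consPosition x y)‖ₑ ^ 2 :=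
    fun x => eLpNorm_two_sq _ _
  have hUm : Measurable U := by
    have h1 : Measurable fun x => U x ^ 2 := by
      simp_rw [hU2]
      exact Measurable.lintegral_prod_right' (f := fun p : Space × ({j : Fin N // j ≠ 0} → Space) =>
        ‖V (consPosition p.1 p.2)‖ₑ ^ 2) ((hVm.comp hcm).enorm.pow_const 2)
    have h2 : U = fun x => (U x ^ 2) ^ ((2 : ℝ)⁻¹) := by
      funext x
      rw [← ENNReal.rpow_natCast, ← ENNReal.rpow_mul]; norm_num
    rw [h2]; exact h1.pow_const _
  have hpd : (fun x => ENNReal.ofReal (positionDensity Ψ x)) =ᵐ[volume] fun x => ‖V x‖ₑ ^ 2 := by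
    filter_upwards [ae_all_iff.2 hfe] with x hx
    rw [hV, enorm_toLp_sq, positionDensity, ENNReal.ofReal_sum_of_nonneg (fun _ _ => by positivity)]
    refine Finset.sum_congr rfl fun s _ => ?_
    rw [ENNReal.ofReal_pow (norm_nonneg _), ofReal_norm, hx s]
  have hpi : Integrable (positionDensity Ψ) := by
    by_contra h
    have := hΨ.norm_eq_one
    rw [integral_undef h] at this
    exact zero_ne_one this
  have hpn : ∀ x, 0 ≤ positionDensity Ψ x := fun x => Finset.sum_nonneg fun _ _ => by positivity
  have hUone : ∫⁻ x, U x ^ 2 = 1 := by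
    simp_rw [hU2]
    rw [← lintegral_prod (f := fun p : Space × ({j : Fin N // j ≠ 0} → Space) =>
      ‖V (consPosition p.1 p.2)‖ₑ ^ 2) ((hVm.comp hcm).enorm.pow_const 2).aemeasurable,
      hmp.lintegral_comp (f := fun x => ‖V x‖ₑ ^ 2) (hVm.enorm.pow_const 2),
      ← lintegral_congr_ae hpd, ← ofReal_integral_eq_lintegral_ofReal hpi (ae_of_all _ hpn),
      hΨ.norm_eq_one, ENNReal.ofReal_one]
  have hUfin : ∀ᵐ x, U x < ⊤ := by
    have := ae_lt_top (hUm.pow_const 2) (by rw [hUone]; simp)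
    filter_upwards [this] with x hx
    by_contra h
    simp [not_lt_top_iff.1 h] at hx
  have hpd' := Measure.ae_ae_of_ae_prod (hmp.quasiMeasurePreserving.ae hpd)
  refine ⟨fun x => (U x).toReal, hUm.ennreal_toReal, fun x => ENNReal.toReal_nonneg, ?_, ?_, ?_⟩
  · refine hd.symm.trans ?_
    filter_upwards [hpd'] with x hx
    rw [oneBodyDensity, ← ENNReal.toReal_pow, hU2, ← lintegral_congr_ae hx]
    congr 1
    rw [← integral_toReal]
    · exact integral_congr_ae (ae_of_all _ fun y => by
        simp [ENNReal.toReal_ofReal (hpn _)])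
    · exact AEMeasurable.congr ((hVc x).enorm.pow_const 2).aemeasurable (EventuallyEq.symm hx)
    · exact ae_of_all _ fun y => ENNReal.ofReal_lt_top
  · rw [← hUone]
    refine lintegral_congr_ae ?_
    filter_upwards [hUfin] with x hx
    rw [Real.enorm_eq_ofReal ENNReal.toReal_nonneg, ENNReal.ofReal_toReal hx.ne]
  · intro c
    have hft : ∀ s, HasTranslationBound volume (f s) (direction 0 c) := by
      intro s
      obtain ⟨g, hg, hw⟩ := hΨ.weakPartial_memLp s 0 c
      refine hasTranslationBound_of_weak ((memLp_congr_ae (hfe s)).1 (hΨ.memLp s)) hg ?_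
      intro φ hφ hc
      rw [← hw φ hφ hc]
      refine integral_congr_ae ?_
      filter_upwards [hfe s] with x hx
      rw [hx]
    choose C hC using hft
    refine ⟨∑ s, C s, fun t => ?_⟩
    set e : Space := EuclideanSpace.single c (1 : ℝ)
    have hpt : ∀ x, ‖(U (x + t • e)).toReal - (U x).toReal‖ₑ ^ 2 ≤
        ∫⁻ y, ‖V (consPosition x y + t • direction 0 c) - V (consPosition x y)‖ₑ ^ 2 := by
      intro x
      have hm1 := (hVc (x + t • e)).aestronglyMeasurable (μ := volume)
      have hm2 := (hVc x).aestronglyMeasurable (μ := volume)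
      simp_rw [← consPosition_add]
      exact enorm_eLpNorm_sub_sq_le hm1 hm2
    refine (lintegral_mono hpt).trans ?_
    have hDm : Measurable fun x : Positions N => ‖V (x + t • direction 0 c) - V x‖ₑ ^ 2 :=
      ((hVm.comp (measurable_add_const _)).sub hVm).enorm.pow_const 2
    rw [← lintegral_prod (f := fun p : Space × ({j : Fin N // j ≠ 0} → Space) =>
      ‖V (consPosition p.1 p.2 + t • direction 0 c) - V (consPosition p.1 p.2)‖ₑ ^ 2)
      (hDm.comp hcm).aemeasurable,
      hmp.lintegral_comp (f := fun x => ‖V (x + t • direction 0 c) - V x‖ₑ ^ 2) hDm]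
    have : ∀ x, ‖V (x + t • direction 0 c) - V x‖ₑ ^ 2 =
        ∑ s, ‖f s (x + t • direction 0 c) - f s x‖ₑ ^ 2 := fun x => by
      rw [← enorm_toLp_sq]; rfl
    simp_rw [this]
    rw [lintegral_finsetSum _ fun s _ =>
      (show Measurable fun x => ‖f s (x + t • direction 0 c) - f s x‖ₑ ^ 2 from
      (((hfm s).comp (measurable_add_const _)).sub (hfm s)).enorm.pow_const 2)]
    push_cast
    rw [Finset.sum_mul]
    exact Finset.sum_le_sum fun s _ => hC s t

/-! ### Non-concentration of the density: potentials of small balls -/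

theorem enorm_add_sq_le {F : Type*} [NormedAddCommGroup F] (p q : F) :
    ‖p + q‖ₑ ^ 2 ≤ 2 * (‖p‖ₑ ^ 2 + ‖q‖ₑ ^ 2) := by
  have h1 : ‖p + q‖ₑ ^ 2 ≤ (‖p‖ₑ + ‖q‖ₑ) ^ 2 := by gcongr; exact enorm_add_le _ _
  refine h1.trans ?_
  have := ENNReal.rpow_add_le_mul_rpow_add_rpow ‖p‖ₑ ‖q‖ₑ (p := 2) one_le_two
  norm_num at this
  exact_mod_cast this

/-- Translation bounds in the coordinate directions give a translation bound in all directions. -/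
theorem exists_translation_bound_norm {u : Space → ℝ} (hum : Measurable u)
    (hu : ∀ c, HasTranslationBound volume u (EuclideanSpace.single c (1 : ℝ))) :
    ∃ C : NNReal, ∀ z : Space, ∫⁻ x, ‖u (x + z) - u x‖ₑ ^ 2 ≤ C * ‖z‖ₑ ^ 2 := by
  choose C hC using hu
  have hadd : ∀ a b : Space, ∫⁻ x, ‖u (x + (a + b)) - u x‖ₑ ^ 2 ≤
      2 * ((∫⁻ x, ‖u (x + a) - u x‖ₑ ^ 2) + ∫⁻ x, ‖u (x + b) - u x‖ₑ ^ 2) := by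
    intro a b
    have hm : ∀ z : Space, Measurable fun x => ‖u (x + z) - u x‖ₑ ^ 2 := fun z =>
      ((hum.comp (measurable_add_const z)).sub hum).enorm.pow_const 2
    rw [← lintegral_add_right_eq_self (fun x => ‖u (x + a) - u x‖ₑ ^ 2) b,
      ← lintegral_add_right _ (hm b), ← lintegral_const_mul' _ _ (by simp)]
    refine lintegral_mono fun x => ?_
    refine le_trans (le_of_eq ?_) (enorm_add_sq_le _ _)
    congr 2
    rw [show x + (a + b) = x + b + a by abel]; ring
  refine ⟨2 * C 0 + 4 * C 1 + 4 * C 2, fun z => ?_⟩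
  have hz : z = z 0 • EuclideanSpace.single 0 (1 : ℝ) + (z 1 • EuclideanSpace.single 1 (1 : ℝ) +
      z 2 • EuclideanSpace.single 2 (1 : ℝ)) := by
    ext i; fin_cases i <;> simp
  have hle : ∀ c, ∫⁻ x, ‖u (x + z c • EuclideanSpace.single c (1 : ℝ)) - u x‖ₑ ^ 2
      ≤ C c * ‖z‖ₑ ^ 2 := fun c => by
    refine (hC c _).trans ?_
    gcongr
    exact enorm_le_iff_norm_le.2 (PiLp.norm_apply_le z c)
  conv_lhs => rw [hz]
  refine (hadd _ _).trans ?_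
  calc _ ≤ 2 * (C 0 * ‖z‖ₑ ^ 2 + 2 * (C 1 * ‖z‖ₑ ^ 2 + C 2 * ‖z‖ₑ ^ 2)) := by
        gcongr
        · exact hle 0
        · refine (hadd _ _).trans ?_
          gcongr
          · exact hle 1
          · exact hle 2
    _ = _ := by push_cast; ring

/-- Comparing a function on a small ball with its averages over larger scales. -/
theorem lintegral_ball_sq_le {u : Space → ℝ} (hum : Measurable u) (hu1 : ∫⁻ x, ‖u x‖ₑ ^ 2 = 1)
    {C : NNReal} (hC : ∀ z : Space, ∫⁻ x, ‖u (x + z) - u x‖ₑ ^ 2 ≤ C * ‖z‖ₑ ^ 2)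
    (p : Space) (j : ℕ) :
    ∫⁻ x in Metric.ball p ((1 / 2) ^ (5 * j)), ‖u x‖ₑ ^ 2 ≤ (2 + 2 * C) * (2⁻¹) ^ (6 * j) := by
  -- The two scales balance the errors: `(r / s)³` and `s²` both equal `2^(-6j)`. The mass of a ball
  -- is thus `O(r^(6/5))`; all that matters later is that the exponent exceeds 1.
  set r : ℝ := (1 / 2) ^ (5 * j)
  set s : ℝ := (1 / 2) ^ (3 * j)
  set B := Metric.ball p r
  set S := Metric.ball (0 : Space) s
  have hs0 : 0 < s := by positivity
  have hvS0 : volume S ≠ 0 := (Metric.measure_ball_pos volume 0 hs0).ne'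
  have hvS : volume S ≠ ⊤ := measure_ball_lt_top.ne
  have hvol : volume B = 2⁻¹ ^ (6 * j) * volume S := by
    have hb := Measure.addHaar_ball volume p (show 0 ≤ r by positivity)
    have hs := Measure.addHaar_ball volume (0 : Space) (show 0 ≤ s by positivity)
    rw [hb, hs, ← mul_assoc]
    congr 1
    simp only [finrank_euclideanSpace, Fintype.card_fin, r, s]
    rw [show (2⁻¹ : ℝ≥0∞) = ENNReal.ofReal (1 / 2) by
      rw [one_div, ENNReal.ofReal_inv_of_pos two_pos]; simp, ← ENNReal.ofReal_pow (by norm_num),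
      ← ENNReal.ofReal_mul (by positivity)]
    congr 1; ring
  have hm2 : Measurable fun x => ‖u x‖ₑ ^ 2 := hum.enorm.pow_const 2
  set M := ∫⁻ x in B, ‖u x‖ₑ ^ 2
  have h1 : ∀ z ∈ S, M ≤ 2 * (∫⁻ x in B, ‖u (x + z)‖ₑ ^ 2) + 2 * C * 2⁻¹ ^ (6 * j) := by
    intro z hz
    have hzs : ‖z‖ₑ ^ 2 ≤ 2⁻¹ ^ (6 * j) := by
      have : ‖z‖ₑ ≤ 2⁻¹ ^ (3 * j) := by
        rw [show (2⁻¹ : ℝ≥0∞) = ENNReal.ofReal (1 / 2) by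
          rw [one_div, ENNReal.ofReal_inv_of_pos two_pos]; simp, ← ENNReal.ofReal_pow (by norm_num),
          ← ofReal_norm]
        exact ENNReal.ofReal_le_ofReal (mem_ball_zero_iff.1 hz).le
      calc _ ≤ ((2⁻¹ : ℝ≥0∞) ^ (3 * j)) ^ 2 := by gcongr
        _ = _ := by rw [← pow_mul]; congr 1; ring
    have hpt : ∀ x, ‖u x‖ₑ ^ 2 ≤ 2 * ‖u (x + z)‖ₑ ^ 2 + 2 * ‖u (x + z) - u x‖ₑ ^ 2 := fun x => by
      have := enorm_add_sq_le (u (x + z)) (-(u (x + z) - u x))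
      rw [enorm_neg, mul_add] at this
      simpa using this
    have hm3 : Measurable fun x => 2 * ‖u (x + z)‖ₑ ^ 2 :=
      (hm2.comp (measurable_add_const z)).const_mul 2
    calc M ≤ ∫⁻ x in B, (2 * ‖u (x + z)‖ₑ ^ 2 + 2 * ‖u (x + z) - u x‖ₑ ^ 2) := lintegral_mono hpt
      _ = 2 * (∫⁻ x in B, ‖u (x + z)‖ₑ ^ 2) + 2 * ∫⁻ x in B, ‖u (x + z) - u x‖ₑ ^ 2 := by
        rw [lintegral_add_left hm3, lintegral_const_mul' _ _ (by simp),
          lintegral_const_mul' _ _ (by simp)]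
      _ ≤ _ := by
        rw [mul_assoc 2]
        gcongr
        exact (setLIntegral_le_lintegral _ _).trans ((hC z).trans (by gcongr))
  -- Integrate `h1` over `z ∈ S`. After exchanging integrals, each `x ∈ B` contributes at most `∫ u²
  -- = 1` to the first term.
  have h2 : M * volume S ≤ 2 * volume B + 2 * C * 2⁻¹ ^ (6 * j) * volume S := by
    calc M * volume S = ∫⁻ _ in S, M := by simp
      _ ≤ ∫⁻ z in S, (2 * (∫⁻ x in B, ‖u (x + z)‖ₑ ^ 2) + 2 * C * 2⁻¹ ^ (6 * j)) :=
        setLIntegral_mono' measurableSet_ball h1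
      _ = 2 * (∫⁻ z in S, ∫⁻ x in B, ‖u (x + z)‖ₑ ^ 2) + 2 * C * 2⁻¹ ^ (6 * j) * volume S := by
        rw [lintegral_add_right _ measurable_const, lintegral_const_mul' _ _ (by simp)]; simp
      _ ≤ _ := by
        gcongr
        rw [lintegral_lintegral_swap (by
          exact (hm2.comp (measurable_snd.add measurable_fst)).aemeasurable)]
        calc _ ≤ ∫⁻ x in B, 1 := by
              refine lintegral_mono fun x => ?_
              refine (setLIntegral_le_lintegral _ _).trans ?_
              rw [lintegral_add_left_eq_self (fun y => ‖u y‖ₑ ^ 2) x, hu1]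
          _ = volume B := by simp
  rw [hvol] at h2
  have h3 : M * volume S ≤ (2 + 2 * C) * 2⁻¹ ^ (6 * j) * volume S := h2.trans (le_of_eq (by ring))
  exact (ENNReal.mul_le_mul_iff_left hvS0 hvS).1 h3

/-- The Newtonian potential of `u²` restricted to a small ball is uniformly small. -/
theorem exists_potential_ball_le {u : Space → ℝ} (hum : Measurable u)
    (hu1 : ∫⁻ x, ‖u x‖ₑ ^ 2 = 1)
    (hu : ∀ c, HasTranslationBound volume u (EuclideanSpace.single c (1 : ℝ)))
    {ε : ℝ≥0∞} (hε : ε ≠ 0) :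
    ∃ r : ℝ, 0 < r ∧ ∀ p : Space,
      ∫⁻ x in Metric.ball p r, ‖x - p‖ₑ⁻¹ * ‖u x‖ₑ ^ 2 ≤ ε := by
  obtain ⟨C, hC⟩ := exists_translation_bound_norm hum hu
  set K : ℝ≥0∞ := 32 * (2 + 2 * C) * 2 with hK
  have hKt : K ≠ ⊤ := by finiteness
  obtain ⟨J, hJ⟩ : ∃ J : ℕ, K * 2⁻¹ ^ J ≤ ε := by
    have h1 : Tendsto (fun J : ℕ => K * (2⁻¹ : ℝ≥0∞) ^ J) atTop (𝓝 (K * 0)) :=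
      ENNReal.Tendsto.const_mul (ENNReal.tendsto_pow_atTop_nhds_zero_of_lt_one (by simp))
        (Or.inr hKt)
    rw [mul_zero] at h1
    obtain ⟨J, hJ⟩ := (h1.eventually (ge_mem_nhds (pos_iff_ne_zero.2 hε))).exists
    exact ⟨J, hJ⟩
  refine ⟨(1 / 2) ^ (5 * J), by positivity, fun p => ?_⟩
  set B : ℕ → Set Space := fun i => Metric.ball p ((1 / 2) ^ (5 * (J + i))) with hB
  have hm2 : Measurable fun x => ‖u x‖ₑ ^ 2 := hum.enorm.pow_const 2
  -- If `B i` is the smallest of the balls containing `x`, then `x` lies outside the next one and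
  -- the kernel is at most `2^(5(J+i+1))`. Enlarging the shells to full balls costs nothing in the
  -- estimate.
  have hpt : ∀ x ∈ Metric.ball p ((1 / 2) ^ (5 * J)), x ≠ p → ‖x - p‖ₑ⁻¹ * ‖u x‖ₑ ^ 2 ≤
      ∑' i, (B i).indicator (fun x => 2 ^ (5 * (J + i + 1)) * ‖u x‖ₑ ^ 2) x := by
    intro x hx hxp
    have hpos : 0 < ‖x - p‖ := norm_pos_iff.2 (sub_ne_zero.2 hxp)
    have hex : ∃ i : ℕ, ((1 : ℝ) / 2) ^ (5 * (J + i)) ≤ ‖x - p‖ := by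
      obtain ⟨n, hn⟩ := exists_pow_lt_of_lt_one hpos (show (1 / 2 : ℝ) < 1 by norm_num)
      refine ⟨n, le_trans ?_ hn.le⟩
      exact pow_le_pow_of_le_one (by norm_num) (by norm_num) (by omega)
    classical
    have hi0 : Nat.find hex ≠ 0 := by
      intro h0
      have := Nat.find_spec hex
      rw [h0, add_zero] at this
      exact absurd (mem_ball_iff_norm.1 hx) this.not_gt
    obtain ⟨i, hi⟩ := Nat.exists_eq_succ_of_ne_zero hi0
    have h1 : ‖x - p‖ < (1 / 2) ^ (5 * (J + i)) := not_le.1 (Nat.find_min hex (by omega))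
    have h2 := Nat.find_spec hex
    rw [hi] at h2
    refine le_trans ?_ (ENNReal.le_tsum i)
    rw [Set.indicator_of_mem (mem_ball_iff_norm.2 h1)]
    gcongr
    rw [ENNReal.inv_le_iff_inv_le, ENNReal.inv_pow, ← ofReal_norm,
      show (2⁻¹ : ℝ≥0∞) = ENNReal.ofReal (1 / 2) by
      rw [one_div, ENNReal.ofReal_inv_of_pos two_pos]; simp, ← ENNReal.ofReal_pow (by norm_num)]
    exact ENNReal.ofReal_le_ofReal h2
  calc _ ≤ ∫⁻ x in Metric.ball p ((1 / 2) ^ (5 * J)), 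
        ∑' i, (B i).indicator (fun x => 2 ^ (5 * (J + i + 1)) * ‖u x‖ₑ ^ 2) x := by
        refine lintegral_mono_ae ?_
        have hne : ∀ᵐ x : Space, x ≠ p := by simp [ae_iff]
        filter_upwards [ae_restrict_mem measurableSet_ball, ae_restrict_of_ae hne] with x hx hx2
          using hpt x hx hx2
    _ ≤ ∫⁻ x, ∑' i, (B i).indicator (fun x => 2 ^ (5 * (J + i + 1)) * ‖u x‖ₑ ^ 2) x :=
        setLIntegral_le_lintegral _ _
    _ = ∑' i, 2 ^ (5 * (J + i + 1)) * ∫⁻ x in B i, ‖u x‖ₑ ^ 2 := by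
        rw [lintegral_tsum fun i => ((hm2.const_mul _).indicator measurableSet_ball).aemeasurable]
        congr 1; funext i
        rw [lintegral_indicator measurableSet_ball, lintegral_const_mul _ hm2]
    -- The kernel `32 · 2^(5(J+i))` against a mass of order `2^(-6(J+i))` leaves the geometric
    -- factor `2^(-(J+i))`.
    _ ≤ ∑' i : ℕ, 32 * (2 + 2 * (C : ℝ≥0∞)) * 2⁻¹ ^ J * 2⁻¹ ^ i := by
        refine ENNReal.tsum_le_tsum fun i => ?_
        refine (mul_le_mul_right (lintegral_ball_sq_le hum hu1 hC p (J + i)) _).trans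
          (le_of_eq ?_)
        have h4 : (2 : ℝ≥0∞) ^ (5 * (J + i)) * 2⁻¹ ^ (5 * (J + i)) = 1 := by
          rw [← mul_pow, ENNReal.mul_inv_cancel (by simp) (by simp), one_pow]
        calc _ = 32 * (2 + 2 * C) * (2⁻¹ ^ J * 2⁻¹ ^ i) *
            ((2 : ℝ≥0∞) ^ (5 * (J + i)) * 2⁻¹ ^ (5 * (J + i))) := by ring
          _ = _ := by rw [h4]; ring
    _ = K * 2⁻¹ ^ J := by
        rw [ENNReal.tsum_mul_left, ENNReal.tsum_geometric, ENNReal.one_sub_inv_two, inv_inv, hK]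
        ring
    _ ≤ ε := hJ

/-! ### Slab bounds and an equidistributing phase -/

/-- Young's inequality for `(b - a)(b + a)`. The weight `h` is chosen because squared increments
under a shift by `h` integrate to `O(h²)`; both terms then become `O(h)`. -/
theorem two_mul_enorm_sq_sub_sq_le (a b : ℝ) {h : ℝ} (hh : 0 < h) :
    ‖b ^ 2 - a ^ 2‖ₑ ≤ ENNReal.ofReal h⁻¹ * ‖b - a‖ₑ ^ 2 +
      ENNReal.ofReal h * (2 * (‖a‖ₑ ^ 2 + ‖b‖ₑ ^ 2)) := by
  have e : ∀ x : ℝ, ‖x‖ₑ ^ 2 = ENNReal.ofReal (x ^ 2) := fun x => by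
    rw [Real.enorm_eq_ofReal_abs, ← ENNReal.ofReal_pow (abs_nonneg _), sq_abs]
  rw [e, e, e, ← ENNReal.ofReal_add (by positivity) (by positivity),
    show (2 : ℝ≥0∞) = ENNReal.ofReal 2 by simp, ← ENNReal.ofReal_mul (p := 2) zero_le_two,
    ← ENNReal.ofReal_mul (p := h) hh.le, ← ENNReal.ofReal_mul (p := h⁻¹) (by positivity),
    ← ENNReal.ofReal_add (by positivity) (by positivity), Real.enorm_eq_ofReal_abs]
  refine ENNReal.ofReal_le_ofReal ?_
  have h1 : b ^ 2 - a ^ 2 = (b - a) * (b + a) := by ring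
  have h2 : h⁻¹ * (b - a) ^ 2 + h * (b + a) ^ 2 ≥ 2 * |(b - a) * (b + a)| := by
    have h3 : 0 ≤ h⁻¹ * (|b - a| - h * |b + a|) ^ 2 := by positivity
    have h4 : h⁻¹ * (|b - a| - h * |b + a|) ^ 2 =
        h⁻¹ * |b - a| ^ 2 + h * |b + a| ^ 2 - 2 * (|b - a| * |b + a|) := by field_simp; ring
    rw [abs_mul]
    rw [h4, sq_abs, sq_abs] at h3
    linarith
  have h5 : (b + a) ^ 2 ≤ 2 * (a ^ 2 + b ^ 2) := by nlinarith [sq_nonneg (a - b)]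
  have h6 := mul_le_mul_of_nonneg_left h5 hh.le
  rw [h1]
  have := abs_nonneg ((b - a) * (b + a))
  linarith

/-- The mass of `u²` in a slab orthogonal to the first axis is at most a constant times its
thickness. -/
theorem exists_slab_bound {u : Space → ℝ} (hum : Measurable u) (hu1 : ∫⁻ x, ‖u x‖ₑ ^ 2 = 1)
    (hu : HasTranslationBound volume u (EuclideanSpace.single 0 (1 : ℝ))) :
    ∃ L : NNReal, ∀ (t h : ℝ), 0 < h →
      ∫⁻ x in {x : Space | t < x 0 ∧ x 0 ≤ t + h}, ‖u x‖ₑ ^ 2 ≤ L * ENNReal.ofReal h := by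
  obtain ⟨C, hC⟩ := hu
  refine ⟨C + 4, fun t h hh => ?_⟩
  set e : Space := EuclideanSpace.single 0 (1 : ℝ) with he
  have hm2 : Measurable fun x => ‖u x‖ₑ ^ 2 := hum.enorm.pow_const 2
  set S : ℕ → Set Space := fun j => {x : Space | t + j * h < x 0 ∧ x 0 ≤ t + (j + 1) * h} with hS
  have hc0 : Measurable fun x : Space => x 0 := by fun_prop
  have hSm : ∀ j, MeasurableSet (S j) := fun j =>
    (measurableSet_lt measurable_const hc0).inter (measurableSet_le hc0 measurable_const)
  have hSd : Pairwise (Function.onFun Disjoint S) := by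
    intro i j hij
    wlog hlt : i < j generalizing i j
    · exact (this hij.symm (lt_of_le_of_ne (not_lt.1 hlt) hij.symm)).symm
    refine Set.disjoint_left.2 fun x hx hy => ?_
    have h1 : ((i : ℝ) + 1) * h ≤ j * h := by
      gcongr; exact_mod_cast hlt
    have := hx.2; have := hy.1; linarith
  set a : ℕ → ℝ≥0∞ := fun j => ∫⁻ x in S j, ‖u x‖ₑ ^ 2 with ha
  set D : Space → ℝ≥0∞ := fun x => ‖u (x + h • e) ^ 2 - u x ^ 2‖ₑ with hD
  -- Shifting by `h e` carries each slab to the next and loses at most `∫ D` over that slab. The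
  -- slabs are disjoint and their masses tend to zero, so telescoping bounds the first mass by the
  -- integral of `D` over the whole space.
  have hstep : ∀ j, a j ≤ a (j + 1) + ∫⁻ x in S j, D x := by
    intro j
    have h1 : a (j + 1) = ∫⁻ x in S j, ‖u (x + h • e)‖ₑ ^ 2 := by
      have hpre : (fun x => x + h • e) ⁻¹' S (j + 1) = S j := by
        ext x
        simp only [hS, Set.mem_preimage, Set.mem_ofPred_eq, PiLp.add_apply, PiLp.smul_apply, he,
          PiLp.single_apply]
        push_cast
        simp only [smul_eq_mul, mul_one]
        constructor <;> rintro ⟨h1, h2⟩ <;> constructor <;> linarith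
      rw [← hpre]
      exact ((measurePreserving_add_right volume (h • e)).setLIntegral_comp_preimage
        (hSm (j + 1)) hm2).symm
    rw [h1, ← lintegral_add_left (show Measurable fun x => ‖u (x + h • e)‖ₑ ^ 2 from
      hm2.comp (measurable_add_const _))]
    refine lintegral_mono fun x => ?_
    simp only [hD, ← enorm_pow]
    have := enorm_sub_le (E := ℝ) (a := u (x + h • e) ^ 2) (b := u (x + h • e) ^ 2 - u x ^ 2)
    simpa using this
  have hsum : ∀ n, a 0 ≤ a n + ∑ j ∈ Finset.range n, ∫⁻ x in S j, D x := by
    intro n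
    induction n with
    | zero => simp
    | succ n ih =>
      refine ih.trans ?_
      rw [Finset.sum_range_succ]
      calc _ ≤ a (n + 1) + (∫⁻ x in S n, D x) + ∑ j ∈ Finset.range n, ∫⁻ x in S j, D x := by
            gcongr; exact hstep n
        _ = _ := by ring
  have hsumD : ∀ n, ∑ j ∈ Finset.range n, ∫⁻ x in S j, D x ≤ ∫⁻ x, D x := by
    intro n
    refine (ENNReal.sum_le_tsum _).trans ?_
    rw [← lintegral_iUnion hSm hSd]
    exact setLIntegral_le_lintegral _ _
  have hat : Tendsto a atTop (𝓝 0) := by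
    refine ENNReal.tendsto_atTop_zero_of_tsum_ne_top ?_
    rw [← lintegral_iUnion hSm hSd]
    exact ((setLIntegral_le_lintegral _ _).trans_lt (by rw [hu1]; simp)).ne
  have hfin : a 0 ≤ ∫⁻ x, D x := by
    have h1 : Tendsto (fun n => a n + ∫⁻ x, D x) atTop (𝓝 (0 + ∫⁻ x, D x)) := hat.add_const _
    rw [zero_add] at h1
    exact ge_of_tendsto' h1 fun n => (hsum n).trans (by gcongr; exact hsumD n)
  have hDle : ∫⁻ x, D x ≤ (C + 4 : NNReal) * ENNReal.ofReal h := by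
    calc ∫⁻ x, D x ≤ ∫⁻ x, (ENNReal.ofReal h⁻¹ * ‖u (x + h • e) - u x‖ₑ ^ 2 +
          ENNReal.ofReal h * (2 * (‖u x‖ₑ ^ 2 + ‖u (x + h • e)‖ₑ ^ 2))) :=
          lintegral_mono fun x => two_mul_enorm_sq_sub_sq_le _ _ hh
      _ = ENNReal.ofReal h⁻¹ * (∫⁻ x, ‖u (x + h • e) - u x‖ₑ ^ 2) + ENNReal.ofReal h * 4 := by
          rw [lintegral_add_left (show Measurable fun x =>
              ENNReal.ofReal h⁻¹ * ‖u (x + h • e) - u x‖ₑ ^ 2 from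
              (((hum.comp (measurable_add_const _)).sub hum).enorm.pow_const 2).const_mul _),
            lintegral_const_mul' _ _ (by simp), lintegral_const_mul' _ _ (by simp),
            lintegral_const_mul' _ _ (by simp), lintegral_add_left hm2,
            lintegral_add_right_eq_self (fun x => ‖u x‖ₑ ^ 2), hu1]
          norm_num
      _ ≤ ENNReal.ofReal h⁻¹ * (C * ‖h‖ₑ ^ 2) + ENNReal.ofReal h * 4 := by gcongr; exact hC h
      _ = _ := by
          have : ENNReal.ofReal h⁻¹ * ENNReal.ofReal h = 1 := by
            rw [← ENNReal.ofReal_mul (by positivity), inv_mul_cancel₀ hh.ne', ENNReal.ofReal_one]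
          rw [Real.enorm_eq_ofReal hh.le]
          push_cast
          calc _ = C * ENNReal.ofReal h * (ENNReal.ofReal h⁻¹ * ENNReal.ofReal h)
                + ENNReal.ofReal h * 4 := by ring
            _ = _ := by rw [this]; ring
  refine le_trans (le_of_eq ?_) (hfin.trans hDle)
  simp [ha, hS]

/-- A continuous distribution function pushes its measure forward to the uniform measure. -/
theorem map_cdf_eq_uniform (μ : Measure ℝ) [IsProbabilityMeasure μ]
    (hc : Continuous (ProbabilityTheory.cdf μ)) :
    μ.map (ProbabilityTheory.cdf μ) = volume.restrict (Set.Icc 0 1) := by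
  set G := ProbabilityTheory.cdf μ with hG
  have hGm : Measurable G := hc.measurable
  have := Measure.isProbabilityMeasure_map (μ := μ) hGm.aemeasurable
  refine Measure.ext_of_Iic _ _ fun a => ?_
  rw [Measure.map_apply hGm measurableSet_Iic, Measure.restrict_apply measurableSet_Iic]
  have h0 : ∀ t, 0 ≤ G t := ProbabilityTheory.cdf_nonneg μ
  have h1 : ∀ t, G t ≤ 1 := ProbabilityTheory.cdf_le_one μ
  have hmono : Monotone G := ProbabilityTheory.monotone_cdf μ
  rcases lt_or_ge a 0 with ha | ha
  · have e1 : G ⁻¹' Set.Iic a = ∅ := by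
      ext t; simpa using ha.trans_le (h0 t)
    have e2 : Set.Iic a ∩ Set.Icc 0 1 = ∅ := by
      ext t; simp only [Set.mem_inter_iff, Set.mem_Iic, Set.mem_Icc, Set.mem_empty_iff_false]
      constructor
      · rintro ⟨h, h', -⟩; linarith
      · exact False.elim
    rw [e1, e2]; simp
  rcases le_or_gt 1 a with ha1 | ha1
  · have e1 : G ⁻¹' Set.Iic a = Set.univ := by
      ext t; simpa using (h1 t).trans ha1
    have e2 : Set.Iic a ∩ Set.Icc 0 1 = Set.Icc 0 1 :=
      Set.inter_eq_right.2 fun t ht => ht.2.trans ha1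
    rw [e1, e2]; simp
  have e2 : Set.Iic a ∩ Set.Icc 0 1 = Set.Icc 0 a := by
    ext t; simp only [Set.mem_inter_iff, Set.mem_Iic, Set.mem_Icc]
    constructor
    · rintro ⟨h, h', -⟩; exact ⟨h', h⟩
    · rintro ⟨h, h'⟩; exact ⟨h', h, by linarith⟩
  rw [e2, Real.volume_Icc, sub_zero]
  set A := G ⁻¹' Set.Iic a with hA
  have htop : ∃ b, a < G b :=
    ((ProbabilityTheory.tendsto_cdf_atTop μ).eventually (lt_mem_nhds ha1)).exists
  rcases A.eq_empty_or_nonempty with hne | hne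
  · have : a = 0 := by
      by_contra h
      have hpos : 0 < a := lt_of_le_of_ne ha (Ne.symm h)
      obtain ⟨b, hb⟩ := ((ProbabilityTheory.tendsto_cdf_atBot μ).eventually
        (gt_mem_nhds hpos)).exists
      have : b ∈ A := le_of_lt hb
      rw [hne] at this
      exact this
    rw [hne, this]; simp
  · obtain ⟨b, hb⟩ := htop
    have hbd : BddAbove A := ⟨b, fun t ht => by
      by_contra! hlt
      exact absurd (hmono hlt.le) (not_le.2 (lt_of_le_of_lt ht hb))⟩
    have hcl : IsClosed A := isClosed_Iic.preimage hc
    have hmem := hcl.csSup_mem hne hbd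
    set s := sSup A
    have hAs : A = Set.Iic s := by
      ext t
      exact ⟨fun ht => le_csSup hbd ht, fun ht => (hmono ht).trans hmem⟩
    -- Continuity enters here: the level `a` is attained, so `G` equals `a` at the right end `s` of
    -- its sublevel set.
    obtain ⟨t, ht⟩ := mem_range_of_exists_le_of_exists_ge hc ⟨s, hmem⟩ ⟨b, hb.le⟩
    have hts : t ≤ s := le_csSup hbd (show t ∈ A from ht.le)
    have hGs : G s = a := le_antisymm hmem (ht ▸ hmono hts)
    rw [hAs, ← ProbabilityTheory.ofReal_cdf, ← hG, hGs]

theorem integral_exp_two_pi_mul_eq_zero {m : ℤ} (hm : m ≠ 0) :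
    ∫ s in Set.Icc (0 : ℝ) 1, Complex.exp (2 * Real.pi * Complex.I * m * s) = 0 := by
  have hc : (2 * Real.pi * Complex.I * m : ℂ) ≠ 0 := by
    simp [Real.pi_ne_zero, Complex.I_ne_zero, hm]
  rw [integral_Icc_eq_integral_Ioc, ← intervalIntegral.integral_of_le zero_le_one,
    integral_exp_mul_complex hc]
  have : Complex.exp (2 * Real.pi * Complex.I * m) = 1 := by
    rw [show (2 * Real.pi * Complex.I * m : ℂ) = m * (2 * Real.pi * Complex.I) by ring]
    exact Complex.exp_int_mul_two_pi_mul_I m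
  simp [this]

/-- A Lipschitz phase all of whose nontrivial Fourier modes have mean zero for the density `u²`. -/
theorem exists_equidistributing_phase {u : Space → ℝ} (hum : Measurable u)
    (hu1 : ∫⁻ x, ‖u x‖ₑ ^ 2 = 1)
    (hu : HasTranslationBound volume u (EuclideanSpace.single 0 (1 : ℝ))) :
    ∃ (F : Space → ℝ) (L : ℝ), (∀ x y, |F x - F y| ≤ L * ‖x - y‖) ∧
      ∀ m : ℤ, m ≠ 0 →
        ∫ x, ((u x ^ 2 : ℝ) : ℂ) * Complex.exp (2 * Real.pi * Complex.I * m * F x) = 0 := by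
  obtain ⟨L, hL⟩ := exists_slab_bound hum hu1 hu
  have hm2 : Measurable fun x => ‖u x‖ₑ ^ 2 := hum.enorm.pow_const 2
  set ν : Measure Space := volume.withDensity fun x => ‖u x‖ₑ ^ 2 with hν
  have : IsProbabilityMeasure ν := ⟨by rw [hν, withDensity_apply _ MeasurableSet.univ]; simpa⟩
  have hc0 : Measurable fun x : Space => x 0 := by fun_prop
  set μ : Measure ℝ := ν.map (fun x => x 0) with hμ
  have : IsProbabilityMeasure μ := Measure.isProbabilityMeasure_map hc0.aemeasurable
  set G := ProbabilityTheory.cdf μ with hG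
  have hmono : Monotone G := ProbabilityTheory.monotone_cdf μ
  -- Increments of the distribution function are masses of slabs, so the slab bound is a Lipschitz
  -- bound for `G`.
  have hinc : ∀ s t : ℝ, s ≤ t → |G t - G s| ≤ L * (t - s) := by
    intro s t hst
    rw [abs_of_nonneg (sub_nonneg.2 (hmono hst))]
    rcases hst.eq_or_lt with rfl | hlt
    · simp
    have h1 : μ (Set.Ioc s t) ≤ L * ENNReal.ofReal (t - s) := by
      rw [hμ, Measure.map_apply hc0 measurableSet_Ioc, hν,
        withDensity_apply _ (hc0 measurableSet_Ioc)]
      have e : (fun x : Space => x 0) ⁻¹' Set.Ioc s t = {x | s < x 0 ∧ x 0 ≤ s + (t - s)} := by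
        ext x; simp
      rw [e]
      exact hL s (t - s) (sub_pos.2 hlt)
    rw [← ProbabilityTheory.measure_cdf μ, StieltjesFunction.measure_Ioc,
      ← ENNReal.ofReal_coe_nnreal, ← ENNReal.ofReal_mul L.coe_nonneg] at h1
    exact (ENNReal.ofReal_le_ofReal_iff (mul_nonneg L.coe_nonneg (sub_pos.2 hlt).le)).1 h1
  have hlip : ∀ s t : ℝ, |G t - G s| ≤ L * |t - s| := by
    intro s t
    rcases le_total s t with h | h
    · rw [abs_of_nonneg (sub_nonneg.2 h)]; exact hinc s t h
    · rw [abs_sub_comm, abs_sub_comm t, abs_of_nonneg (sub_nonneg.2 h)]; exact hinc t s h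
  have hcont : Continuous G := by
    have : LipschitzWith L G := LipschitzWith.of_dist_le_mul fun s t => by
      rw [Real.dist_eq, Real.dist_eq]; exact hlip t s
    exact this.continuous
  refine ⟨fun x => G (x 0), L, fun x y => ?_, fun m hm => ?_⟩
  · refine (hlip _ _).trans ?_
    gcongr
    exact PiLp.norm_apply_le (x - y) 0
  · have h1 : ∀ f : Space → ℂ, ∫ x, ((u x ^ 2 : ℝ) : ℂ) * f x = ∫ x, f x ∂ν := by
      intro f
      rw [hν, integral_withDensity_eq_integral_toReal_smul hm2
        (ae_of_all _ fun x => by finiteness)]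
      refine integral_congr_ae (ae_of_all _ fun x => ?_)
      simp [Complex.real_smul]
    rw [h1]
    have hcm : Continuous fun s : ℝ => Complex.exp (2 * Real.pi * Complex.I * m * s) := by fun_prop
    rw [← integral_exp_two_pi_mul_eq_zero hm, ← map_cdf_eq_uniform μ hcont,
      integral_map hcont.measurable.aemeasurable hcm.aestronglyMeasurable, hμ,
      integral_map hc0.aemeasurable
        (show AEStronglyMeasurable (fun s : ℝ => Complex.exp (2 * Real.pi * Complex.I * m * G s)) _
        from (hcm.comp hcont).aestronglyMeasurable)]

/-! ### Tonelli's theorem on configuration space -/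

section LintegralPi

variable {α : Type*} [MeasurableSpace α] (μ : Measure α) [SigmaFinite μ]

theorem lintegral_fin_prod_eq_prod {n : ℕ} (f : Fin n → α → ℝ≥0∞) (hf : ∀ i, Measurable (f i)) :
    ∫⁻ x : Fin n → α, ∏ i, f i (x i) ∂(Measure.pi fun _ => μ) = ∏ i, ∫⁻ x, f i x ∂μ := by
  induction n with
  | zero => simp
  | succ n ih =>
    have hmp := (measurePreserving_piFinSuccAbove (fun _ : Fin (n + 1) => μ) 0).symm
    rw [← hmp.lintegral_comp_emb (MeasurableEquiv.measurableEmbedding _)]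
    rw [Fin.prod_univ_succ, ← ih _ fun i => hf i.succ]
    simp only [MeasurableEquiv.piFinSuccAbove_symm_apply, Fin.insertNthEquiv_apply,
      Fin.prod_univ_succ, Fin.insertNth_zero, Fin.cons_succ, Fin.cons_zero]
    exact lintegral_prod_mul (hf 0).aemeasurable
      (Finset.measurable_prod _ fun i _ => (hf _).comp (measurable_pi_apply i)).aemeasurable

/-- Tonelli's theorem for products of functions of the individual coordinates. -/
theorem lintegral_fintype_prod_eq_prod {ι : Type*} [Fintype ι] (f : ι → α → ℝ≥0∞)
    (hf : ∀ i, Measurable (f i)) :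
    ∫⁻ x : ι → α, ∏ i, f i (x i) ∂(Measure.pi fun _ => μ) = ∏ i, ∫⁻ x, f i x ∂μ := by
  let e := (Fintype.equivFin ι).symm
  rw [← (measurePreserving_piCongrLeft (fun _ => μ) e).lintegral_comp_emb
    (MeasurableEquiv.measurableEmbedding _)]
  simp_rw [← e.prod_comp, MeasurableEquiv.coe_piCongrLeft, Equiv.piCongrLeft_apply_apply]
  exact lintegral_fin_prod_eq_prod μ _ fun i => hf _

end LintegralPi

/-! ### The algebra of bounded Lipschitz functions -/

section BoundedLipschitz

variable {α : Type*} [PseudoMetricSpace α]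

/-- Bounded Lipschitz functions. -/
def IsBoundedLipschitz {A : Type*} [NormedRing A] (f : α → A) : Prop :=
  ∃ C : ℝ, 0 ≤ C ∧ (∀ x, ‖f x‖ ≤ C) ∧ ∀ x y, ‖f x - f y‖ ≤ C * dist x y

namespace IsBoundedLipschitz

variable {A : Type*} [NormedRing A] {f g : α → A}

theorem const (a : A) : IsBoundedLipschitz fun _ : α => a :=
  ⟨‖a‖, norm_nonneg _, fun _ => le_rfl, fun x y => by simp; positivity⟩

theorem add (hf : IsBoundedLipschitz f) (hg : IsBoundedLipschitz g) :
    IsBoundedLipschitz fun x => f x + g x := by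
  obtain ⟨C, hC, h1, h2⟩ := hf
  obtain ⟨D, hD, h3, h4⟩ := hg
  refine ⟨C + D, by positivity, fun x => (norm_add_le _ _).trans (add_le_add (h1 x) (h3 x)),
    fun x y => ?_⟩
  rw [add_sub_add_comm, add_mul]
  exact (norm_add_le _ _).trans (add_le_add (h2 x y) (h4 x y))

theorem mul (hf : IsBoundedLipschitz f) (hg : IsBoundedLipschitz g) :
    IsBoundedLipschitz fun x => f x * g x := by
  obtain ⟨C, hC, h1, h2⟩ := hf
  obtain ⟨D, hD, h3, h4⟩ := hg
  refine ⟨2 * (C * D), by positivity, fun x => ?_, fun x y => ?_⟩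
  · have := (norm_mul_le (f x) (g x)).trans
      (mul_le_mul (h1 x) (h3 x) (norm_nonneg _) hC)
    nlinarith [mul_nonneg hC hD]
  · have e : f x * g x - f y * g y = f x * (g x - g y) + (f x - f y) * g y := by noncomm_ring
    rw [e]
    calc _ ≤ ‖f x‖ * ‖g x - g y‖ + ‖f x - f y‖ * ‖g y‖ :=
          (norm_add_le _ _).trans (add_le_add (norm_mul_le _ _) (norm_mul_le _ _))
      _ ≤ C * (D * dist x y) + C * dist x y * D := by
          gcongr
          · exact h1 x
          · exact h4 x y
          · exact h2 x y
          · exact h3 y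
      _ = _ := by ring

theorem comp {β : Type*} [PseudoMetricSpace β] (hf : IsBoundedLipschitz f) {φ : β → α} {L : ℝ}
    (hφ : ∀ x y, dist (φ x) (φ y) ≤ L * dist x y) : IsBoundedLipschitz fun x => f (φ x) := by
  obtain ⟨C, hC, h1, h2⟩ := hf
  refine ⟨C + C * |L|, by positivity, fun x => (h1 _).trans (by nlinarith [abs_nonneg L]),
    fun x y => (h2 _ _).trans ?_⟩
  calc C * dist (φ x) (φ y) ≤ C * (|L| * dist x y) := by
        gcongr
        exact (hφ x y).trans (by gcongr; exact le_abs_self L)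
    _ ≤ _ := by nlinarith [mul_nonneg hC (dist_nonneg (x := x) (y := y))]

theorem sum {κ : Type*} (s : Finset κ) {f : κ → α → A} (hf : ∀ k ∈ s, IsBoundedLipschitz (f k)) :
    IsBoundedLipschitz fun x => ∑ k ∈ s, f k x := by
  classical
  induction s using Finset.induction_on with
  | empty => simpa using const (0 : A)
  | insert a s ha ih =>
    simp_rw [Finset.sum_insert ha]
    exact (hf a (by simp)).add (ih fun k hk => hf k (by simp [hk]))

theorem prod {B : Type*} [NormedCommRing B] {κ : Type*} (s : Finset κ) {f : κ → α → B}
    (hf : ∀ k ∈ s, IsBoundedLipschitz (f k)) : IsBoundedLipschitz fun x => ∏ k ∈ s, f k x := by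
  classical
  induction s using Finset.induction_on with
  | empty => simpa using const (1 : B)
  | insert a s ha ih =>
    simp_rw [Finset.prod_insert ha]
    exact (hf a (by simp)).mul (ih fun k hk => hf k (by simp [hk]))

theorem pow {B : Type*} [NormedCommRing B] {f : α → B} (hf : IsBoundedLipschitz f) (n : ℕ) :
    IsBoundedLipschitz fun x => f x ^ n := by
  simpa using prod (Finset.range n) (f := fun _ => f) fun _ _ => hf

theorem continuous (hf : IsBoundedLipschitz f) : Continuous f := by
  obtain ⟨C, hC, -, h2⟩ := hf
  refine (LipschitzWith.of_dist_le_mul (K := ⟨C, hC⟩) fun x y => ?_).continuous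
  rw [dist_eq_norm]; exact h2 x y

end IsBoundedLipschitz

end BoundedLipschitz

theorem enorm_mul_le_mul {A : Type*} [NormedRing A] (a b : A) : ‖a * b‖ₑ ≤ ‖a‖ₑ * ‖b‖ₑ := by
  change ((‖a * b‖₊ : ℝ≥0∞)) ≤ ‖a‖₊ * ‖b‖₊
  exact_mod_cast nnnorm_mul_le a b

/-! ### Operations that preserve translation bounds -/

section TranslationClosure

variable {E : Type*} [NormedAddCommGroup E] [NormedSpace ℝ E] [FiniteDimensional ℝ E]
  [MeasurableSpace E] [BorelSpace E] {μ : Measure E} [μ.IsAddHaarMeasure]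

/-- The reverse triangle inequality stands in for the chain rule. This is how the square root of a
sum of squares in `superposition` becomes Sobolev regular. -/
theorem HasTranslationBound.norm {F : Type*} [NormedAddCommGroup F] {u : E → F} {v : E}
    (hu : HasTranslationBound μ u v) : HasTranslationBound μ (fun x => ‖u x‖) v := by
  obtain ⟨C, hC⟩ := hu
  refine ⟨C, fun t => (lintegral_mono fun x => ?_).trans (hC t)⟩
  gcongr
  exact enorm_le_iff_norm_le.2 (abs_norm_sub_norm_le _ _)

theorem HasTranslationBound.isometry {F G : Type*} [NormedAddCommGroup F] [NormedAddCommGroup G]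
    {u : E → F} {v : E} (hu : HasTranslationBound μ u v) (φ : F →+ G) (hφ : ∀ x, ‖φ x‖ = ‖x‖) :
    HasTranslationBound μ (fun x => φ (u x)) v := by
  obtain ⟨C, hC⟩ := hu
  refine ⟨C, fun t => (le_of_eq ?_).trans (hC t)⟩
  refine lintegral_congr fun x => ?_
  rw [← map_sub, ← enorm_norm, hφ, enorm_norm]

/-- A discrete product rule: the increment is the shifted `f` times the increment of `u`, plus the
increment of `f` times `u`. The second term is `O(t)` times `u`, which is why `u` must be square
integrable. -/
theorem HasTranslationBound.mul_left {A : Type*} [NormedRing A] [MeasurableSpace A] [BorelSpace A]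
    {u f : E → A} {v : E} (hu : HasTranslationBound μ u v) (hum : Measurable u)
    (hui : ∫⁻ x, ‖u x‖ₑ ^ 2 ∂μ ≠ ⊤) (hf : IsBoundedLipschitz f) :
    HasTranslationBound μ (fun x => f x * u x) v := by
  obtain ⟨C, hC⟩ := hu
  obtain ⟨D, hD, h1, h2⟩ := hf
  set I := ∫⁻ x, ‖u x‖ₑ ^ 2 ∂μ with hI
  set K : NNReal := 2 * (Real.toNNReal D ^ 2 * C + (Real.toNNReal (D * ‖v‖)) ^ 2 * I.toNNReal)
  refine ⟨K, fun t => ?_⟩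
  have hpt : ∀ x, ‖f (x + t • v) * u (x + t • v) - f x * u x‖ₑ ^ 2 ≤
      2 * (ENNReal.ofReal D ^ 2 * ‖u (x + t • v) - u x‖ₑ ^ 2 +
        (ENNReal.ofReal (D * ‖v‖) * ‖t‖ₑ) ^ 2 * ‖u x‖ₑ ^ 2) := by
    intro x
    have e : f (x + t • v) * u (x + t • v) - f x * u x =
        f (x + t • v) * (u (x + t • v) - u x) + (f (x + t • v) - f x) * u x := by noncomm_ring
    rw [e]
    refine (enorm_add_sq_le _ _).trans ?_
    rw [← mul_pow, ← mul_pow]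
    gcongr
    · refine (enorm_mul_le_mul _ _).trans ?_
      gcongr
      rw [← ofReal_norm]; exact ENNReal.ofReal_le_ofReal (h1 _)
    · refine (enorm_mul_le_mul _ _).trans ?_
      gcongr
      rw [← ofReal_norm, ← ofReal_norm, ← ENNReal.ofReal_mul (by positivity)]
      refine ENNReal.ofReal_le_ofReal ((h2 _ _).trans (le_of_eq ?_))
      rw [dist_eq_norm, add_sub_cancel_left, norm_smul]; ring
  refine (lintegral_mono hpt).trans ?_
  rw [lintegral_const_mul' _ _ (by simp), lintegral_add_right _ ((hum.enorm.pow_const 2).const_mul _),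
    lintegral_const_mul' _ _ (by finiteness), lintegral_const_mul' _ _ (by finiteness)]
  calc _ ≤ 2 * (ENNReal.ofReal D ^ 2 * (C * ‖t‖ₑ ^ 2) +
        (ENNReal.ofReal (D * ‖v‖) * ‖t‖ₑ) ^ 2 * I) := by gcongr; exact hC t
    _ = _ := by
      simp only [K, ENNReal.ofReal]
      push_cast
      rw [ENNReal.coe_toNNReal hui]
      ring

theorem HasTranslationBound.toLp {ι : Type*} [Fintype ι] {F : Type*} [NormedAddCommGroup F]
    [MeasurableSpace F] [BorelSpace F] [SecondCountableTopology F]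
    {u : ι → E → F} {v : E} (hum : ∀ k, Measurable (u k))
    (hu : ∀ k, HasTranslationBound μ (u k) v) :
    HasTranslationBound μ (fun x => (WithLp.toLp 2 fun k => u k x : PiLp 2 fun _ : ι => F)) v := by
  choose C hC using hu
  refine ⟨∑ k, C k, fun t => ?_⟩
  have : ∀ x, ‖(WithLp.toLp 2 fun k => u k (x + t • v) : PiLp 2 fun _ : ι => F) -
      (WithLp.toLp 2 fun k => u k x : PiLp 2 fun _ : ι => F)‖ₑ ^ 2
      = ∑ k, ‖u k (x + t • v) - u k x‖ₑ ^ 2 := fun x => by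
    rw [← enorm_toLp_sq]; rfl
  simp_rw [this]
  rw [lintegral_finsetSum _ fun k _ =>
    (show Measurable fun x => ‖u k (x + t • v) - u k x‖ₑ ^ 2 from
      (((hum k).comp (measurable_add_const _)).sub (hum k)).enorm.pow_const 2)]
  push_cast
  rw [Finset.sum_mul]
  exact Finset.sum_le_sum fun k _ => hC k t

end TranslationClosure

/-- Tensor products inherit translation bounds from their factors. -/
theorem hasTranslationBound_prod {N : ℕ} {ψ : Fin N → Space → ℝ} (hm : ∀ i, Measurable (ψ i))
    (h1 : ∀ i, ∫⁻ x, ‖ψ i x‖ₑ ^ 2 = 1) (i : Fin N) (c : Fin 3)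
    (h : HasTranslationBound volume (ψ i) (EuclideanSpace.single c (1 : ℝ))) :
    HasTranslationBound volume (fun X : Positions N => ∏ j, ψ j (X j)) (direction i c) := by
  obtain ⟨C, hC⟩ := h
  refine ⟨C, fun t => ?_⟩
  set e : Space := EuclideanSpace.single c (1 : ℝ) with he
  -- A shift of one particle alters one factor only, so the increment is again a product, with the
  -- `i`-th factor replaced by its increment.
  set g : Fin N → Space → ℝ :=
    Function.update ψ i (fun x => ψ i (x + t • e) - ψ i x) with hg
  have hgi : g i = fun x => ψ i (x + t • e) - ψ i x := by simp [hg]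
  have hgj : ∀ j, j ≠ i → g j = ψ j := fun j hj => by simp [hg, hj]
  have hgm : ∀ j, Measurable (g j) := fun j => by
    by_cases hj : j = i
    · subst hj; rw [hgi]; exact ((hm j).comp (measurable_add_const _)).sub (hm j)
    · rw [hgj j hj]; exact hm j
  have hpt : ∀ X : Positions N, ∏ j, ψ j ((X + t • direction i c) j) - ∏ j, ψ j (X j)
      = ∏ j, g j (X j) := by
    intro X
    rw [Fintype.prod_eq_mul_prod_compl i, Fintype.prod_eq_mul_prod_compl i,
      Fintype.prod_eq_mul_prod_compl i (fun j => g j (X j)), hgi]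
    have e1 : ∏ j ∈ {i}ᶜ, ψ j ((X + t • direction i c) j) = ∏ j ∈ {i}ᶜ, ψ j (X j) :=
      Finset.prod_congr rfl fun j hj => by
        have : j ≠ i := by simpa using hj
        simp [direction, this]
    have e2 : ∏ j ∈ {i}ᶜ, g j (X j) = ∏ j ∈ {i}ᶜ, ψ j (X j) :=
      Finset.prod_congr rfl fun j hj => by rw [hgj j (by simpa using hj)]
    rw [e1, e2, ← sub_mul]
    simp [direction, he]
  have hpe : ∀ X : Positions N, ‖∏ j, g j (X j)‖ₑ ^ 2 = ∏ j, ‖g j (X j)‖ₑ ^ 2 := fun X => by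
    rw [Finset.prod_pow]
    congr 1
    simp only [← ofReal_norm, norm_prod]
    exact ENNReal.ofReal_prod_of_nonneg fun _ _ => norm_nonneg _
  simp_rw [hpt, hpe]
  rw [volume_pi, lintegral_fintype_prod_eq_prod volume (fun j x => ‖g j x‖ₑ ^ 2)
    fun j => (hgm j).enorm.pow_const 2, Fintype.prod_eq_mul_prod_compl i]
  rw [Finset.prod_eq_one fun j hj => by rw [hgj j (by simpa using hj), h1], mul_one, hgi]
  exact hC t

/-- The normalized Vandermonde determinant of the values of `E` at the particle positions. -/
def vandermondePhase {N : ℕ} (E : Space → ℂ) (X : Positions N) : ℂ :=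
  ((Real.sqrt (N.factorial : ℝ))⁻¹ : ℝ) *
    Matrix.det (Matrix.of fun i j : Fin N => E (X i) ^ (j : ℕ))

/-! ### The antisymmetric factor -/

section Vandermonde

variable {N : ℕ} {E : Space → ℂ}

theorem vandermonde_det_eq_sum (X : Positions N) :
    Matrix.det (Matrix.of fun i j : Fin N => E (X i) ^ (j : ℕ)) =
      ∑ σ : Equiv.Perm (Fin N), ((Equiv.Perm.sign σ : ℤ) : ℂ) * ∏ i, E (X i) ^ (σ i : ℕ) := by
  rw [← Matrix.det_transpose, Matrix.det_apply']
  simp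

theorem vandermondePhase_comp_perm (X : Positions N) (σ : Equiv.Perm (Fin N)) :
    vandermondePhase E (X ∘ σ) = ((Equiv.Perm.sign σ : ℤ) : ℂ) * vandermondePhase E X := by
  have := Matrix.det_permute σ (Matrix.of fun i j : Fin N => E (X i) ^ (j : ℕ))
  rw [vandermondePhase, vandermondePhase, mul_left_comm, ← this]
  rfl

/-- The determinant has `N!` unimodular terms and the squared normalization is `1 / N!`. This crude
bound is used only for the remainder of small mass. -/
theorem enorm_vandermondePhase_sq_le (hE : ∀ x, ‖E x‖ = 1) (X : Positions N) :
    ‖vandermondePhase E X‖ₑ ^ 2 ≤ N.factorial := by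
  have h1 : ‖Matrix.det (Matrix.of fun i j : Fin N => E (X i) ^ (j : ℕ))‖ ≤ N.factorial := by
    rw [vandermonde_det_eq_sum]
    refine (norm_sum_le _ _).trans ?_
    calc _ ≤ ∑ σ : Equiv.Perm (Fin N), (1 : ℝ) := by
          refine Finset.sum_le_sum fun σ _ => ?_
          rw [norm_mul, norm_prod]
          simp only [norm_pow, hE, one_pow, Finset.prod_const_one, mul_one]
          rcases Int.units_eq_one_or (Equiv.Perm.sign σ) with h | h <;> simp [h]
      _ = _ := by simp [Fintype.card_perm]
  have h2 : ‖vandermondePhase E X‖ ^ 2 ≤ N.factorial := by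
    rw [vandermondePhase, norm_mul, mul_pow, Complex.norm_real, norm_inv, inv_pow, Real.norm_eq_abs,
      sq_abs, Real.sq_sqrt (by positivity)]
    have h0 : (0 : ℝ) < N.factorial := by exact_mod_cast N.factorial_pos
    rw [inv_mul_le_iff₀ h0, ← sq]
    gcongr
  rw [← ofReal_norm, ← ENNReal.ofReal_pow (norm_nonneg _)]
  exact (ENNReal.ofReal_le_ofReal h2).trans (le_of_eq (by simp))

theorem isBoundedLipschitz_vandermondePhase (hE : IsBoundedLipschitz E) :
    IsBoundedLipschitz (vandermondePhase (N := N) E) := by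
  unfold vandermondePhase
  refine (IsBoundedLipschitz.const _).mul ?_
  simp_rw [vandermonde_det_eq_sum]
  refine IsBoundedLipschitz.sum _ fun σ _ => (IsBoundedLipschitz.const _).mul ?_
  refine IsBoundedLipschitz.prod _ fun i _ => IsBoundedLipschitz.pow ?_ _
  exact hE.comp (L := 1) fun X Y => by rw [one_mul]; exact dist_le_pi_dist X Y i

/-- Integrating `|D|²` against a product density with vanishing modes over all particles but the
first gives one. -/
theorem integral_prod_mul_vandermondePhase [NeZero N] (hE : ∀ x, ‖E x‖ = 1)
    (hEm : Continuous E) {ψ : Fin N → Space → ℝ} (hm : ∀ i, Measurable (ψ i))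
    (h1 : ∀ i, ∫⁻ x, ‖ψ i x‖ₑ ^ 2 = 1)
    (hmode : ∀ i, ∀ a b : ℕ, a < N → b < N → a ≠ b →
      ∫ x, ((ψ i x ^ 2 : ℝ) : ℂ) * (E x ^ a * (starRingEnd ℂ (E x)) ^ b) = 0) (x₀ : Space) :
    ∫⁻ y : {j : Fin N // j ≠ 0} → Space,
      (∏ j : {j : Fin N // j ≠ 0}, ‖ψ j (y j)‖ₑ ^ 2) * ‖vandermondePhase E (consPosition x₀ y)‖ₑ ^ 2 = 1 := by
  have hEE : ∀ x, E x * starRingEnd ℂ (E x) = 1 := fun x => by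
    rw [Complex.mul_conj, Complex.normSq_eq_norm_sq, hE]; simp
  have hi2 : ∀ i, Integrable fun x => ψ i x ^ 2 := fun i => by
    refine ⟨((hm i).pow_const 2).aestronglyMeasurable, ?_⟩
    rw [hasFiniteIntegral_iff_enorm]
    simp_rw [enorm_pow, h1]
    simp
  have hone : ∀ i, ∫ x, ψ i x ^ 2 = 1 := fun i => by
    rw [integral_eq_lintegral_of_nonneg_ae (ae_of_all _ fun x => sq_nonneg _)
      ((hm i).pow_const 2).aestronglyMeasurable]
    have : ∀ x, ENNReal.ofReal (ψ i x ^ 2) = ‖ψ i x‖ₑ ^ 2 := fun x => by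
      rw [← enorm_pow, Real.enorm_eq_ofReal (sq_nonneg _)]
    simp_rw [this, h1]
    simp
  set R : ({j : Fin N // j ≠ 0} → Space) → ℝ := fun y =>
    (∏ j : {j : Fin N // j ≠ 0}, ψ j (y j) ^ 2) * ‖vandermondePhase E (consPosition x₀ y)‖ ^ 2 with hR
  set G : Equiv.Perm (Fin N) → Equiv.Perm (Fin N) → Fin N → Space → ℂ := fun σ τ i x =>
    E x ^ (σ i : ℕ) * (starRingEnd ℂ (E x)) ^ (τ i : ℕ) with hG
  have hGn : ∀ σ τ i x, ‖G σ τ i x‖ = 1 := fun σ τ i x => by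
    simp [hG, hE]
  have hGc : ∀ σ τ i, Continuous (G σ τ i) := fun σ τ i =>
    (hEm.pow _).mul ((Complex.continuous_conj.comp hEm).pow _)
  have hintF : ∀ σ τ (i : Fin N), Integrable fun x => ((ψ i x ^ 2 : ℝ) : ℂ) * G σ τ i x := by
    intro σ τ i
    refine (hi2 i).ofReal.mul_bdd (c := 1) (hGc σ τ i).aestronglyMeasurable
      (ae_of_all _ fun x => (hGn σ τ i x).le)
  -- Expanding the determinant and its conjugate gives a double sum over permutations, each term of
  -- which factorizes over the particles.
  have hRexp : ∀ y, (R y : ℂ) = ∑ σ : Equiv.Perm (Fin N), ∑ τ : Equiv.Perm (Fin N),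
      ((N.factorial : ℂ)⁻¹ * ((Equiv.Perm.sign σ : ℤ) : ℂ) * ((Equiv.Perm.sign τ : ℤ) : ℂ) *
        G σ τ 0 x₀) * ∏ j : {j : Fin N // j ≠ 0}, ((ψ j (y j) ^ 2 : ℝ) : ℂ) * G σ τ j (y j) := by
    intro y
    set X := consPosition x₀ y with hX
    have hX0 : X 0 = x₀ := by simp [hX, consPosition]
    have hXj : ∀ j : {j : Fin N // j ≠ 0}, X j = y j := fun j => by
      simp [hX, consPosition, j.2]
    have hns : ((‖vandermondePhase E X‖ ^ 2 : ℝ) : ℂ) = (N.factorial : ℂ)⁻¹ *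
        ∑ σ : Equiv.Perm (Fin N), ∑ τ : Equiv.Perm (Fin N), ((Equiv.Perm.sign σ : ℤ) : ℂ) *
          ((Equiv.Perm.sign τ : ℤ) : ℂ) * ∏ i, G σ τ i (X i) := by
      have hs : (((Real.sqrt (N.factorial : ℝ))⁻¹ : ℝ) : ℂ) *
          (((Real.sqrt (N.factorial : ℝ))⁻¹ : ℝ) : ℂ) = (N.factorial : ℂ)⁻¹ := by
        rw [← Complex.ofReal_mul, ← mul_inv, Real.mul_self_sqrt (by positivity)]
        push_cast; rfl
      rw [← Complex.normSq_eq_norm_sq, ← Complex.mul_conj, vandermondePhase, map_mul,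
        Complex.conj_ofReal, vandermonde_det_eq_sum, mul_mul_mul_comm, hs, map_sum,
        Finset.sum_mul_sum]
      congr 1
      refine Finset.sum_congr rfl fun σ _ => Finset.sum_congr rfl fun τ _ => ?_
      simp only [map_mul, map_intCast, map_prod, map_pow, hG, Finset.prod_mul_distrib]
      ring
    have : (R y : ℂ) = (∏ j : {j : Fin N // j ≠ 0}, ((ψ j (y j) ^ 2 : ℝ) : ℂ)) *
        ((‖vandermondePhase E X‖ ^ 2 : ℝ) : ℂ) := by
      simp only [hR, ← hX]; push_cast; rfl
    rw [this, hns, Finset.mul_sum, Finset.mul_sum]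
    refine Finset.sum_congr rfl fun σ _ => ?_
    rw [Finset.mul_sum, Finset.mul_sum]
    refine Finset.sum_congr rfl fun τ _ => ?_
    rw [Fintype.prod_eq_mul_prod_subtype_ne (fun i => G σ τ i (X i)) 0, hX0]
    simp_rw [hXj]
    rw [Finset.prod_mul_distrib (f := fun j : {j : Fin N // j ≠ 0} => ((ψ j (y j) ^ 2 : ℝ) : ℂ))
      (g := fun j => G σ τ j (y j))]
    ring
  have hint : ∀ σ τ : Equiv.Perm (Fin N), Integrable
      (fun y : {j : Fin N // j ≠ 0} → Space =>
        ∏ j : {j : Fin N // j ≠ 0}, ((ψ j (y j) ^ 2 : ℝ) : ℂ) * G σ τ j (y j)) := fun σ τ =>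
    Integrable.fintype_prod (f := fun (j : {j : Fin N // j ≠ 0}) x =>
      ((ψ j x ^ 2 : ℝ) : ℂ) * G σ τ j x) fun j => hintF σ τ j
  have hval : ∀ σ τ : Equiv.Perm (Fin N),
      ∫ y : {j : Fin N // j ≠ 0} → Space,
        ∏ j : {j : Fin N // j ≠ 0}, ((ψ j (y j) ^ 2 : ℝ) : ℂ) * G σ τ j (y j) =
      if σ = τ then 1 else 0 := by
    intro σ τ
    rw [integral_fintype_prod_volume_eq_prod (fun (j : {j : Fin N // j ≠ 0}) x =>
      ((ψ j x ^ 2 : ℝ) : ℂ) * G σ τ j x)]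
    split_ifs with hst
    · subst hst
      refine Finset.prod_eq_one fun j _ => ?_
      simp only [hG, ← mul_pow, hEE, one_pow, mul_one]
      rw [integral_complex_ofReal, hone]; simp
    -- Particle `0` is not integrated, so a differing index other than `0` is required. It exists
    -- because permutations that agree off one point agree there too.
    · obtain ⟨j, hj0, hj⟩ : ∃ j : Fin N, j ≠ 0 ∧ σ j ≠ τ j := by
        by_contra! hcon
        refine hst (Equiv.ext fun i => ?_)
        by_cases hi : i = 0
        · subst hi
          obtain ⟨k, hk⟩ := τ.surjective (σ 0)
          by_cases hk0 : k = 0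
          · rw [hk0] at hk; exact hk.symm
          · rw [← hcon k hk0] at hk
            exact absurd (σ.injective hk) hk0
        · exact hcon i hi
      refine Finset.prod_eq_zero (Finset.mem_univ ⟨j, hj0⟩) ?_
      exact hmode j _ _ (σ j).2 (τ j).2 (fun h => hj (Fin.ext h))
  have hintR : ∫ y, R y = 1 := by
    have : ((∫ y, R y : ℝ) : ℂ) = 1 := by
      rw [← integral_complex_ofReal]
      simp_rw [hRexp]
      rw [integral_finsetSum _ fun σ _ => integrable_finsetSum _ fun τ _ =>
        (hint σ τ).const_mul _]
      simp_rw [integral_finsetSum _ fun τ _ => (hint _ τ).const_mul _, integral_const_mul, hval]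
      simp only [mul_ite, mul_one, mul_zero, Finset.sum_ite_eq, Finset.mem_univ, if_true]
      have hs : ∀ σ : Equiv.Perm (Fin N), (N.factorial : ℂ)⁻¹ * ((Equiv.Perm.sign σ : ℤ) : ℂ) *
          ((Equiv.Perm.sign σ : ℤ) : ℂ) * G σ σ 0 x₀ = (N.factorial : ℂ)⁻¹ := fun σ => by
        have e1 : G σ σ 0 x₀ = 1 := by simp only [hG, ← mul_pow, hEE, one_pow]
        rw [e1]
        rcases Int.units_eq_one_or (Equiv.Perm.sign σ) with h | h <;> simp [h]
      simp_rw [hs]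
      simp [Fintype.card_perm, Nat.factorial_ne_zero]
    exact_mod_cast this
  have hRi : Integrable R := by
    by_contra h
    rw [integral_undef h] at hintR
    exact zero_ne_one hintR
  have hRn : ∀ y, 0 ≤ R y := fun y =>
    mul_nonneg (Finset.prod_nonneg fun _ _ => sq_nonneg _) (sq_nonneg _)
  have := ofReal_integral_eq_lintegral_ofReal hRi (ae_of_all _ hRn)
  rw [hintR, ENNReal.ofReal_one] at this
  rw [this]
  refine lintegral_congr fun y => ?_
  simp only [hR]
  rw [ENNReal.ofReal_mul (Finset.prod_nonneg fun _ _ => sq_nonneg _),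
    ENNReal.ofReal_prod_of_nonneg fun _ _ => sq_nonneg _, ENNReal.ofReal_pow (norm_nonneg _),
    ofReal_norm]
  congr 1
  refine Finset.prod_congr rfl fun j _ => ?_
  rw [← enorm_pow, Real.enorm_eq_ofReal (sq_nonneg _)]

end Vandermonde

/-- Normalized one-particle functions and a unimodular phase whose low modes have mean zero in each
of the corresponding densities. -/
structure IsOrbitalFamily (N : ℕ) {ι : Type*} (ψ : ι → Space → ℝ) (E : Space → ℂ) : Prop where
  measurable : ∀ c, Measurable (ψ c)
  norm_one : ∀ c, ∫⁻ x, ‖ψ c x‖ₑ ^ 2 = 1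
  translation : ∀ c d, HasTranslationBound volume (ψ c) (EuclideanSpace.single d (1 : ℝ))
  norm_phase : ∀ x, ‖E x‖ = 1
  lipschitz : IsBoundedLipschitz E
  mode : ∀ c, ∀ a b : ℕ, a < N → b < N → a ≠ b →
    ∫ x, ((ψ c x ^ 2 : ℝ) : ℂ) * (E x ^ a * (starRingEnd ℂ (E x)) ^ b) = 0

/-! ### Wavefunctions built from mixtures of product densities -/

section Superposition

variable {N : ℕ} {ι : Type*} [Fintype ι]

/-- The vector of weighted tensor products, whose squared norm is a mixture of product densities. -/
def amplitude (ψ : ι → Space → ℝ) (W : (Fin N → ι) → NNReal) (X : Positions N) :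
    EuclideanSpace ℝ (Fin N → ι) :=
  WithLp.toLp 2 fun k => NNReal.sqrt (W k) * ∏ i, ψ (k i) (X i)

/-- The spin-polarized wavefunction whose modulus squared is a mixture of product densities, up to
the squared modulus of the Vandermonde phase. -/
def superposition (ψ : ι → Space → ℝ) (W : (Fin N → ι) → NNReal) (E : Space → ℂ) :
    WaveFunction N :=
  fun X s => if s = 0 then vandermondePhase E X * (‖amplitude ψ W X‖ : ℂ) else 0

/-- A product density times the squared modulus of the Vandermonde phase. -/
def blockDensity (ψ : ι → Space → ℝ) (E : Space → ℂ) (k : Fin N → ι) (X : Positions N) : ℝ≥0∞ :=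
  (∏ i, ‖ψ (k i) (X i)‖ₑ ^ 2) * ‖vandermondePhase E X‖ₑ ^ 2

variable {ψ : ι → Space → ℝ} {W : (Fin N → ι) → NNReal} {E : Space → ℂ}

theorem enorm_prod_sq {κ : Type*} [Fintype κ] (f : κ → ℝ) :
    ‖∏ i, f i‖ₑ ^ 2 = ∏ i, ‖f i‖ₑ ^ 2 := by
  rw [Finset.prod_pow]
  congr 1
  simp only [← ofReal_norm, norm_prod]
  exact ENNReal.ofReal_prod_of_nonneg fun _ _ => norm_nonneg _

theorem enorm_amplitude_sq (X : Positions N) :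
    ‖amplitude ψ W X‖ₑ ^ 2 = ∑ k, (W k : ℝ≥0∞) * ∏ i, ‖ψ (k i) (X i)‖ₑ ^ 2 := by
  rw [amplitude, enorm_toLp_sq]
  refine Finset.sum_congr rfl fun k _ => ?_
  rw [enorm_mul, mul_pow, enorm_prod_sq]
  congr 1
  rw [Real.enorm_eq_ofReal (NNReal.coe_nonneg _), ENNReal.ofReal_coe_nnreal, ← ENNReal.coe_pow,
    NNReal.sq_sqrt]

theorem sum_enorm_superposition_sq (X : Positions N) :
    ∑ s, ‖superposition ψ W E X s‖ₑ ^ 2 = ∑ k, (W k : ℝ≥0∞) * blockDensity ψ E k X := by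
  have h1 : ∑ s, ‖superposition ψ W E X s‖ₑ ^ 2 =
      ‖vandermondePhase E X‖ₑ ^ 2 * ‖amplitude ψ W X‖ₑ ^ 2 := by
    rw [Finset.sum_eq_single (0 : Spins N) (fun s _ hs => by simp [superposition, hs])
      (fun h => absurd (Finset.mem_univ _) h)]
    simp only [superposition, if_true, enorm_mul, mul_pow]
    congr 2
    rw [← enorm_norm, Complex.norm_real, enorm_norm, enorm_norm]
  rw [h1, enorm_amplitude_sq, Finset.mul_sum]
  refine Finset.sum_congr rfl fun k _ => ?_
  rw [blockDensity]; ring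

theorem ofReal_positionDensity (Ψ : WaveFunction N) (X : Positions N) :
    ENNReal.ofReal (positionDensity Ψ X) = ∑ s, ‖Ψ X s‖ₑ ^ 2 := by
  rw [positionDensity, ENNReal.ofReal_sum_of_nonneg (fun _ _ => by positivity)]
  refine Finset.sum_congr rfl fun s _ => ?_
  rw [ENNReal.ofReal_pow (norm_nonneg _), ofReal_norm]

theorem positionDensity_nonneg (Ψ : WaveFunction N) (X : Positions N) : 0 ≤ positionDensity Ψ X :=
  Finset.sum_nonneg fun _ _ => by positivity

theorem measurable_amplitude (hm : ∀ c, Measurable (ψ c)) :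
    Measurable (amplitude ψ W) :=
  (WithLp.measurable_toLp 2 _).comp <| measurable_pi_lambda _ fun _ =>
    (Finset.measurable_prod _ fun i _ => (hm _).comp (measurable_pi_apply i)).const_mul _

theorem measurable_blockDensity (h : IsOrbitalFamily N ψ E) (k : Fin N → ι) : Measurable (blockDensity ψ E k) :=
  (Finset.measurable_prod _ fun i _ =>
    ((h.measurable _).comp (measurable_pi_apply i)).enorm.pow_const 2).mul
    ((isBoundedLipschitz_vandermondePhase h.lipschitz).continuous.measurable.enorm.pow_const 2)

/-- Since the low modes vanish, the Vandermonde factor disappears on integrating out all particles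
but one. A block therefore has the same one-body density as the plain product. -/
theorem lintegral_blockDensity_cons (h : IsOrbitalFamily N ψ E) [NeZero N] (k : Fin N → ι) (x : Space) :
    ∫⁻ y : {j : Fin N // j ≠ 0} → Space, blockDensity ψ E k (consPosition x y) =
      ‖ψ (k 0) x‖ₑ ^ 2 := by
  have e : ∀ y : {j : Fin N // j ≠ 0} → Space, blockDensity ψ E k (consPosition x y) =
      ‖ψ (k 0) x‖ₑ ^ 2 * ((∏ j : {j : Fin N // j ≠ 0}, ‖ψ (k j) (y j)‖ₑ ^ 2) *
        ‖vandermondePhase E (consPosition x y)‖ₑ ^ 2) := by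
    intro y
    rw [blockDensity, Fintype.prod_eq_mul_prod_subtype_ne _ 0, mul_assoc]
    have h0 : consPosition x y 0 = x := by simp [consPosition]
    have hj : ∀ j : {j : Fin N // j ≠ 0}, consPosition x y j = y j := fun j => by
      simp [consPosition, j.2]
    simp_rw [h0, hj]
  simp_rw [e]
  rw [lintegral_const_mul' _ _ (by simp),
    integral_prod_mul_vandermondePhase h.norm_phase h.lipschitz.continuous
      (ψ := fun i => ψ (k i)) (fun i => h.measurable _) (fun i => h.norm_one _)
      (fun i => h.mode _) x, mul_one]

theorem lintegral_blockDensity (h : IsOrbitalFamily N ψ E) [NeZero N] (k : Fin N → ι) :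
    ∫⁻ X : Positions N, blockDensity ψ E k X = 1 := by
  have hmp := measurePreserving_consPosition N
  have hm := measurable_blockDensity h k
  rw [← hmp.lintegral_comp hm, lintegral_prod (f := fun p : Space × ({j : Fin N // j ≠ 0} → Space) =>
    blockDensity ψ E k (consPosition p.1 p.2)) (hm.comp hmp.measurable).aemeasurable]
  simp_rw [lintegral_blockDensity_cons h, h.norm_one]

theorem lintegral_prod_orbital (h : IsOrbitalFamily N ψ E) [NeZero N] (k : Fin N → ι) :
    ∫⁻ X : Positions N, ∏ i, ‖ψ (k i) (X i)‖ₑ ^ 2 = 1 := by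
  rw [volume_pi, lintegral_fintype_prod_eq_prod volume (fun i x => ‖ψ (k i) x‖ₑ ^ 2)
    fun i => (h.measurable _).enorm.pow_const 2]
  exact Finset.prod_eq_one fun i _ => h.norm_one _

theorem amplitude_comp_perm (hW : ∀ (σ : Equiv.Perm (Fin N)) k, W (k ∘ σ) = W k)
    (X : Positions N) (σ : Equiv.Perm (Fin N)) :
    ‖amplitude ψ W (X ∘ σ)‖ = ‖amplitude ψ W X‖ := by
  have : ‖amplitude ψ W (X ∘ σ)‖ₑ ^ 2 = ‖amplitude ψ W X‖ₑ ^ 2 := by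
    rw [enorm_amplitude_sq, enorm_amplitude_sq,
      ← (σ.arrowCongr (Equiv.refl ι)).symm.sum_comp]
    refine Finset.sum_congr rfl fun k _ => ?_
    have e : (σ.arrowCongr (Equiv.refl ι)).symm k = k ∘ σ := by
      funext i; simp [Equiv.arrowCongr]
    rw [e, hW]
    congr 1
    exact Equiv.prod_comp σ fun i => ‖ψ (k i) (X i)‖ₑ ^ 2
  have h2 := congrArg ENNReal.toReal this
  simp only [ENNReal.toReal_pow, toReal_enorm] at h2
  exact (pow_left_inj₀ (norm_nonneg _) (norm_nonneg _) two_ne_zero).1 h2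

/-- No quantitative bound is needed, because the kinetic energy of the fixed competitor is
multiplied by `α → 0`. -/
theorem kineticEnergy_lt_top {Ψ : WaveFunction N} (hΨ : IsAdmissible Ψ) : kineticEnergy Ψ < ⊤ := by
  have hg : ∀ s i c, MemLp (weakPartial (fun x => Ψ x s) i c) 2 volume := fun s i c => by
    rw [weakPartial, dif_pos (hΨ.weakPartial_memLp s i c)]
    exact (hΨ.weakPartial_memLp s i c).choose_spec.1
  have hm : ∀ s i c, AEMeasurable (fun x => ‖weakPartial (fun x => Ψ x s) i c x‖ₑ ^ 2) volume :=
    fun s i c => (hg s i c).1.enorm.pow_const 2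
  rw [kineticEnergy, lintegral_finsetSum' _ fun s _ => Finset.aemeasurable_fun_sum _ fun i _ =>
    Finset.aemeasurable_fun_sum _ fun c _ => hm s i c]
  refine ENNReal.sum_lt_top.2 fun s _ => ?_
  rw [lintegral_finsetSum' _ fun i _ => Finset.aemeasurable_fun_sum _ fun c _ => hm s i c]
  refine ENNReal.sum_lt_top.2 fun i _ => ?_
  rw [lintegral_finsetSum' _ fun c _ => hm s i c]
  refine ENNReal.sum_lt_top.2 fun c _ => ?_
  rw [← eLpNorm_two_sq]
  exact ENNReal.pow_lt_top (hg s i c).2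

/-- The superposition is an admissible wavefunction with the prescribed one-body density. -/
theorem isAdmissible_superposition (h : IsOrbitalFamily N ψ E) [NeZero N]
    (hW : ∀ (σ : Equiv.Perm (Fin N)) k, W (k ∘ σ) = W k) {u : Space → ℝ} {ρ : Space → ℝ}
    (hu1 : ∫⁻ x, ‖u x‖ₑ ^ 2 = 1) (hρ : ρ =ᵐ[volume] fun x => N * u x ^ 2)
    (hden : ∀ᵐ x, ∑ k, (W k : ℝ≥0∞) * ‖ψ (k 0) x‖ₑ ^ 2 = ‖u x‖ₑ ^ 2) :
    IsAdmissible (superposition ψ W E) ∧ HasDensity (superposition ψ W E) ρ := by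
  set Φ := superposition ψ W E with hΦ
  have hA := measurable_amplitude (W := W) h.measurable
  have hAc : Measurable fun X => (‖amplitude ψ W X‖ : ℂ) := Complex.measurable_ofReal.comp hA.norm
  have hDl := isBoundedLipschitz_vandermondePhase (N := N) h.lipschitz
  have hΦm : ∀ s, Measurable fun X => Φ X s := fun s => by
    by_cases hs : s = 0
    · simp only [hΦ, superposition, hs, if_true]
      exact hDl.continuous.measurable.mul hAc
    · simp only [hΦ, superposition, hs, if_false]
      exact measurable_const
  have hbm := fun k => measurable_blockDensity h k
  have hmp := measurePreserving_consPosition N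
  have hcons : ∀ x, ∫⁻ y : {j : Fin N // j ≠ 0} → Space,
      ENNReal.ofReal (positionDensity Φ (consPosition x y)) =
        ∑ k, (W k : ℝ≥0∞) * ‖ψ (k 0) x‖ₑ ^ 2 := by
    intro x
    simp_rw [ofReal_positionDensity, hΦ, sum_enorm_superposition_sq]
    have hbc : ∀ k, Measurable fun y : {j : Fin N // j ≠ 0} → Space =>
        blockDensity ψ E k (consPosition x y) := fun k =>
      (hbm k).comp (hmp.measurable.comp measurable_prodMk_left)
    rw [lintegral_finsetSum _ fun k _ => (hbc k).const_mul _]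
    refine Finset.sum_congr rfl fun k _ => ?_
    rw [lintegral_const_mul _ (hbc k), lintegral_blockDensity_cons h]
  have hpm : Measurable (positionDensity Φ) :=
    Finset.measurable_fun_sum _ fun s _ => (hΦm s).norm.pow_const 2
  have htot : ∫⁻ X, ENNReal.ofReal (positionDensity Φ X) = 1 := by
    rw [← hmp.lintegral_comp hpm.ennreal_ofReal,
      lintegral_prod (f := fun p : Space × ({j : Fin N // j ≠ 0} → Space) =>
        ENNReal.ofReal (positionDensity Φ (consPosition p.1 p.2)))
      (hpm.ennreal_ofReal.comp hmp.measurable).aemeasurable]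
    simp_rw [hcons]
    rw [lintegral_congr_ae hden, hu1]
  -- This cannot be read off from the norm of `Φ`, since the Vandermonde factor may vanish; it
  -- follows from the normalization of the tensor products.
  have hAfin : ∫⁻ X, ‖amplitude ψ W X‖ₑ ^ 2 ≠ ⊤ := by
    simp_rw [enorm_amplitude_sq]
    have hpk : ∀ k : Fin N → ι, Measurable fun X : Positions N => ∏ i, ‖ψ (k i) (X i)‖ₑ ^ 2 :=
      fun k => Finset.measurable_prod _ fun i _ =>
        ((h.measurable _).comp (measurable_pi_apply i)).enorm.pow_const 2
    rw [lintegral_finsetSum _ fun k _ => (hpk k).const_mul _]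
    refine (ENNReal.sum_lt_top.2 fun k _ => ?_).ne
    rw [lintegral_const_mul' _ _ (by simp), lintegral_prod_orbital h]
    finiteness
  have hmem : ∀ s, MemLp (fun X => Φ X s) 2 volume := fun s => by
    refine ⟨(hΦm s).aestronglyMeasurable, ?_⟩
    have : eLpNorm (fun X => Φ X s) 2 volume ^ 2 ≤ 1 := by
      rw [eLpNorm_two_sq, ← htot]
      refine lintegral_mono fun X => ?_
      rw [ofReal_positionDensity]
      exact Finset.single_le_sum (f := fun s => ‖Φ X s‖ₑ ^ 2) (fun _ _ => zero_le)
        (Finset.mem_univ s)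
    by_contra hcon
    rw [not_lt_top_iff.1 hcon] at this
    simp at this
  refine ⟨⟨hmem, fun s i c => ?_, fun σ => ae_of_all _ fun X s => ?_, ?_⟩, ?_⟩
  · refine exists_weak_of_hasTranslationBound (hmem s) ?_
    by_cases hs : s = 0
    · simp only [hΦ, superposition, hs, if_true]
      have hcomp : ∀ k : Fin N → ι, HasTranslationBound volume
          (fun X : Positions N => (NNReal.sqrt (W k) : ℝ) * ∏ i, ψ (k i) (X i))
          (direction i c) := fun k => by
        refine HasTranslationBound.mul_left
          (hasTranslationBound_prod (ψ := fun i => ψ (k i)) (fun i => h.measurable _)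
          (fun i => h.norm_one _) i c (h.translation _ c)) ?_ ?_ (IsBoundedLipschitz.const _)
        · exact Finset.measurable_prod _ fun i _ => (h.measurable _).comp (measurable_pi_apply i)
        · simp_rw [enorm_prod_sq]
          rw [lintegral_prod_orbital h]; simp
      have hAt : HasTranslationBound volume (amplitude ψ W) (direction i c) :=
        HasTranslationBound.toLp (fun k => Measurable.const_mul (Finset.measurable_prod _ fun i _ =>
          (h.measurable _).comp (measurable_pi_apply i)) _) hcomp
      have hAn : HasTranslationBound volume (fun X => (‖amplitude ψ W X‖ : ℂ)) (direction i c) :=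
        hAt.norm.isometry Complex.ofRealHom.toAddMonoidHom (fun x => Complex.norm_real x)
      refine HasTranslationBound.mul_left hAn hAc ?_ hDl
      refine ne_of_eq_of_ne (lintegral_congr fun X => ?_) hAfin
      rw [← enorm_norm, Complex.norm_real, enorm_norm, enorm_norm]
    · simp only [hΦ, superposition, hs, if_false]
      exact ⟨0, fun t => by simp⟩
  -- The fully polarized spin state is fixed by permutations, so the sign has to come from the
  -- positions: the determinant supplies it, and the amplitude is symmetric.
  · have hs : s ∘ σ = 0 ↔ s = 0 := by
      constructor
      · intro hz
        funext i
        simpa using congrFun hz (σ.symm i)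
      · rintro rfl; rfl
    simp only [hΦ, superposition, hs]
    split_ifs
    · rw [vandermondePhase_comp_perm, amplitude_comp_perm hW]; ring
    · simp
  · rw [integral_eq_lintegral_of_nonneg_ae (ae_of_all _ (positionDensity_nonneg Φ))
      hpm.aestronglyMeasurable, htot]
    simp
  · refine EventuallyEq.trans ?_ hρ.symm
    filter_upwards [hden] with x hx
    have hpc : Measurable fun y : {j : Fin N // j ≠ 0} → Space =>
        positionDensity Φ (consPosition x y) :=
      hpm.comp (hmp.measurable.comp measurable_prodMk_left)
    rw [oneBodyDensity, integral_eq_lintegral_of_nonneg_ae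
      (ae_of_all _ fun y => positionDensity_nonneg Φ _) hpc.aestronglyMeasurable, hcons, hx,
      ENNReal.toReal_pow, toReal_enorm, Real.norm_eq_abs, sq_abs]

/-- The amplitude is the norm of a vector and not a sum of orbital products, so there are no cross
terms and the energy is linear in the weights. -/
theorem interactionEnergy_superposition (h : IsOrbitalFamily N ψ E) :
    interactionEnergy (superposition ψ W E) =
      ∑ k, (W k : ℝ≥0∞) * ∫⁻ X, coulombCost X * blockDensity ψ E k X := by
  have hcm : Measurable (coulombCost (N := N)) :=
    Finset.measurable_fun_sum _ fun i _ => Finset.measurable_fun_sum _ fun j _ =>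
      ((measurable_pi_apply i).sub (measurable_pi_apply j)).enorm.inv
  have hbm := fun k => measurable_blockDensity h k
  rw [interactionEnergy]
  simp_rw [sum_enorm_superposition_sq, Finset.mul_sum]
  rw [lintegral_finsetSum _ fun k _ => (show Measurable fun X =>
    coulombCost X * ((W k : ℝ≥0∞) * blockDensity ψ E k X) from hcm.mul ((hbm k).const_mul _))]
  refine Finset.sum_congr rfl fun k _ => ?_
  rw [← lintegral_const_mul' _ _ (by simp)]
  refine lintegral_congr fun X => ?_
  ring

end Superposition

/-! ### Lipschitz partitions of unity into small cells -/

namespace IsBoundedLipschitz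

variable {α : Type*} [PseudoMetricSpace α] {f : α → ℝ}

theorem comp_real (hf : IsBoundedLipschitz f) {g : ℝ → ℝ} {B L : ℝ}
    (hB : ∀ x, |g (f x)| ≤ B) (hL : ∀ x y, |g (f x) - g (f y)| ≤ L * |f x - f y|) :
    IsBoundedLipschitz fun x => g (f x) := by
  obtain ⟨C, hC, -, h2⟩ := hf
  refine ⟨|B| + |L| * C, by positivity, fun x => ?_, fun x y => ?_⟩
  · have := (hB x).trans (le_abs_self B)
    have : 0 ≤ |L| * C := by positivity
    rw [Real.norm_eq_abs]; linarith
  · have h3 : |L| * |f x - f y| ≤ |L| * (C * dist x y) := by gcongr; exact h2 x y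
    have h4 : L * |f x - f y| ≤ |L| * |f x - f y| := by gcongr; exact le_abs_self L
    have h5 : 0 ≤ |B| * dist x y := by positivity
    have := hL x y
    rw [Real.norm_eq_abs]; nlinarith

theorem sqrt (hf : IsBoundedLipschitz f) {c : ℝ} (hc : 0 < c) (h : ∀ x, c ≤ f x) :
    IsBoundedLipschitz fun x => Real.sqrt (f x) := by
  obtain ⟨C, hC, h1, h2⟩ := id hf
  refine hf.comp_real (g := Real.sqrt) (B := Real.sqrt C) (L := (Real.sqrt c)⁻¹) (fun x => ?_)
    fun x y => ?_
  · rw [abs_of_nonneg (Real.sqrt_nonneg _)]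
    exact Real.sqrt_le_sqrt ((le_abs_self _).trans (h1 x))
  · have hs : 0 < Real.sqrt c := Real.sqrt_pos.2 hc
    have hx : Real.sqrt c ≤ Real.sqrt (f x) := Real.sqrt_le_sqrt (h x)
    have hy : 0 ≤ Real.sqrt (f y) := Real.sqrt_nonneg _
    rw [inv_mul_eq_div, le_div_iff₀ hs]
    have e : f x - f y = (Real.sqrt (f x) - Real.sqrt (f y)) * (Real.sqrt (f x) + Real.sqrt (f y)) := by
      have e1 := Real.mul_self_sqrt (hc.le.trans (h x))
      have e2 := Real.mul_self_sqrt (hc.le.trans (h y))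
      linarith
    rw [e, abs_mul]
    gcongr
    rw [abs_of_nonneg (by linarith)]
    linarith

theorem inv (hf : IsBoundedLipschitz f) {c : ℝ} (hc : 0 < c) (h : ∀ x, c ≤ f x) :
    IsBoundedLipschitz fun x => (f x)⁻¹ := by
  refine hf.comp_real (g := fun t => t⁻¹) (B := c⁻¹) (L := (c * c)⁻¹) (fun x => ?_) fun x y => ?_
  · have := hc.trans_le (h x)
    rw [abs_of_pos (by positivity)]
    exact inv_anti₀ hc (h x)
  · have hx := hc.trans_le (h x)
    have hy := hc.trans_le (h y)
    have e : (f x)⁻¹ - (f y)⁻¹ = (f x * f y)⁻¹ * (f y - f x) := by field_simp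
    rw [e, abs_mul, abs_sub_comm, abs_of_pos (by positivity)]
    gcongr
    · exact h x
    · exact h y

theorem max_const (hf : IsBoundedLipschitz f) (c : ℝ) :
    IsBoundedLipschitz fun x => max c (f x) := by
  obtain ⟨C, hC, h1, h2⟩ := id hf
  refine hf.comp_real (g := fun t => max c t) (B := |c| + C) (L := 1) (fun x => ?_) fun x y => ?_
  · refine abs_le.2 ⟨?_, ?_⟩
    · exact le_max_of_le_left (by linarith [neg_abs_le c])
    · exact max_le (by linarith [le_abs_self c]) (by
        have := (le_abs_self _).trans (h1 x); linarith [abs_nonneg c])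
  · rw [one_mul]
    have := abs_max_sub_max_le_max c (f x) c (f y)
    rwa [sub_self, abs_zero, max_eq_right (abs_nonneg (f x - f y))] at this

theorem ofReal (hf : IsBoundedLipschitz f) : IsBoundedLipschitz fun x => (f x : ℂ) := by
  obtain ⟨C, hC, h1, h2⟩ := hf
  refine ⟨C, hC, fun x => by rw [Complex.norm_real]; exact h1 x, fun x y => ?_⟩
  rw [← Complex.ofReal_sub, Complex.norm_real]; exact h2 x y

end IsBoundedLipschitz

/-- A finite family of bounded Lipschitz functions with supports of small diameter whose squares
form a partition of unity on a given ball. -/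
theorem exists_small_cells {h : ℝ} (hh : 0 < h) (R : ℝ) :
    ∃ (κ : Type) (_ : Fintype κ) (η : κ → Space → ℝ), (∀ c, IsBoundedLipschitz (η c)) ∧
      (∀ x, ∑ c, η c x ^ 2 ≤ 1) ∧ (∀ x ∈ Metric.closedBall (0 : Space) R, ∑ c, η c x ^ 2 = 1) ∧
      ∀ c x y, η c x ≠ 0 → η c y ≠ 0 → ‖x - y‖ ≤ h := by
  -- Cover with radius `h / 4` and use tents of radius `h / 2`: supports have diameter at most `h`,
  -- and at each point of the ball some tent is at least `h / 4`.
  obtain ⟨t, -, htf, ht⟩ := (isCompact_closedBall (0 : Space) R).finite_cover_balls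
    (e := h / 4) (by positivity)
  obtain ⟨n, p, hp⟩ : ∃ (n : ℕ) (p : Fin n → Space), Set.range p = t := by
    obtain ⟨n, p, hp⟩ := Set.Finite.fin_param htf
    exact ⟨n, p, hp.2⟩
  set f : Fin n → Space → ℝ := fun c x => max 0 (h / 2 - ‖x - p c‖) with hf
  have hfl : ∀ c, IsBoundedLipschitz (f c) := by
    intro c
    refine ⟨max 1 (h / 2), by positivity, fun x => ?_, fun x y => ?_⟩
    · rw [Real.norm_eq_abs, abs_of_nonneg (le_max_left _ _)]
      refine le_max_of_le_right (max_le (by positivity) ?_)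
      linarith [norm_nonneg (x - p c)]
    · have h1 : |f c x - f c y| ≤ ‖x - y‖ := by
        have h2 := abs_max_sub_max_le_max 0 (h / 2 - ‖x - p c‖) 0 (h / 2 - ‖y - p c‖)
        rw [sub_self, abs_zero,
          max_eq_right (abs_nonneg (h / 2 - ‖x - p c‖ - (h / 2 - ‖y - p c‖)))] at h2
        refine h2.trans ?_
        rw [show h / 2 - ‖x - p c‖ - (h / 2 - ‖y - p c‖) = ‖y - p c‖ - ‖x - p c‖ by ring, abs_sub_comm]
        refine (abs_norm_sub_norm_le _ _).trans (le_of_eq (by congr 1; abel))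
      rw [Real.norm_eq_abs, dist_eq_norm]
      refine h1.trans ?_
      nlinarith [norm_nonneg (x - y), le_max_left 1 (h / 2)]
  set m : ℝ := (h / 4) ^ 2 with hm
  have hm0 : 0 < m := by positivity
  -- The floor `m` keeps the normalizing factor Lipschitz everywhere; on the ball it is inactive, so
  -- the squares sum to one there.
  set S : Space → ℝ := fun x => max m (∑ c, f c x ^ 2) with hS
  have hSl : IsBoundedLipschitz S :=
    IsBoundedLipschitz.max_const (IsBoundedLipschitz.sum _ fun c _ => (hfl c).pow 2) m
  have hSm : ∀ x, m ≤ S x := fun x => le_max_left _ _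
  have hsum : ∀ x, ∑ c, (f c x * (Real.sqrt (S x))⁻¹) ^ 2 = (∑ c, f c x ^ 2) / S x := by
    intro x
    rw [Finset.sum_div]
    refine Finset.sum_congr rfl fun c _ => ?_
    rw [mul_pow, inv_pow, Real.sq_sqrt (hm0.le.trans (hSm x)), div_eq_mul_inv]
  refine ⟨Fin n, inferInstance, fun c x => f c x * (Real.sqrt (S x))⁻¹, fun c => ?_, fun x => ?_,
    fun x hx => ?_, fun c x y hx hy => ?_⟩
  · exact (hfl c).mul ((hSl.sqrt hm0 hSm).inv (Real.sqrt_pos.2 hm0) fun x =>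
      Real.sqrt_le_sqrt (hSm x))
  · rw [hsum]
    exact div_le_one_of_le₀ (le_max_right _ _) (hm0.le.trans (hSm x))
  · rw [hsum]
    have hx2 := ht hx
    simp only [Set.mem_iUnion] at hx2
    obtain ⟨q, hq, hxq⟩ := hx2
    rw [← hp] at hq
    obtain ⟨c, rfl⟩ := hq
    have h1 : h / 4 ≤ f c x := le_max_of_le_right (by
      have := mem_ball_iff_norm.1 hxq; linarith)
    have h2 : m ≤ ∑ c, f c x ^ 2 :=
      (show m ≤ f c x ^ 2 by rw [hm]; gcongr).trans
        (Finset.single_le_sum (f := fun c => f c x ^ 2) (fun _ _ => sq_nonneg _)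
          (Finset.mem_univ c))
    have : S x = ∑ c, f c x ^ 2 := max_eq_right h2
    rw [this, div_self (hm0.trans_le h2).ne']
  · have key : ∀ z, f c z * (Real.sqrt (S z))⁻¹ ≠ 0 → ‖z - p c‖ < h / 2 := by
      intro z hz
      by_contra! hcon
      exact hz (by simp [hf, max_eq_left (show h / 2 - ‖z - p c‖ ≤ 0 by linarith)])
    have h1 := key x hx
    have h2 := key y hy
    have h3 := norm_sub_le_norm_sub_add_norm_sub x (p c) y
    rw [norm_sub_rev (p c) y] at h3
    linarith

/-! ### Fourier modes of the phase -/

section Phase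

/-- The `k`-th Fourier mode of a real phase. -/
def fourierPhase (F : Space → ℝ) (k : ℤ) (x : Space) : ℂ :=
  Complex.exp (2 * Real.pi * Complex.I * k * F x)

variable {F : Space → ℝ}

theorem fourierPhase_eq (k : ℤ) (x : Space) :
    fourierPhase F k x = Complex.exp (((2 * Real.pi * k * F x : ℝ) : ℂ) * Complex.I) := by
  rw [fourierPhase]; congr 1; push_cast; ring

theorem norm_fourierPhase (k : ℤ) (x : Space) : ‖fourierPhase F k x‖ = 1 := by
  rw [fourierPhase_eq, Complex.norm_exp_ofReal_mul_I]

theorem fourierPhase_zero (x : Space) : fourierPhase F 0 x = 1 := by simp [fourierPhase]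

theorem fourierPhase_add (k l : ℤ) (x : Space) :
    fourierPhase F (k + l) x = fourierPhase F k x * fourierPhase F l x := by
  rw [fourierPhase, fourierPhase, fourierPhase, ← Complex.exp_add]; congr 1; push_cast; ring

theorem conj_fourierPhase (k : ℤ) (x : Space) :
    starRingEnd ℂ (fourierPhase F k x) = fourierPhase F (-k) x := by
  rw [fourierPhase_eq, fourierPhase_eq, ← Complex.exp_conj]
  congr 1
  rw [map_mul, Complex.conj_ofReal, Complex.conj_I]; push_cast; ring

theorem fourierPhase_pow (k : ℤ) (a : ℕ) (x : Space) :
    fourierPhase F k x ^ a = fourierPhase F (a * k) x := by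
  rw [fourierPhase, fourierPhase, ← Complex.exp_nat_mul]; congr 1; push_cast; ring

theorem isBoundedLipschitz_fourierPhase {L : ℝ} (hF : ∀ x y, |F x - F y| ≤ L * ‖x - y‖) (k : ℤ) :
    IsBoundedLipschitz (fourierPhase F k) := by
  refine ⟨1 + |2 * Real.pi * k| * |L|, by positivity, fun x => ?_, fun x y => ?_⟩
  · rw [norm_fourierPhase]; linarith [show 0 ≤ |2 * Real.pi * k| * |L| by positivity]
  · have e : fourierPhase F k x - fourierPhase F k y = fourierPhase F k y *
        (Complex.exp (Complex.I * ((2 * Real.pi * k * (F x - F y) : ℝ) : ℂ)) - 1) := by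
      rw [mul_sub, mul_one, fourierPhase, fourierPhase, ← Complex.exp_add]
      congr 2; push_cast; ring
    rw [e, norm_mul, norm_fourierPhase, one_mul]
    refine (Real.norm_exp_I_mul_ofReal_sub_one_le).trans ?_
    rw [Real.norm_eq_abs, abs_mul]
    calc |2 * Real.pi * k| * |F x - F y| ≤ |2 * Real.pi * k| * (|L| * ‖x - y‖) := by
          gcongr
          exact (hF x y).trans (by gcongr; exact le_abs_self L)
      _ ≤ _ := by
          rw [dist_eq_norm]
          nlinarith [norm_nonneg (x - y)]

variable {u : Space → ℝ}

/-- The Fourier modes of a bounded function against `u²` tend to zero, by Bessel's inequality. -/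
theorem tendsto_mode_zero (hum : Measurable u) (hu1 : ∫⁻ x, ‖u x‖ₑ ^ 2 = 1) (hFc : Continuous F)
    (hF0 : ∀ k : ℤ, k ≠ 0 → ∫ x, ((u x ^ 2 : ℝ) : ℂ) * fourierPhase F k x = 0)
    {χ : Space → ℝ} (hχ : IsBoundedLipschitz χ) :
    Tendsto (fun k : ℤ => ∫ x, ((χ x * u x ^ 2 : ℝ) : ℂ) * fourierPhase F k x) cofinite (𝓝 0) := by
  have hphc : ∀ k, Continuous (fourierPhase F k) := fun k => by
    unfold fourierPhase; fun_prop
  have hu2 : MemLp (fun x => (u x : ℂ)) 2 volume := by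
    refine ⟨(Complex.measurable_ofReal.comp hum).aestronglyMeasurable, ?_⟩
    have : eLpNorm (fun x => (u x : ℂ)) 2 volume ^ 2 = 1 := by
      rw [eLpNorm_two_sq, ← hu1]
      refine lintegral_congr fun x => ?_
      rw [← enorm_norm, Complex.norm_real, enorm_norm]
    by_contra hcon
    rw [not_lt_top_iff.1 hcon] at this
    simp at this
  have hmul : ∀ {g : Space → ℂ}, Continuous g → (∃ C, ∀ x, ‖g x‖ ≤ C) →
      MemLp (fun x => g x * (u x : ℂ)) 2 volume := by
    rintro g hg ⟨C, hC⟩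
    refine MemLp.of_le_mul (c := C) hu2 (hg.aestronglyMeasurable.mul hu2.1)
      (ae_of_all _ fun x => ?_)
    rw [norm_mul]
    gcongr
    exact hC x
  have hek : ∀ k, MemLp (fun x => fourierPhase F k x * (u x : ℂ)) 2 volume := fun k =>
    hmul (hphc k) ⟨1, fun x => (norm_fourierPhase k x).le⟩
  have hχu : MemLp (fun x => (χ x : ℂ) * (u x : ℂ)) 2 volume := by
    obtain ⟨C, -, hC, -⟩ := hχ.ofReal
    exact hmul hχ.ofReal.continuous ⟨C, hC⟩
  have hone : ∫ x, ((u x ^ 2 : ℝ) : ℂ) = 1 := by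
    rw [integral_complex_ofReal, integral_eq_lintegral_of_nonneg_ae
      (ae_of_all _ fun x => sq_nonneg _) (hum.pow_const 2).aestronglyMeasurable]
    have : ∀ x, ENNReal.ofReal (u x ^ 2) = ‖u x‖ₑ ^ 2 := fun x => by
      rw [← enorm_pow, Real.enorm_eq_ofReal (sq_nonneg _)]
    simp_rw [this, hu1]
    simp
  set e : ℤ → Lp ℂ 2 (volume : Measure Space) := fun k => (hek k).toLp with he
  -- The product of one phase with the conjugate of another is the phase of the difference
  -- frequency, so vanishing means amount to orthogonality of the functions `fourierPhase F k · u`.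
  have hon : Orthonormal ℂ e := by
    rw [orthonormal_iff_ite]
    intro k l
    have h1 : inner ℂ (e k) (e l) = ∫ x, ((u x ^ 2 : ℝ) : ℂ) * fourierPhase F (l - k) x := by
      rw [L2.inner_def]
      refine integral_congr_ae ?_
      filter_upwards [(hek k).coeFn_toLp, (hek l).coeFn_toLp] with x hk hl
      simp only [he]
      rw [hk, hl, RCLike.inner_apply, map_mul, conj_fourierPhase, Complex.conj_ofReal,
        sub_eq_add_neg, fourierPhase_add]
      push_cast; ring
    rw [h1]
    split_ifs with hkl
    · subst hkl
      simp_rw [sub_self, fourierPhase_zero, mul_one, hone]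
    · exact hF0 _ (sub_ne_zero.2 (Ne.symm hkl))
  have hsum := hon.inner_products_summable hχu.toLp
  have h2 := hsum.tendsto_cofinite_zero
  have h3 : Tendsto (fun k : ℤ => ‖inner ℂ (e k) hχu.toLp‖) cofinite (𝓝 0) := by
    have := (Real.continuous_sqrt.tendsto 0).comp h2
    rw [Real.sqrt_zero] at this
    refine this.congr fun k => ?_
    simp only [Function.comp]
    rw [Real.sqrt_sq (norm_nonneg _)]
  have h4 := h3.comp (neg_injective (G := ℤ)).tendsto_cofinite
  rw [tendsto_zero_iff_norm_tendsto_zero]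
  refine h4.congr fun k => ?_
  simp only [Function.comp]
  congr 1
  rw [L2.inner_def]
  refine integral_congr_ae ?_
  filter_upwards [(hek (-k)).coeFn_toLp, hχu.coeFn_toLp] with x hk hl
  simp only [he]
  rw [hk, hl, RCLike.inner_apply, map_mul, conj_fourierPhase, Complex.conj_ofReal, neg_neg]
  push_cast; ring

end Phase

theorem IsBoundedLipschitz.re {α : Type*} [PseudoMetricSpace α] {f : α → ℂ}
    (hf : IsBoundedLipschitz f) : IsBoundedLipschitz fun x => (f x).re := by
  obtain ⟨C, hC, h1, h2⟩ := hf
  refine ⟨C, hC, fun x => (Complex.abs_re_le_norm _).trans (h1 x), fun x y => ?_⟩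
  rw [← Complex.sub_re]
  exact (Complex.abs_re_le_norm _).trans (h2 x y)

/-! ### Removing the low modes of a cell -/

section Correction

variable {u F : Space → ℝ}

/-- The Fourier modes of the density `χ u²` with respect to the phase `F`. -/
def mode (u F χ : Space → ℝ) (k : ℤ) : ℂ :=
  ∫ x, ((χ x * u x ^ 2 : ℝ) : ℂ) * fourierPhase F k x

theorem integrable_sq (hum : Measurable u) (hu1 : ∫⁻ x, ‖u x‖ₑ ^ 2 = 1) :
    Integrable fun x => u x ^ 2 := by
  refine ⟨(hum.pow_const 2).aestronglyMeasurable, ?_⟩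
  rw [HasFiniteIntegral]
  simp_rw [enorm_pow, hu1]
  simp

theorem integrable_mul_sq (hum : Measurable u) (hu1 : ∫⁻ x, ‖u x‖ₑ ^ 2 = 1) {χ : Space → ℝ}
    (hχ : IsBoundedLipschitz χ) : Integrable fun x => χ x * u x ^ 2 := by
  obtain ⟨C, -, hC, -⟩ := id hχ
  exact (integrable_sq hum hu1).bdd_mul (c := C) hχ.continuous.aestronglyMeasurable
    (ae_of_all _ hC)

theorem integrable_mode (hum : Measurable u) (hu1 : ∫⁻ x, ‖u x‖ₑ ^ 2 = 1) {χ : Space → ℝ}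
    (hχ : IsBoundedLipschitz χ) (hFc : Continuous F) (k : ℤ) :
    Integrable fun x => ((χ x * u x ^ 2 : ℝ) : ℂ) * fourierPhase F k x := by
  have hph : Continuous (fourierPhase F k) := by unfold fourierPhase; fun_prop
  exact (integrable_mul_sq hum hu1 hχ).ofReal.mul_bdd (c := 1) hph.aestronglyMeasurable
    (ae_of_all _ fun x => (norm_fourierPhase k x).le)

theorem conj_mode (χ : Space → ℝ) (k : ℤ) : starRingEnd ℂ (mode u F χ k) = mode u F χ (-k) := by
  rw [mode, mode, ← integral_conj]
  refine integral_congr_ae (ae_of_all _ fun x => ?_)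
  simp only [map_mul, Complex.conj_ofReal, conj_fourierPhase]

/-- The nonzero frequencies of absolute value less than `N`. -/
def lowFrequencies (N : ℕ) : Finset ℤ := (Finset.Ioo (-(N : ℤ)) N).erase 0

theorem mem_lowFrequencies {N : ℕ} {l : ℤ} : l ∈ lowFrequencies N ↔ l ≠ 0 ∧ |l| < N := by
  rw [lowFrequencies, Finset.mem_erase, Finset.mem_Ioo, abs_lt]

/-- Cramer's rule expresses the solution through polynomials in the entries, so convergence of the
system gives convergence of the solution without discussing inverses. -/
theorem tendsto_inv_det_smul_adjugate_mulVec {ι : Type*} [Fintype ι] [DecidableEq ι]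
    {B : Matrix ι ι ℂ} (hdet0 : B.det ≠ 0) {A : ℕ → Matrix ι ι ℂ} {v : ℕ → ι → ℂ}
    (hA : Tendsto A atTop (𝓝 B)) (hv : Tendsto v atTop (𝓝 0)) :
    Tendsto (fun n => (A n).det⁻¹ • ((A n).adjugate.mulVec (v n))) atTop (𝓝 0) ∧
      ∀ᶠ n in atTop, (A n).mulVec ((A n).det⁻¹ • ((A n).adjugate.mulVec (v n))) = v n := by
  have hdet : Tendsto (fun n => (A n).det) atTop (𝓝 B.det) :=
    ((Continuous.matrix_det continuous_id).tendsto B).comp hA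
  have hadj : Tendsto (fun n => (A n).adjugate) atTop (𝓝 B.adjugate) :=
    ((Continuous.matrix_adjugate continuous_id).tendsto B).comp hA
  have hmv : Tendsto (fun n => (A n).adjugate.mulVec (v n)) atTop (𝓝 0) := by
    refine tendsto_pi_nhds.2 fun a => ?_
    have : ∀ b ∈ Finset.univ, Tendsto (fun n => (A n).adjugate a b * v n b) atTop
        (𝓝 (B.adjugate a b * 0)) := fun b _ =>
      (tendsto_pi_nhds.1 (tendsto_pi_nhds.1 hadj a) b).mul (tendsto_pi_nhds.1 hv b)
    simpa [Matrix.mulVec, dotProduct] using tendsto_finsetSum Finset.univ this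
  refine ⟨?_, ?_⟩
  · have := (hdet.inv₀ hdet0).smul hmv
    rwa [smul_zero] at this
  · filter_upwards [hdet.eventually_ne hdet0] with n hn
    rw [Matrix.mulVec_smul, Matrix.mulVec_mulVec, Matrix.mul_adjugate, Matrix.smul_mulVec,
      Matrix.one_mulVec, smul_smul, inv_mul_cancel₀ hn, one_smul]

/-- A small modification of a density removes its low modes with respect to a fast phase. -/
theorem eventually_exists_correction (hum : Measurable u) (hu1 : ∫⁻ x, ‖u x‖ₑ ^ 2 = 1) {L : ℝ}
    (hF : ∀ x y, |F x - F y| ≤ L * ‖x - y‖)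
    (hF0 : ∀ k : ℤ, k ≠ 0 → ∫ x, ((u x ^ 2 : ℝ) : ℂ) * fourierPhase F k x = 0)
    {χ : Space → ℝ} (hχ : IsBoundedLipschitz χ) (hm : ∫ x, χ x * u x ^ 2 ≠ 0) {ε : ℝ} (hε : 0 < ε)
    (N : ℕ) : ∀ᶠ n : ℕ in atTop, ∃ q : Space → ℝ, IsBoundedLipschitz q ∧ (∀ x, |q x| ≤ ε) ∧
      ∀ l ∈ lowFrequencies N, mode u F (fun x => χ x * (1 - q x)) (n * l) = 0 := by
  have hphl := isBoundedLipschitz_fourierPhase hF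
  have hFc : Continuous F := by
    refine (LipschitzWith.of_dist_le_mul (K := L.toNNReal) fun x y => ?_).continuous
    rw [Real.dist_eq, dist_eq_norm]
    exact (hF x y).trans (by gcongr; exact Real.le_coe_toNNReal L)
  set J := lowFrequencies N
  have hlim : ∀ l : ℤ, l ≠ 0 → Tendsto (fun n : ℕ => mode u F χ (n * l)) atTop (𝓝 0) := by
    intro l hl
    have h1 : Function.Injective fun n : ℕ => (n * l : ℤ) := fun a b hab => by
      simpa [hl] using hab
    have := (tendsto_mode_zero hum hu1 hFc hF0 hχ).comp h1.tendsto_cofinite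
    rwa [Nat.cofinite_eq_atTop] at this
  have hmode0 : mode u F χ 0 = ((∫ x, χ x * u x ^ 2 : ℝ) : ℂ) := by
    simp_rw [mode, fourierPhase_zero, mul_one]
    rw [integral_complex_ofReal]
  -- The coefficients of the correction solve a Toeplitz system. For large `n` its off-diagonal
  -- entries and right-hand side tend to zero, while the diagonal is the mass of `χ u²`; the
  -- solution therefore exists and is small.
  set A : ℕ → Matrix J J ℂ := fun n => Matrix.of fun a b => mode u F χ (n * a - n * b) with hA
  set v : ℕ → J → ℂ := fun n a => mode u F χ (n * a) with hv
  have hAl : Tendsto A atTop (𝓝 ((mode u F χ 0) • 1)) := by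
    refine tendsto_pi_nhds.2 fun a => tendsto_pi_nhds.2 fun b => ?_
    rw [Matrix.smul_apply, Matrix.one_apply]
    split_ifs with hab
    · subst hab
      simp [hA]
    · rw [smul_zero]
      refine (hlim (a - b) (sub_ne_zero.2 fun h => hab (Subtype.ext h))).congr fun n => ?_
      simp [hA, mul_sub]
  have hvl : Tendsto v atTop (𝓝 0) := tendsto_pi_nhds.2 fun a =>
    hlim a (mem_lowFrequencies.1 a.2).1
  have hm0 : mode u F χ 0 ≠ 0 := by rw [hmode0]; exact_mod_cast hm
  have hdet0 : ((mode u F χ 0) • (1 : Matrix J J ℂ)).det ≠ 0 := by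
    rw [Matrix.det_smul, Matrix.det_one, mul_one]; exact pow_ne_zero _ hm0
  obtain ⟨h1, h2⟩ := tendsto_inv_det_smul_adjugate_mulVec hdet0 hAl hvl
  set c : ℕ → J → ℂ := fun n => (A n).det⁻¹ • ((A n).adjugate.mulVec (v n))
  have h3 : Tendsto (fun n => ∑ l, ‖c n l‖) atTop (𝓝 0) := by
    have := tendsto_finsetSum (Finset.univ : Finset J) fun l _ => ((tendsto_pi_nhds.1 h1) l).norm
    simpa using this
  filter_upwards [h2, h3.eventually_lt_const hε] with n hn hcn
  set S : Space → ℂ := fun x => ∑ l : J, c n l * fourierPhase F (-(n * l)) x with hS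
  have hSl : IsBoundedLipschitz S :=
    IsBoundedLipschitz.sum _ fun l _ => (IsBoundedLipschitz.const _).mul (hphl _)
  refine ⟨fun x => (S x).re, hSl.re, fun x => ?_, fun m hmJ => ?_⟩
  · refine (Complex.abs_re_le_norm _).trans ((norm_sum_le _ _).trans ?_)
    simp_rw [norm_mul, norm_fourierPhase, mul_one]
    exact hcn.le
  · have hrow : ∀ m : ℤ, m ∈ J → ∑ l : J, c n l * mode u F χ (n * m - n * l) = mode u F χ (n * m) := by
      intro m hm
      have := congrFun hn ⟨m, hm⟩
      simp only [Matrix.mulVec, dotProduct, hA, hv, Matrix.of_apply] at this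
      rw [← this]
      exact Finset.sum_congr rfl fun l _ => mul_comm _ _
    have hneg : -m ∈ J := by
      have := mem_lowFrequencies.1 hmJ
      exact mem_lowFrequencies.2 ⟨neg_ne_zero.2 this.1, by rw [abs_neg]; exact this.2⟩
    -- The correction must be real, so it is the mean of `S` and its conjugate. The conjugate of row
    -- `-m` gives the identity for the conjugate coefficients, and the two halves add up to the mode
    -- to be cancelled.
    have hrow2 : ∑ l : J, starRingEnd ℂ (c n l) * mode u F χ (n * m + n * l) = mode u F χ (n * m) := by
      have := congrArg (starRingEnd ℂ) (hrow (-m) hneg)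
      rw [map_sum, conj_mode] at this
      rw [show -((n : ℤ) * -m) = n * m by ring] at this
      rw [← this]
      refine Finset.sum_congr rfl fun l _ => ?_
      rw [map_mul, conj_mode]
      congr 2; ring
    have hint := integrable_mode hum hu1 hχ hFc
    have e : ∀ x, ((χ x * (1 - (S x).re) * u x ^ 2 : ℝ) : ℂ) * fourierPhase F (n * m) x =
        ((χ x * u x ^ 2 : ℝ) : ℂ) * fourierPhase F (n * m) x -
        ((∑ l : J, c n l / 2 * (((χ x * u x ^ 2 : ℝ) : ℂ) * fourierPhase F (n * m - n * l) x)) +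
        ∑ l : J, starRingEnd ℂ (c n l) / 2 *
          (((χ x * u x ^ 2 : ℝ) : ℂ) * fourierPhase F (n * m + n * l) x)) := by
      intro x
      have e1 : ∑ l : J, c n l / 2 * (((χ x * u x ^ 2 : ℝ) : ℂ) * fourierPhase F (n * m - n * l) x) =
          ((χ x * u x ^ 2 : ℝ) : ℂ) * fourierPhase F (n * m) x * (S x / 2) := by
        rw [hS, Finset.sum_div, Finset.mul_sum]
        refine Finset.sum_congr rfl fun l _ => ?_
        rw [sub_eq_add_neg, fourierPhase_add]; ring
      have e2 : ∑ l : J, starRingEnd ℂ (c n l) / 2 *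
          (((χ x * u x ^ 2 : ℝ) : ℂ) * fourierPhase F (n * m + n * l) x) =
          ((χ x * u x ^ 2 : ℝ) : ℂ) * fourierPhase F (n * m) x * (starRingEnd ℂ (S x) / 2) := by
        rw [hS, map_sum, Finset.sum_div, Finset.mul_sum]
        refine Finset.sum_congr rfl fun l _ => ?_
        rw [map_mul, conj_fourierPhase, neg_neg, fourierPhase_add]; ring
      have e3 : ((S x).re : ℂ) = (S x + starRingEnd ℂ (S x)) / 2 := Complex.re_eq_add_conj _
      rw [e1, e2]
      push_cast
      rw [e3]
      ring
    rw [mode]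
    simp_rw [e]
    have hI1 : Integrable fun x => ∑ l : J, c n l / 2 *
        (((χ x * u x ^ 2 : ℝ) : ℂ) * fourierPhase F (n * m - n * l) x) :=
      integrable_finsetSum _ fun l _ => (hint _).const_mul _
    have hI2 : Integrable fun x => ∑ l : J, starRingEnd ℂ (c n l) / 2 *
        (((χ x * u x ^ 2 : ℝ) : ℂ) * fourierPhase F (n * m + n * l) x) :=
      integrable_finsetSum _ fun l _ => (hint _).const_mul _
    have hI3 : Integrable fun x => (∑ l : J, c n l / 2 *
        (((χ x * u x ^ 2 : ℝ) : ℂ) * fourierPhase F (n * m - n * l) x)) +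
        ∑ l : J, starRingEnd ℂ (c n l) / 2 *
        (((χ x * u x ^ 2 : ℝ) : ℂ) * fourierPhase F (n * m + n * l) x) := hI1.add hI2
    rw [integral_sub (hint _) hI3,
      integral_add hI1 hI2,
      integral_finsetSum _ fun l _ => (hint _).const_mul _,
      integral_finsetSum _ fun l _ => (hint _).const_mul _]
    simp_rw [integral_const_mul]
    have h4 : ∑ l : J, c n l / 2 * mode u F χ (n * m - n * l) = mode u F χ (n * m) / 2 := by
      rw [← hrow m hmJ, Finset.sum_div]
      exact Finset.sum_congr rfl fun l _ => by ring
    have h5 : ∑ l : J, starRingEnd ℂ (c n l) / 2 * mode u F χ (n * m + n * l) =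
        mode u F χ (n * m) / 2 := by
      rw [← hrow2, Finset.sum_div]
      exact Finset.sum_congr rfl fun l _ => by ring
    simp only [mode] at h4 h5
    rw [h4, h5]
    ring

end Correction

theorem IsBoundedLipschitz.one_sub {α : Type*} [PseudoMetricSpace α] {f : α → ℝ}
    (hf : IsBoundedLipschitz f) : IsBoundedLipschitz fun x => 1 - f x := by
  obtain ⟨C, hC, h1, h2⟩ := hf
  refine ⟨1 + C, by positivity, fun x => ?_, fun x y => ?_⟩
  · exact (norm_sub_le _ _).trans (by rw [norm_one]; linarith [h1 x])
  · rw [show 1 - f x - (1 - f y) = f y - f x by ring, norm_sub_rev]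
    exact (h2 x y).trans (by nlinarith [dist_nonneg (x := x) (y := y)])

/-! ### Cells whose densities have no low modes -/

section Cells

variable {u : Space → ℝ}

theorem exists_setIntegral_compl_closedBall_le (hum : Measurable u)
    (hu1 : ∫⁻ x, ‖u x‖ₑ ^ 2 = 1) {ε : ℝ} (hε : 0 < ε) :
    ∃ R : ℝ, ∫ x, (Metric.closedBall (0 : Space) R)ᶜ.indicator (fun x => u x ^ 2) x ≤ ε := by
  have h1 : Tendsto (fun k : ℕ => ∫ x, (Metric.closedBall (0 : Space) k)ᶜ.indicator
      (fun x => u x ^ 2) x) atTop (𝓝 (∫ _ : Space, (0 : ℝ))) := by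
    refine tendsto_integral_of_dominated_convergence (fun x => u x ^ 2)
      (fun k => ((hum.pow_const 2).indicator
        Metric.isClosed_closedBall.measurableSet.compl).aestronglyMeasurable)
      (integrable_sq hum hu1) (fun k => ae_of_all _ fun x => ?_) (ae_of_all _ fun x => ?_)
    · refine (norm_indicator_le_norm_self _ _).trans (le_of_eq ?_)
      rw [Real.norm_eq_abs, abs_of_nonneg (sq_nonneg _)]
    · refine tendsto_const_nhds.congr' ?_
      filter_upwards [eventually_ge_atTop ⌈‖x‖⌉₊] with k hk
      rw [Set.indicator_of_notMem]
      simpa using (Nat.le_ceil _).trans (Nat.cast_le.2 hk)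
  rw [integral_zero] at h1
  obtain ⟨k, hk⟩ := (h1.eventually_lt_const hε).exists
  exact ⟨k, hk.le⟩

/-- Partition of unity, with small supports except for one cell of small mass, such that all the
normalized pieces of `u²` form an orbital family. -/
theorem exists_orbital_cells (hum : Measurable u) (hu1 : ∫⁻ x, ‖u x‖ₑ ^ 2 = 1)
    (hu : ∀ d, HasTranslationBound volume u (EuclideanSpace.single d (1 : ℝ))) (N : ℕ) {h : ℝ}
    (hh : 0 < h) {δ : ℝ} (hδ : 0 < δ) :
    ∃ (κ : Type) (_ : Fintype κ) (χ : Option κ → Space → ℝ≥0∞) (ψ : Option κ → Space → ℝ)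
      (E : Space → ℂ) (m : Option κ → NNReal), IsOrbitalFamily N ψ E ∧ (∀ c, Measurable (χ c)) ∧
      (∀ x, ∑ c, χ c x = 1) ∧
      (∀ c, ∀ᵐ x, (m c : ℝ≥0∞) * ‖ψ c x‖ₑ ^ 2 = χ c x * ‖u x‖ₑ ^ 2) ∧
      (∀ c : κ, m (some c) ≠ 0 → ∀ x y, ψ (some c) x ≠ 0 → χ (some c) y ≠ 0 → ‖x - y‖ ≤ h) ∧
      (m none : ℝ) ≤ δ := by
  classical
  -- The exceptional mass is at most `3/2 ε` from inside the ball of radius `R` plus `ε` from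
  -- outside.
  obtain ⟨ε, hε, hε2, hεδ⟩ : ∃ ε : ℝ, 0 < ε ∧ ε ≤ 1 / 2 ∧ 5 / 2 * ε ≤ δ :=
    ⟨min (1 / 2) (2 / 5 * δ), by positivity, min_le_left _ _, by
      have := min_le_right (1 / 2) (2 / 5 * δ); linarith⟩
  obtain ⟨R, hR⟩ := exists_setIntegral_compl_closedBall_le hum hu1 hε
  obtain ⟨κ, hκ, η, hη, hη1, hηR, hηh⟩ := exists_small_cells hh R
  obtain ⟨F, L, hF, hF0⟩ := exists_equidistributing_phase hum hu1 (hu 0)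
  have hFc : Continuous F := by
    refine (LipschitzWith.of_dist_le_mul (K := L.toNNReal) fun x y => ?_).continuous
    rw [Real.dist_eq, dist_eq_norm]
    exact (hF x y).trans (by gcongr; exact Real.le_coe_toNNReal L)
  have hu2 := integrable_sq hum hu1
  have hev : ∀ c, ∀ᶠ n : ℕ in atTop, ∃ q : Space → ℝ, IsBoundedLipschitz q ∧
      (∀ x, |q x| ≤ ε / 2) ∧
      ∀ l ∈ lowFrequencies N, mode u F (fun x => η c x ^ 2 * (1 - q x)) (n * l) = 0 := by
    intro c
    by_cases hM : ∫ x, η c x ^ 2 * u x ^ 2 = 0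
    · refine .of_forall fun n => ⟨fun _ => 0, .const _, fun x => by simp; positivity, fun l _ => ?_⟩
      rw [integral_eq_zero_iff_of_nonneg (fun x => by positivity)
        (integrable_mul_sq hum hu1 ((hη c).pow 2))] at hM
      rw [mode]
      refine integral_eq_zero_of_ae ?_
      filter_upwards [hM] with x hx
      simp only [sub_zero, mul_one]
      simp only [Pi.zero_apply] at hx
      rw [hx]; simp
    · exact eventually_exists_correction hum hu1 hF hF0 ((hη c).pow 2) hM (by positivity) N
  obtain ⟨n, hn, hn0⟩ := ((eventually_all.2 hev).and (eventually_gt_atTop 0)).exists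
  choose q hq hqε hqm using hn
  -- The exceptional cell `none` takes whatever the corrected cells leave. The factor `1 - ε`
  -- compensates for corrections of size `ε / 2` and keeps this remainder above `ε / 2`, so that its
  -- square root is Lipschitz.
  set g : Option κ → Space → ℝ := fun c x => c.elim
    (1 - ∑ c, (1 - ε) * (η c x ^ 2 * (1 - q c x))) fun c => (1 - ε) * (η c x ^ 2 * (1 - q c x))
    with hg
  have hgs : ∀ c x, g (some c) x = (1 - ε) * (η c x ^ 2 * (1 - q c x)) := fun _ _ => rfl
  have hgn : ∀ x, g none x = 1 - ∑ c, (1 - ε) * (η c x ^ 2 * (1 - q c x)) := fun _ => rfl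
  have hg1 : ∀ x, ∑ c, g c x = 1 := fun x => by
    rw [Fintype.sum_option, hgn]; simp only [hgs]; ring
  have hgsl : ∀ c, IsBoundedLipschitz (g (some c)) := fun c =>
    (IsBoundedLipschitz.const (1 - ε)).mul (((hη c).pow 2).mul (hq c).one_sub)
  have hglow : ∀ x, ε / 2 ≤ g none x := by
    intro x
    have : ∑ c, (1 - ε) * (η c x ^ 2 * (1 - q c x)) ≤ ∑ c, η c x ^ 2 * (1 - ε / 2) := by
      refine Finset.sum_le_sum fun c _ => ?_
      have h1 := neg_le_of_abs_le (hqε c x)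
      have h2 : (1 - ε) * (1 - q c x) ≤ 1 - ε / 2 := by nlinarith
      nlinarith [sq_nonneg (η c x)]
    rw [← Finset.sum_mul] at this
    have h3 := hη1 x
    rw [hgn]
    nlinarith
  have hgup : ∀ x ∈ Metric.closedBall (0 : Space) R, g none x ≤ 3 / 2 * ε := by
    intro x hx
    have : ∑ c, η c x ^ 2 * (1 - 3 / 2 * ε) ≤ ∑ c, (1 - ε) * (η c x ^ 2 * (1 - q c x)) := by
      refine Finset.sum_le_sum fun c _ => ?_
      have h1 := le_of_abs_le (hqε c x)
      have h2 : 1 - 3 / 2 * ε ≤ (1 - ε) * (1 - q c x) := by nlinarith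
      nlinarith [sq_nonneg (η c x)]
    rw [← Finset.sum_mul, hηR x hx] at this
    rw [hgn]; linarith
  have hgs0 : ∀ c x, 0 ≤ g (some c) x := fun c x => by
    have h1 := le_of_abs_le (hqε c x)
    have : 0 ≤ 1 - q c x := by linarith
    have : 0 ≤ 1 - ε := by linarith
    rw [hgs]; positivity
  have hg0 : ∀ c x, 0 ≤ g c x := by
    rintro (_ | c) x
    · linarith [hglow x]
    · exact hgs0 c x
  have hgnl : IsBoundedLipschitz (g none) :=
    (IsBoundedLipschitz.sum Finset.univ fun c _ => hgsl c).one_sub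
  have hgl : ∀ c, IsBoundedLipschitz (g c) := by
    rintro (_ | c)
    exacts [hgnl, hgsl c]
  -- The ordinary cells vanish somewhere, but there the vanishing factor is already a square, `η c ^
  -- 2`, and only the factor bounded below by `1 / 4` needs a root.
  have hroot : ∀ c, ∃ r : Space → ℝ, IsBoundedLipschitz r ∧ ∀ x, r x ^ 2 = g c x := by
    rintro (_ | c)
    · exact ⟨_, hgnl.sqrt (half_pos hε) hglow, fun x => Real.sq_sqrt (hg0 _ _)⟩
    · have hl : ∀ x, 1 / 4 ≤ (1 - ε) * (1 - q c x) := fun x => by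
        have h1 := le_of_abs_le (hqε c x)
        nlinarith
      have hbl : IsBoundedLipschitz fun x => (1 - ε) * (1 - q c x) :=
        (IsBoundedLipschitz.const (1 - ε)).mul (hq c).one_sub
      refine ⟨_, (hη c).mul (hbl.sqrt (by norm_num) hl), fun x => ?_⟩
      rw [mul_pow, Real.sq_sqrt (by linarith [hl x]), hgs]; ring
  choose r hr hrg using hroot
  have hgi : ∀ c, Integrable fun x => g c x * u x ^ 2 := fun c => integrable_mul_sq hum hu1 (hgl c)
  have hm0 : ∀ c, 0 ≤ ∫ x, g c x * u x ^ 2 := fun c =>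
    integral_nonneg fun x => mul_nonneg (hg0 c x) (sq_nonneg _)
  set m : Option κ → NNReal := fun c => ⟨∫ x, g c x * u x ^ 2, hm0 c⟩ with hm
  have hmc : ∀ c, (m c : ℝ) = ∫ x, g c x * u x ^ 2 := fun _ => rfl
  have hgms : ∀ c, ∀ l ∈ lowFrequencies N, mode u F (g (some c)) (n * l) = 0 := by
    intro c l hl
    have e : mode u F (g (some c)) (n * l) =
        ((1 - ε : ℝ) : ℂ) * mode u F (fun x => η c x ^ 2 * (1 - q c x)) (n * l) := by
      rw [mode, mode, ← integral_const_mul]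
      refine integral_congr_ae (ae_of_all _ fun x => ?_)
      simp only [hgs]; push_cast; ring
    rw [e, hqm c l hl, mul_zero]
  -- The remainder needs no correction of its own: its modes are those of `u²` minus those of the
  -- other cells. Here `n ≠ 0` is used.
  have hgm : ∀ c, ∀ l ∈ lowFrequencies N, mode u F (g c) (n * l) = 0 := by
    rintro (_ | c) l hl
    · have hk : (n * l : ℤ) ≠ 0 := by
        have := (mem_lowFrequencies.1 hl).1
        have : (n : ℤ) ≠ 0 := by exact_mod_cast hn0.ne'
        positivity
      have e : ∀ x, ((g none x * u x ^ 2 : ℝ) : ℂ) * fourierPhase F (n * l) x =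
          ((u x ^ 2 : ℝ) : ℂ) * fourierPhase F (n * l) x -
          ∑ c, ((g (some c) x * u x ^ 2 : ℝ) : ℂ) * fourierPhase F (n * l) x := by
        intro x
        rw [hgn, ← Finset.sum_mul]
        simp only [hgs]
        push_cast
        rw [← Finset.sum_mul]
        ring
      have hi := fun c => integrable_mode hum hu1 (hgsl c) hFc (n * l)
      have hi1 : Integrable fun x => ((u x ^ 2 : ℝ) : ℂ) * fourierPhase F (n * l) x := by
        simpa using integrable_mode hum hu1 (IsBoundedLipschitz.const (1 : ℝ)) hFc (n * l)
      rw [mode]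
      simp_rw [e]
      rw [integral_sub hi1 (integrable_finsetSum _ fun c _ => hi c),
        integral_finsetSum _ fun c _ => hi c]
      have h1 : ∫ x, ((u x ^ 2 : ℝ) : ℂ) * fourierPhase F (n * l) x = 0 := hF0 _ hk
      rw [h1, Finset.sum_eq_zero (fun c _ => by simpa only [mode] using hgms c l hl), sub_zero]
    · exact hgms c l hl
  -- A cell without mass gets the orbital `u`, which is normalized and has no modes. It is not
  -- localized, hence the condition `m (some c) ≠ 0` in the diameter bound.
  set f : Option κ → Space → ℝ := fun c x => if m c = 0 then 1 else r c x * (Real.sqrt (m c))⁻¹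
    with hf
  have hfl : ∀ c, IsBoundedLipschitz (f c) := by
    intro c
    by_cases hc : m c = 0
    · simp only [hf, hc, if_true]; exact .const _
    · simp only [hf, hc, if_false]; exact (hr c).mul (.const _)
  have hf2 : ∀ c, m c ≠ 0 → ∀ x, f c x ^ 2 = (m c : ℝ)⁻¹ * g c x := by
    intro c hc x
    simp only [hf, hc, if_false]
    rw [mul_pow, inv_pow, Real.sq_sqrt (NNReal.coe_nonneg _), hrg, mul_comm]
  have hf2z : ∀ c, m c = 0 → ∀ x, f c x = 1 := by
    intro c hc x
    simp only [hf, hc, if_true]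
  refine ⟨κ, hκ, fun c x => ENNReal.ofReal (g c x), fun c x => f c x * u x, fourierPhase F n, m,
    ⟨fun c => (hfl c).continuous.measurable.mul hum, fun c => ?_, fun c d =>
      (hu d).mul_left hum (by rw [hu1]; simp) (hfl c), norm_fourierPhase _,
      isBoundedLipschitz_fourierPhase hF n, fun c a b ha hb hab => ?_⟩,
    fun c => (hgl c).continuous.measurable.ennreal_ofReal, fun x => ?_, fun c => ?_,
    fun c hc x y hx hy => ?_, ?_⟩
  · by_cases hc : m c = 0
    · simp_rw [hf2z c hc, one_mul, hu1]
    · have e : ∀ x, ‖f c x * u x‖ₑ ^ 2 = ENNReal.ofReal ((m c : ℝ)⁻¹ * (g c x * u x ^ 2)) := by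
        intro x
        rw [← enorm_pow, mul_pow, hf2 c hc, mul_assoc, Real.enorm_eq_ofReal]
        have := hg0 c x
        positivity
      simp_rw [e]
      rw [← ofReal_integral_eq_lintegral_ofReal ((hgi c).const_mul _)
        (ae_of_all _ fun x => mul_nonneg (by positivity) (mul_nonneg (hg0 c x) (sq_nonneg _))),
        integral_const_mul, ← hmc, inv_mul_cancel₀ (by exact_mod_cast hc), ENNReal.ofReal_one]
  · have hl : (a - b : ℤ) ∈ lowFrequencies N := by
      rw [mem_lowFrequencies, abs_lt]
      omega
    have hE : ∀ x, fourierPhase F n x ^ a * starRingEnd ℂ (fourierPhase F n x) ^ b =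
        fourierPhase F (n * (a - b)) x := by
      intro x
      rw [conj_fourierPhase, fourierPhase_pow, fourierPhase_pow, ← fourierPhase_add]
      congr 1; ring
    simp_rw [hE]
    by_cases hc : m c = 0
    · simp_rw [hf2z c hc, one_mul]
      have hk : (n * (a - b) : ℤ) ≠ 0 := by
        have := (mem_lowFrequencies.1 hl).1
        have : (n : ℤ) ≠ 0 := by exact_mod_cast hn0.ne'
        positivity
      exact hF0 _ hk
    · simp_rw [mul_pow, hf2 c hc]
      have e : ∀ x, (((m c : ℝ)⁻¹ * g c x * u x ^ 2 : ℝ) : ℂ) * fourierPhase F (n * (a - b)) x =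
          (((m c : ℝ)⁻¹ : ℝ) : ℂ) *
            (((g c x * u x ^ 2 : ℝ) : ℂ) * fourierPhase F (n * (a - b)) x) := by
        intro x; push_cast; ring
      simp_rw [e]
      rw [integral_const_mul]
      have := hgm c _ hl
      rw [mode] at this
      rw [this, mul_zero]
  · rw [← ENNReal.ofReal_sum_of_nonneg fun c _ => hg0 c x, hg1, ENNReal.ofReal_one]
  · by_cases hc : m c = 0
    · have h1 : ∫ x, g c x * u x ^ 2 = 0 := by rw [← hmc, hc]; simp
      rw [integral_eq_zero_iff_of_nonneg (fun x => mul_nonneg (hg0 c x) (sq_nonneg _)) (hgi c)] at h1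
      filter_upwards [h1] with x hx
      rw [hc, ← enorm_pow (u x), Real.enorm_eq_ofReal (sq_nonneg (u x)),
        ← ENNReal.ofReal_mul (hg0 c x)]
      simp only [Pi.zero_apply] at hx
      simp [hx]
    · refine ae_of_all _ fun x => ?_
      rw [← enorm_pow, ← enorm_pow, Real.enorm_eq_ofReal (sq_nonneg _),
        Real.enorm_eq_ofReal (sq_nonneg _), ← ENNReal.ofReal_mul (hg0 c x), mul_pow, hf2 c hc,
        ← ENNReal.ofReal_coe_nnreal, ← ENNReal.ofReal_mul (NNReal.coe_nonneg _)]
      congr 1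
      have : (m c : ℝ) ≠ 0 := by exact_mod_cast hc
      field_simp
  · refine hηh c x y (fun h0 => hx ?_) fun h0 => hy ?_
    · have : f (some c) x ^ 2 = 0 := by rw [hf2 _ hc, hgs, h0]; simp
      rw [pow_eq_zero_iff two_ne_zero] at this
      simp only [this, zero_mul]
    · simp only [hgs, h0]; simp
  · rw [hmc]
    have hi := (integrable_sq hum hu1).indicator
      (Metric.isClosed_closedBall (x := (0 : Space)) (ε := R)).measurableSet.compl
    have hone : ∫ x, u x ^ 2 = 1 := by
      rw [integral_eq_lintegral_of_nonneg_ae (ae_of_all _ fun x => sq_nonneg _)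
        (hum.pow_const 2).aestronglyMeasurable]
      have : ∀ x, ENNReal.ofReal (u x ^ 2) = ‖u x‖ₑ ^ 2 := fun x => by
        rw [← enorm_pow, Real.enorm_eq_ofReal (sq_nonneg _)]
      simp_rw [this, hu1]
      simp
    calc ∫ x, g none x * u x ^ 2 ≤ ∫ x, (3 / 2 * ε * u x ^ 2 +
          (Metric.closedBall (0 : Space) R)ᶜ.indicator (fun x => u x ^ 2) x) := by
          refine integral_mono (hgi none) ((hu2.const_mul _).add hi) fun x => ?_
          by_cases hx : x ∈ Metric.closedBall (0 : Space) R
          · simp only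
            rw [Set.indicator_of_notMem (by simpa using hx), add_zero]
            exact mul_le_mul_of_nonneg_right (hgup x hx) (sq_nonneg _)
          · simp only
            rw [Set.indicator_of_mem (by simpa using hx)]
            have h1 : g none x ≤ 1 := by
              rw [← hg1 x]
              exact Finset.single_le_sum (fun c _ => hg0 c x) (Finset.mem_univ _)
            nlinarith [sq_nonneg (u x)]
      _ ≤ δ := by
          rw [integral_add (hu2.const_mul _) hi, integral_const_mul, hone]
          linarith

end Cells

/-! ### Estimates for the Coulomb cost -/

section CostEstimates

variable {N : ℕ}

theorem measurable_coulombCost : Measurable (coulombCost (N := N)) :=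
  Finset.measurable_fun_sum _ fun i _ => Finset.measurable_fun_sum _ fun j _ =>
    ((measurable_pi_apply i).sub (measurable_pi_apply j)).enorm.inv

/-- Integrate over particle `i` first, with the others frozen: the inner integral is the potential
of `f i` at the position of particle `j`, bounded uniformly by `A`. -/
theorem lintegral_inv_enorm_sub_mul_prod_le {f : Fin N → Space → ℝ≥0∞}
    (hf : ∀ i, Measurable (f i)) {i j : Fin N} (hij : i ≠ j) (h1 : ∫⁻ x, f i x = 1) {A : ℝ≥0∞}
    (hA : ∀ y, ∫⁻ x, ‖x - y‖ₑ⁻¹ * f i x ≤ A) :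
    ∫⁻ X : Positions N, ‖X i - X j‖ₑ⁻¹ * ∏ l, f l (X l) ≤
      A * ∫⁻ X : Positions N, ∏ l, f l (X l) := by
  classical
  have hp : Measurable fun X : Positions N => ∏ l, f l (X l) :=
    Finset.measurable_prod _ fun l _ => (hf l).comp (measurable_pi_apply l)
  have hq : Measurable fun X : Positions N => ‖X i - X j‖ₑ⁻¹ * ∏ l, f l (X l) :=
    ((measurable_pi_apply i).sub (measurable_pi_apply j)).enorm.inv.mul hp
  have hup : ∀ (X : Positions N) (t : Space), ∏ l, f l (Function.update X i t l) =
      f i t * ∏ l ∈ Finset.univ.erase i, f l (X l) := by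
    intro X t
    rw [← Finset.mul_prod_erase _ _ (Finset.mem_univ i), Function.update_self]
    congr 1
    refine Finset.prod_congr rfl fun l hl => ?_
    rw [Function.update_of_ne (Finset.ne_of_mem_erase hl)]
  rw [volume_pi, lintegral_eq_lmarginal_univ (0 : Positions N),
    lintegral_eq_lmarginal_univ (0 : Positions N), lmarginal_erase' _ hq (Finset.mem_univ i),
    lmarginal_erase' _ hp (Finset.mem_univ i)]
  simp only [lmarginal]
  refine (lintegral_mono fun y => ?_).trans (le_of_eq (lintegral_const_mul A ?_))
  · simp_rw [hup, Function.update_self, Function.update_of_ne hij.symm, ← mul_assoc]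
    have hm : Measurable fun t : Space =>
        ‖t - Function.updateFinset (0 : Positions N) (Finset.univ.erase i) y j‖ₑ⁻¹ * f i t :=
      (measurable_id.sub_const _).enorm.inv.mul (hf i)
    rw [lintegral_mul_const _ hm,
      lintegral_mul_const _ (hf i), h1, one_mul]
    gcongr
    exact hA _
  · simp_rw [hup]
    refine Measurable.lintegral_prod_right ?_
    refine Measurable.mul ((hf i).comp measurable_snd) ?_
    refine Finset.measurable_prod _ fun l _ => (hf l).comp ?_
    exact ((measurable_pi_apply l).comp
      (measurable_updateFinset (x := (0 : Positions N)) (s := Finset.univ.erase i))).comp measurable_fst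

theorem lintegral_coulombCost_mul_prod_le {f : Space → ℝ≥0∞} (hf : Measurable f)
    (h1 : ∫⁻ x, f x = 1) {A : ℝ≥0∞} (hA : ∀ y, ∫⁻ x, ‖x - y‖ₑ⁻¹ * f x ≤ A) :
    ∫⁻ X : Positions N, coulombCost X * ∏ l, f (X l) ≤ N * N * A := by
  have hp : Measurable fun X : Positions N => ∏ l, f (X l) :=
    Finset.measurable_prod _ fun l _ => hf.comp (measurable_pi_apply l)
  have hq : ∀ i j, Measurable fun X : Positions N => ‖X i - X j‖ₑ⁻¹ * ∏ l, f (X l) := fun i j =>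
    ((measurable_pi_apply i).sub (measurable_pi_apply j)).enorm.inv.mul hp
  have hone : ∫⁻ X : Positions N, ∏ l, f (X l) = 1 := by
    rw [volume_pi, lintegral_fintype_prod_eq_prod volume (fun _ => f) fun _ => hf]
    exact Finset.prod_eq_one fun _ _ => h1
  simp_rw [coulombCost, Finset.sum_mul]
  rw [lintegral_finsetSum _ fun i _ => Finset.measurable_fun_sum _ fun j _ => hq i j]
  calc ∑ i, ∫⁻ X : Positions N, ∑ j ∈ Finset.Ioi i, ‖X i - X j‖ₑ⁻¹ * ∏ l, f (X l)
      ≤ ∑ _i : Fin N, ∑ _j : Fin N, A := by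
        refine Finset.sum_le_sum fun i _ => ?_
        rw [lintegral_finsetSum _ fun j _ => hq i j]
        refine (Finset.sum_le_sum fun j hj => ?_).trans
          (Finset.sum_le_sum_of_subset (Finset.subset_univ (Finset.Ioi i)))
        have := lintegral_inv_enorm_sub_mul_prod_le (f := fun _ => f) (fun _ => hf)
          (Finset.mem_Ioi.1 hj).ne h1 hA
        rwa [hone, mul_one] at this
    _ = N * N * A := by simp [mul_assoc]

theorem coulombCost_le_mul {x X : Positions N} {θ : ℝ≥0∞} (hθ0 : θ ≠ 0) (hθ : θ ≠ ⊤)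
    (h : ∀ i j, i ≠ j → ‖x i - x j‖ₑ ≤ θ * ‖X i - X j‖ₑ) :
    coulombCost X ≤ θ * coulombCost x := by
  simp_rw [coulombCost, Finset.mul_sum]
  refine Finset.sum_le_sum fun i _ => Finset.sum_le_sum fun j hj => ?_
  have h1 := ENNReal.inv_le_inv.2 (h i j (Finset.mem_Ioi.1 hj).ne)
  rw [ENNReal.mul_inv (.inl hθ0) (.inl hθ)] at h1
  calc ‖X i - X j‖ₑ⁻¹ = θ * (θ⁻¹ * ‖X i - X j‖ₑ⁻¹) := by
        rw [← mul_assoc, ENNReal.mul_inv_cancel hθ0 hθ, one_mul]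
    _ ≤ _ := by gcongr

/-- The configurations whose particles have pairwise distance at least `δ`. -/
def separated (N : ℕ) (δ : ℝ) : Set (Positions N) := {x | ∀ i j, i ≠ j → δ ≤ ‖x i - x j‖}

theorem measurableSet_separated (δ : ℝ) : MeasurableSet (separated N δ) := by
  have : separated N δ = ⋂ i, ⋂ j, ⋂ _ : i ≠ j, {x : Positions N | δ ≤ ‖x i - x j‖} := by
    ext x; simp [separated]
  rw [this]
  exact .iInter fun i => .iInter fun j => .iInter fun _ =>
    measurableSet_le measurable_const ((measurable_pi_apply i).sub (measurable_pi_apply j)).norm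

theorem comp_mem_separated {δ : ℝ} (σ : Equiv.Perm (Fin N)) {x : Positions N} :
    x ∘ σ ∈ separated N δ ↔ x ∈ separated N δ := by
  refine ⟨fun h i j hij => ?_, fun h i j hij => h _ _ (σ.injective.ne hij)⟩
  simpa using h (σ.symm i) (σ.symm j) (σ.symm.injective.ne hij)

/-- Markov's inequality: a pair at distance below `δ` already costs at least `1 / δ`. -/
theorem measure_compl_separated_le (γ : Measure (Positions N)) {δ : ℝ} (hδ : 0 < δ) :
    γ (separated N δ)ᶜ ≤ ENNReal.ofReal δ * transportCost γ := by
  have hlow : ∀ x ∈ (separated N δ)ᶜ, (ENNReal.ofReal δ)⁻¹ ≤ coulombCost x := by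
    intro x hx
    simp only [separated, Set.mem_compl_iff, Set.mem_ofPred_eq, not_forall, not_le] at hx
    obtain ⟨i, j, hij, hx⟩ := hx
    have key : ∀ i j : Fin N, i < j → ‖x i - x j‖ < δ →
        (ENNReal.ofReal δ)⁻¹ ≤ coulombCost x := by
      intro i j hij hx
      calc (ENNReal.ofReal δ)⁻¹ ≤ ‖x i - x j‖ₑ⁻¹ := by
            rw [ENNReal.inv_le_inv, ← ofReal_norm]
            exact ENNReal.ofReal_le_ofReal hx.le
        _ ≤ ∑ j ∈ Finset.Ioi i, ‖x i - x j‖ₑ⁻¹ :=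
            Finset.single_le_sum (f := fun j => ‖x i - x j‖ₑ⁻¹) (fun _ _ => zero_le)
              (Finset.mem_Ioi.2 hij)
        _ ≤ _ := Finset.single_le_sum (f := fun i => ∑ j ∈ Finset.Ioi i, ‖x i - x j‖ₑ⁻¹)
            (fun _ _ => zero_le) (Finset.mem_univ i)
    rcases lt_or_gt_of_ne hij with h | h
    · exact key i j h hx
    · exact key j i h (by rwa [norm_sub_rev])
  have hd0 : ENNReal.ofReal δ ≠ 0 := by simpa using hδ
  calc γ (separated N δ)ᶜ
      = ENNReal.ofReal δ * ∫⁻ _ in (separated N δ)ᶜ, (ENNReal.ofReal δ)⁻¹ ∂γ := by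
        rw [setLIntegral_const, ← mul_assoc,
          ENNReal.mul_inv_cancel hd0 ENNReal.ofReal_ne_top, one_mul]
    _ ≤ ENNReal.ofReal δ * ∫⁻ x in (separated N δ)ᶜ, coulombCost x ∂γ := by
        refine mul_le_mul_right ?_ _
        exact setLIntegral_mono measurable_coulombCost hlow
    _ ≤ _ := by
        gcongr
        exact setLIntegral_le_lintegral _ _

end CostEstimates

/-! ### The independent coupling of the remaining mass -/

section Completion

variable {N : ℕ} {ι : Type*} [Fintype ι]

/-- The independent coupling of a finite measure with itself, normalized to have that measure as
marginals. -/
def independentWeight (b : ι → NNReal) (k : Fin N → ι) : NNReal :=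
  (∑ c, b c) * ∏ i, b (k i) / ∑ c, b c

theorem sum_independentWeight_mul_prod (b : ι → NNReal) (f : Fin N → ι → ℝ≥0∞) :
    ∑ k, (independentWeight b k : ℝ≥0∞) * ∏ i, f i (k i) =
      (∑ c, b c : NNReal) * ∏ i, ∑ c, (b c / ∑ c, b c : NNReal) * f i c := by
  classical
  rw [Finset.prod_univ_sum, Finset.mul_sum, Fintype.piFinset_univ]
  refine Finset.sum_congr rfl fun k _ => ?_
  rw [independentWeight, ENNReal.coe_mul, ENNReal.ofNNReal_finsetProd, Finset.prod_mul_distrib, mul_assoc]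

theorem independentWeight_comp_perm (b : ι → NNReal) (k : Fin N → ι) (σ : Equiv.Perm (Fin N)) :
    independentWeight b (k ∘ σ) = independentWeight b k := by
  rw [independentWeight, independentWeight]
  congr 1
  exact Equiv.prod_comp σ fun i => b (k i) / ∑ c, b c

theorem sum_independentWeight_mul [NeZero N] (b : ι → NNReal) (f : ι → ℝ≥0∞) :
    ∑ k : Fin N → ι, (independentWeight b k : ℝ≥0∞) * f (k 0) = ∑ c, (b c : ℝ≥0∞) * f c := by
  classical
  have h := sum_independentWeight_mul_prod b (fun i c => if i = (0 : Fin N) then f c else 1)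
  have e : ∀ k : Fin N → ι, ∏ i, (if i = (0 : Fin N) then f (k i) else 1) = f (k 0) := by
    intro k; rw [Finset.prod_ite_eq' Finset.univ (0 : Fin N) fun i => f (k i)]; simp
  simp_rw [e] at h
  rw [h]
  by_cases hB : ∑ c, b c = 0
  · have : ∀ c, b c = 0 := fun c => by
      simpa using (Finset.sum_eq_zero_iff.1 hB) c (Finset.mem_univ c)
    simp [this]
  · rw [Finset.prod_eq_single (0 : Fin N)]
    · simp only [if_true]
      rw [Finset.mul_sum]
      refine Finset.sum_congr rfl fun c _ => ?_
      rw [← mul_assoc, ← ENNReal.coe_mul, mul_div_cancel₀ _ hB]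
    · intro i _ hi
      simp only [hi, if_false, mul_one]
      rw [← ENNReal.ofNNReal_finsetSum, ← Finset.sum_div, div_self hB, ENNReal.coe_one]
    · simp

end Completion

section IndependentPart

variable {N : ℕ} {ι : Type*} [Fintype ι] {ψ : ι → Space → ℝ} {E : Space → ℂ}

/-- With `|D|² ≤ N!` for the Vandermonde factor `D`, the sum is at most `N! B` times the energy of a
product of copies of `f ≤ u² / B`, where `B` is the total mass. Points within `r` contribute at most
`A / B` to the potential of `f`, and the others at most `1 / r`. The prefactor `B` cancels the
singular `1 / B`, so the bound is small even though `f` may be concentrated. -/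
theorem sum_independentWeight_interaction_le [NeZero N] (h : IsOrbitalFamily N ψ E)
    (b : ι → NNReal) {u : Space → ℝ}
    (hb : ∀ᵐ x, ∑ c, (b c : ℝ≥0∞) * ‖ψ c x‖ₑ ^ 2 ≤ ‖u x‖ₑ ^ 2) {r : ℝ} {A : ℝ≥0∞}
    (hA : ∀ p : Space, ∫⁻ x in Metric.ball p r, ‖x - p‖ₑ⁻¹ * ‖u x‖ₑ ^ 2 ≤ A) :
    ∑ k : Fin N → ι, (independentWeight b k : ℝ≥0∞) * ∫⁻ X, coulombCost X * blockDensity ψ E k X ≤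
      N.factorial * (N * N) * (A + (∑ c, b c : NNReal) * (ENNReal.ofReal r)⁻¹) := by
  set B := ∑ c, b c with hB
  by_cases hB0 : B = 0
  · have : ∀ k : Fin N → ι, independentWeight b k = 0 := fun k => by
      rw [independentWeight, ← hB, hB0, zero_mul]
    simp [this]
  have hBe0 : (B : ℝ≥0∞) ≠ 0 := by exact_mod_cast hB0
  set f : Space → ℝ≥0∞ := fun x => ∑ c, (b c / B : NNReal) * ‖ψ c x‖ₑ ^ 2 with hf
  have hfm : Measurable f := Finset.measurable_fun_sum _ fun c _ =>
    ((h.measurable c).enorm.pow_const 2).const_mul _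
  have hf1 : ∫⁻ x, f x = 1 := by
    rw [hf, lintegral_finsetSum _ fun c _ => ((h.measurable c).enorm.pow_const 2).const_mul _]
    simp_rw [lintegral_const_mul' _ _ ENNReal.coe_ne_top, h.norm_one, mul_one]
    rw [← ENNReal.ofNNReal_finsetSum, ← Finset.sum_div, div_self hB0, ENNReal.coe_one]
  have hfu : ∀ᵐ x, f x ≤ (B : ℝ≥0∞)⁻¹ * ‖u x‖ₑ ^ 2 := by
    filter_upwards [hb] with x hx
    refine le_trans (le_of_eq ?_) (mul_le_mul_right hx _)
    rw [Finset.mul_sum]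
    refine Finset.sum_congr rfl fun c _ => ?_
    rw [← mul_assoc, ENNReal.coe_div hB0, ENNReal.div_eq_inv_mul]
  have hpot : ∀ y, ∫⁻ x, ‖x - y‖ₑ⁻¹ * f x ≤ (B : ℝ≥0∞)⁻¹ * A + (ENNReal.ofReal r)⁻¹ := by
    intro y
    rw [← lintegral_add_compl _ (Metric.isOpen_ball (x := y) (ε := r)).measurableSet]
    gcongr
    · refine le_trans (lintegral_mono_ae (g := fun x =>
        (B : ℝ≥0∞)⁻¹ * (‖x - y‖ₑ⁻¹ * ‖u x‖ₑ ^ 2)) (ae_restrict_of_ae ?_)) ?_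
      · filter_upwards [hfu] with x hx
        rw [mul_left_comm]
        gcongr
      · rw [lintegral_const_mul' _ _ (by simpa using hB0)]
        gcongr
        exact hA y
    · calc ∫⁻ x in (Metric.ball y r)ᶜ, ‖x - y‖ₑ⁻¹ * f x
          ≤ ∫⁻ x in (Metric.ball y r)ᶜ, (ENNReal.ofReal r)⁻¹ * f x := by
            refine setLIntegral_mono (hfm.const_mul _) fun x hx => ?_
            gcongr
            rw [← ofReal_norm]
            refine ENNReal.ofReal_le_ofReal ?_
            simpa [dist_eq_norm] using hx
        _ ≤ ∫⁻ x, (ENNReal.ofReal r)⁻¹ * f x := setLIntegral_le_lintegral _ _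
        _ = _ := by rw [lintegral_const_mul _ hfm, hf1, mul_one]
  have hbm := fun k => measurable_blockDensity h (N := N) k
  have hcm := measurable_coulombCost (N := N)
  calc ∑ k, (independentWeight b k : ℝ≥0∞) * ∫⁻ X, coulombCost X * blockDensity ψ E k X
      = ∫⁻ X : Positions N, ∑ k, (independentWeight b k : ℝ≥0∞) * (coulombCost X * blockDensity ψ E k X) := by
        rw [lintegral_finsetSum _ fun k _ => (show Measurable fun X => (independentWeight b k : ℝ≥0∞) *
          (coulombCost X * blockDensity ψ E k X) from (hcm.mul (hbm k)).const_mul _)]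
        exact Finset.sum_congr rfl fun k _ => (lintegral_const_mul' _ _ ENNReal.coe_ne_top).symm
    _ ≤ ∫⁻ X : Positions N, (N.factorial * B) * (coulombCost X * ∏ i, f (X i)) := by
        refine lintegral_mono fun X => ?_
        have e : ∑ k, (independentWeight b k : ℝ≥0∞) * (coulombCost X * blockDensity ψ E k X) =
            ‖vandermondePhase E X‖ₑ ^ 2 * coulombCost X * (B * ∏ i, f (X i)) := by
          rw [hf, ← sum_independentWeight_mul_prod b fun i c => ‖ψ c (X i)‖ₑ ^ 2, Finset.mul_sum]
          refine Finset.sum_congr rfl fun k _ => ?_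
          rw [blockDensity]; ring
        rw [e]
        calc ‖vandermondePhase E X‖ₑ ^ 2 * coulombCost X * (B * ∏ i, f (X i))
            ≤ N.factorial * coulombCost X * (B * ∏ i, f (X i)) := by
              gcongr
              exact enorm_vandermondePhase_sq_le h.norm_phase X
          _ = _ := by ring
    _ = N.factorial * B * ∫⁻ X : Positions N, coulombCost X * ∏ i, f (X i) :=
        lintegral_const_mul' _ _ (by finiteness)
    _ ≤ N.factorial * B * (N * N * ((B : ℝ≥0∞)⁻¹ * A + (ENNReal.ofReal r)⁻¹)) := by
        gcongr
        exact lintegral_coulombCost_mul_prod_le hfm hf1 hpot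
    _ = _ := by
        rw [show (N.factorial * B * (N * N * ((B : ℝ≥0∞)⁻¹ * A + (ENNReal.ofReal r)⁻¹)) : ℝ≥0∞) =
          N.factorial * (N * N) * (B * (B : ℝ≥0∞)⁻¹ * A + B * (ENNReal.ofReal r)⁻¹) by ring,
          ENNReal.mul_inv_cancel hBe0 ENNReal.coe_ne_top, one_mul]

end IndependentPart

/-! ### Block weights of a plan -/

section BlockWeights

variable {N : ℕ} {κ : Type*}

theorem sum_ite_prod_eq {ι : Type*} [Fintype ι] [DecidableEq ι] (g : Fin N → ι → ℝ≥0∞)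
    (hg : ∀ i, ∑ c, g i c = 1) (i : Fin N) (c : ι) :
    ∑ k : Fin N → ι, (if k i = c then ∏ l, g l (k l) else 0) = g i c := by
  set f : Fin N → ι → ℝ≥0∞ := fun l c' => if l = i ∧ c' ≠ c then 0 else g l c' with hf
  have e : ∀ k : Fin N → ι, (if k i = c then ∏ l, g l (k l) else 0) = ∏ l, f l (k l) := by
    intro k
    split_ifs with hk
    · refine Finset.prod_congr rfl fun l _ => ?_
      simp only [hf]
      rw [if_neg]
      rintro ⟨rfl, h⟩
      exact h hk
    · exact (Finset.prod_eq_zero (Finset.mem_univ i) (by simp [hf, hk])).symm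
  simp_rw [e]
  have := Finset.prod_univ_sum (fun _ : Fin N => (Finset.univ : Finset ι)) f
  rw [Fintype.piFinset_univ] at this
  rw [← this, Finset.prod_eq_single i]
  · rw [Finset.sum_eq_single c]
    · simp [hf]
    · intro c' _ hc'
      simp [hf, hc']
    · simp
  · intro l _ hl
    simp only [hf, hl, false_and, if_false, hg]
  · simp

theorem sum_prod_eq_one {ι : Type*} [Fintype ι] (g : Fin N → ι → ℝ≥0∞)
    (hg : ∀ i, ∑ c, g i c = 1) : ∑ k : Fin N → ι, ∏ l, g l (k l) = 1 := by
  classical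
  have := Finset.prod_univ_sum (fun _ : Fin N => (Finset.univ : Finset ι)) g
  rw [Fintype.piFinset_univ] at this
  rw [← this]
  exact Finset.prod_eq_one fun i _ => hg i

open Classical in
/-- The mass which a plan assigns to the block `k` of a partition of unity, on the set of separated
configurations. Blocks which involve the exceptional cell get weight zero. -/
def blockWeight (γ : Measure (Positions N)) (δ : ℝ) (χ : Option κ → Space → ℝ≥0∞)
    (k : Fin N → Option κ) : ℝ≥0∞ :=
  if ∀ i, k i ≠ none then ∫⁻ x in separated N δ, ∏ i, χ (k i) (x i) ∂γ else 0

variable {γ : Measure (Positions N)} {δ : ℝ} {χ : Option κ → Space → ℝ≥0∞}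

theorem blockWeight_le (k : Fin N → Option κ) :
    blockWeight γ δ χ k ≤ ∫⁻ x in separated N δ, ∏ i, χ (k i) (x i) ∂γ := by
  rw [blockWeight]
  split_ifs
  exacts [le_rfl, zero_le]

theorem measurable_prod_cells (hχ : ∀ c, Measurable (χ c)) (k : Fin N → Option κ) :
    Measurable fun x : Positions N => ∏ i, χ (k i) (x i) :=
  Finset.measurable_prod _ fun i _ => (hχ (k i)).comp (measurable_pi_apply i)

theorem blockWeight_comp_perm (hχ : ∀ c, Measurable (χ c))
    (hS : ∀ (σ : Equiv.Perm (Fin N)) (f : Positions N → ℝ≥0∞), Measurable f →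
      ∫⁻ x, f (x ∘ σ) ∂γ = ∫⁻ x, f x ∂γ) (σ : Equiv.Perm (Fin N)) (k : Fin N → Option κ) :
    blockWeight γ δ χ (k ∘ σ) = blockWeight γ δ χ k := by
  have h1 : (∀ i, (k ∘ σ) i ≠ none) ↔ ∀ i, k i ≠ none :=
    ⟨fun h i => by simpa using h (σ.symm i), fun h i => h _⟩
  simp only [blockWeight, h1]
  split_ifs
  · have hD := measurableSet_separated (N := N) δ
    rw [← lintegral_indicator hD, ← lintegral_indicator hD,
      ← hS σ _ ((measurable_prod_cells hχ (k ∘ σ)).indicator hD)]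
    refine lintegral_congr fun x => ?_
    by_cases hx : x ∈ separated N δ
    · rw [Set.indicator_of_mem hx, Set.indicator_of_mem ((comp_mem_separated σ).2 hx)]
      exact Equiv.prod_comp σ fun i => χ (k i) (x i)
    · rw [Set.indicator_of_notMem hx, Set.indicator_of_notMem (mt (comp_mem_separated σ).1 hx)]
  · rfl

variable [Fintype κ] {m : Option κ → NNReal}

/-- The cell functions of the other particles sum to one, and restriction to separated
configurations only loses mass. Block weights thus never exceed the prescribed marginal, which
leaves a nonnegative deficit to fill. -/
theorem sum_ite_setLIntegral_le [DecidableEq κ] (hχ : ∀ c, Measurable (χ c))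
    (hχ1 : ∀ x, ∑ c, χ c x = 1) (i : Fin N) (c : Option κ) :
    ∑ k : Fin N → Option κ,
      (if k i = c then ∫⁻ x in separated N δ, ∏ l, χ (k l) (x l) ∂γ else 0) ≤
      ∫⁻ x, χ c (x i) ∂γ := by
  calc ∑ k : Fin N → Option κ,
      (if k i = c then ∫⁻ x in separated N δ, ∏ l, χ (k l) (x l) ∂γ else 0)
      = ∫⁻ x in separated N δ, ∑ k : Fin N → Option κ,
          (if k i = c then ∏ l, χ (k l) (x l) else 0) ∂γ := by
        rw [lintegral_finsetSum]
        · refine Finset.sum_congr rfl fun k _ => ?_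
          split_ifs <;> simp
        · intro k _
          split_ifs
          exacts [measurable_prod_cells hχ k, measurable_const]
    _ = ∫⁻ x in separated N δ, χ c (x i) ∂γ := by
        refine lintegral_congr fun x => ?_
        exact sum_ite_prod_eq (fun l c => χ c (x l)) (fun l => hχ1 (x l)) i c
    _ ≤ _ := setLIntegral_le_lintegral _ _

/-- Mass is lost only if two particles are too close or some particle is in the exceptional cell;
the latter is handled by a union bound. -/
theorem one_le_sum_blockWeight [IsProbabilityMeasure γ] (hχ : ∀ c, Measurable (χ c))
    (hχ1 : ∀ x, ∑ c, χ c x = 1) {a : ℝ≥0∞} (ha : ∀ i, ∫⁻ x, χ none (x i) ∂γ ≤ a) :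
    1 ≤ ∑ k, blockWeight γ δ χ k + (N * a + γ (separated N δ)ᶜ) := by
  classical
  have h1 : γ (separated N δ) ≤ ∑ k, blockWeight γ δ χ k + N * a := by
    calc γ (separated N δ) = ∫⁻ x in separated N δ, ∑ k : Fin N → Option κ,
          ∏ l, χ (k l) (x l) ∂γ := by
          rw [← setLIntegral_one]
          exact lintegral_congr fun x =>
            (sum_prod_eq_one (fun l c => χ c (x l)) fun l => hχ1 (x l)).symm
      _ = ∑ k : Fin N → Option κ, ∫⁻ x in separated N δ, ∏ l, χ (k l) (x l) ∂γ :=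
          lintegral_finsetSum _ fun k _ => measurable_prod_cells hχ k
      _ ≤ ∑ k : Fin N → Option κ, (blockWeight γ δ χ k + ∑ i, if k i = none then
            ∫⁻ x in separated N δ, ∏ l, χ (k l) (x l) ∂γ else 0) := by
          refine Finset.sum_le_sum fun k _ => ?_
          by_cases hk : ∀ i, k i ≠ none
          · rw [blockWeight, if_pos hk]
            exact le_self_add
          · push Not at hk
            obtain ⟨i, hi⟩ := hk
            refine le_add_left (le_trans (le_of_eq ?_) (Finset.single_le_sum
              (fun _ _ => zero_le) (Finset.mem_univ i)))
            rw [if_pos hi]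
      _ ≤ _ := by
          rw [Finset.sum_add_distrib, Finset.sum_comm]
          gcongr
          calc _ ≤ ∑ _i : Fin N, a := Finset.sum_le_sum fun i _ =>
                (sum_ite_setLIntegral_le hχ hχ1 i none).trans (ha i)
            _ = N * a := by simp
  calc 1 = γ (separated N δ) + γ (separated N δ)ᶜ := by
        rw [measure_add_measure_compl (measurableSet_separated δ), measure_univ]
    _ ≤ _ := by rw [← add_assoc]; gcongr

/-- Within a block each particle moves by at most `s`, so distances drop by at most `2s`. As
distances in `x` are at least `δ`, the hypothesis `hs` gives `‖x i - x j‖ ≤ (1 + t) ‖X i - X j‖`.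
The costs then compare pointwise, and averaging over the block and over `γ` keeps the comparison. -/
theorem sum_blockWeight_interaction_le {ψ : Option κ → Space → ℝ} {E : Space → ℂ} [NeZero N]
    (h : IsOrbitalFamily N ψ E) (hχ : ∀ c, Measurable (χ c)) (hχ1 : ∀ x, ∑ c, χ c x = 1)
    {t s : ℝ} (ht : 0 < t) (hs : 2 * s * (1 + t) ≤ δ * t)
    (hmz : ∀ c, m c = 0 → ∀ i, ∫⁻ x, χ c (x i) ∂γ = 0)
    (hsep : ∀ c : κ, m (some c) ≠ 0 → ∀ x y, ψ (some c) x ≠ 0 → χ (some c) y ≠ 0 → ‖x - y‖ ≤ s) :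
    ∑ k, blockWeight γ δ χ k * ∫⁻ X, coulombCost X * blockDensity ψ E k X ≤
      ENNReal.ofReal (1 + t) * transportCost γ := by
  have hbm := fun k => measurable_blockDensity h (N := N) k
  have hcm := measurable_coulombCost (N := N)
  have hθ0 : ENNReal.ofReal (1 + t) ≠ 0 := by
    rw [Ne, ENNReal.ofReal_eq_zero, not_le]; positivity
  have key : ∀ k, blockWeight γ δ χ k * ∫⁻ X, coulombCost X * blockDensity ψ E k X ≤
      ENNReal.ofReal (1 + t) *
        ∫⁻ x in separated N δ, coulombCost x * ∏ i, χ (k i) (x i) ∂γ := by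
    intro k
    by_cases hw : blockWeight γ δ χ k = 0
    · rw [hw, zero_mul]; exact zero_le (a := _)
    have hk : ∀ i, k i ≠ none := by
      by_contra hk
      exact hw (by rw [blockWeight, if_neg hk])
    have hχle : ∀ c x, χ c x ≤ 1 := fun c x => by
      rw [← hχ1 x]
      exact Finset.single_le_sum (f := fun c => χ c x) (fun _ _ => zero_le) (Finset.mem_univ c)
    have hmk : ∀ i, m (k i) ≠ 0 := by
      intro i hi
      refine hw (le_antisymm ((blockWeight_le k).trans ((setLIntegral_le_lintegral _ _).trans ?_))
        zero_le)
      rw [← hmz _ hi i]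
      refine lintegral_mono fun x => ?_
      rw [← Finset.mul_prod_erase _ _ (Finset.mem_univ i)]
      exact mul_le_of_le_one_right' (Finset.prod_le_one' fun l _ => hχle _ _)
    have hsep' : ∀ i x y, ψ (k i) x ≠ 0 → χ (k i) y ≠ 0 → ‖x - y‖ ≤ s := by
      intro i
      obtain ⟨c, hc⟩ := Option.ne_none_iff_exists'.1 (hk i)
      rw [hc]
      exact hsep c (hc ▸ hmk i)
    rw [blockWeight, if_pos hk, ← lintegral_const_mul' _ _ ENNReal.ofReal_ne_top]
    refine (lintegral_mul_const_le _ _).trans ?_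
    refine setLIntegral_mono (hcm.mul (measurable_prod_cells hχ k) |>.const_mul _) fun x hx => ?_
    by_cases hx0 : ∏ i, χ (k i) (x i) = 0
    · rw [hx0]; simp
    have hxi : ∀ i, χ (k i) (x i) ≠ 0 := fun i => Finset.prod_ne_zero_iff.1 hx0 i (Finset.mem_univ i)
    rw [← mul_assoc, mul_comm _ (∏ i, χ (k i) (x i))]
    gcongr
    calc ∫⁻ X, coulombCost X * blockDensity ψ E k X
        ≤ ∫⁻ X, (ENNReal.ofReal (1 + t) * coulombCost x) * blockDensity ψ E k X := by
          refine lintegral_mono fun X => ?_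
          by_cases hX : blockDensity ψ E k X = 0
          · rw [hX]; simp
          have hXi : ∀ i, ψ (k i) (X i) ≠ 0 := by
            intro i hi
            refine hX ?_
            rw [blockDensity, Finset.prod_eq_zero (Finset.mem_univ i) (by simp [hi]), zero_mul]
          gcongr
          refine coulombCost_le_mul hθ0 ENNReal.ofReal_ne_top fun i j hij => ?_
          rw [← ofReal_norm, ← ofReal_norm, ← ENNReal.ofReal_mul (by positivity)]
          refine ENNReal.ofReal_le_ofReal ?_
          have h1 := hsep' i _ _ (hXi i) (hxi i)
          have h2 := hsep' j _ _ (hXi j) (hxi j)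
          have h3 : ‖x i - x j‖ ≤ ‖X i - X j‖ + 2 * s := by
            calc ‖x i - x j‖ = ‖(X i - X j) - (X i - x i) + (X j - x j)‖ := by congr 1; abel
              _ ≤ ‖X i - X j‖ + ‖X i - x i‖ + ‖X j - x j‖ :=
                  (norm_add_le _ _).trans (by gcongr; exact norm_sub_le _ _)
              _ ≤ _ := by linarith
          have h4 := hx i j hij
          nlinarith
      _ = _ := by rw [lintegral_const_mul _ (hbm k), lintegral_blockDensity h, mul_one]
  calc ∑ k, blockWeight γ δ χ k * ∫⁻ X, coulombCost X * blockDensity ψ E k X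
      ≤ ∑ k, ENNReal.ofReal (1 + t) *
        ∫⁻ x in separated N δ, coulombCost x * ∏ i, χ (k i) (x i) ∂γ :=
        Finset.sum_le_sum fun k _ => key k
    _ = ENNReal.ofReal (1 + t) * ∫⁻ x in separated N δ, coulombCost x ∂γ := by
        rw [← Finset.mul_sum, ← lintegral_finsetSum _ fun k _ =>
          (show Measurable fun x => coulombCost x * ∏ i, χ (k i) (x i) from
            hcm.mul (measurable_prod_cells hχ k))]
        congr 1
        refine lintegral_congr fun x => ?_
        rw [← Finset.mul_sum, sum_prod_eq_one (fun l c => χ c (x l)) fun l => hχ1 (x l), mul_one]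
    _ ≤ _ := by
        gcongr
        exact setLIntegral_le_lintegral _ _

end BlockWeights

/-! ### Recovery of a plan by wavefunctions -/

section Approximation

variable {N : ℕ} [NeZero N]

/-- Every symmetric plan with finite cost can be approximated in cost by an admissible wavefunction
with the same one-body density. -/
theorem exists_wavefunction_interaction_le {u ρ : Space → ℝ} (hum : Measurable u)
    (hu1 : ∫⁻ x, ‖u x‖ₑ ^ 2 = 1)
    (hu : ∀ d, HasTranslationBound volume u (EuclideanSpace.single d (1 : ℝ)))
    (hρ : ρ =ᵐ[volume] fun x => N * u x ^ 2) {γ : Measure (Positions N)} [IsProbabilityMeasure γ]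
    (hS : ∀ (σ : Equiv.Perm (Fin N)) (f : Positions N → ℝ≥0∞), Measurable f →
      ∫⁻ x, f (x ∘ σ) ∂γ = ∫⁻ x, f x ∂γ)
    (hM : ∀ (i : Fin N) (f : Space → ℝ≥0∞), Measurable f →
      ∫⁻ x, f (x i) ∂γ = ∫⁻ x, f x * ‖u x‖ₑ ^ 2)
    (hC : transportCost γ ≠ ⊤) {ε : ℝ≥0∞} (hε : ε ≠ 0) :
    ∃ Φ : WaveFunction N, IsAdmissible Φ ∧ HasDensity Φ ρ ∧
      interactionEnergy Φ ≤ transportCost γ + ε := by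
  classical
  have hε3 : ε / 3 ≠ 0 := ENNReal.div_ne_zero.2 ⟨hε, by finiteness⟩
  set K : ℝ≥0∞ := N.factorial * (N * N) with hK
  have hKt : K ≠ ⊤ := by rw [hK]; finiteness
  -- Three errors of `ε / 3`: the distortion `t` of distances, the local potential `a` in balls of
  -- radius `r`, and the remaining mass `β` interacting at distance beyond `r`. Then `δ` makes the
  -- mass of close configurations less than `β / 2`.
  obtain ⟨t, ht, htC⟩ := ENNReal.exists_nnreal_pos_mul_lt hC hε3
  obtain ⟨a, ha, haK⟩ := ENNReal.exists_nnreal_pos_mul_lt hKt hε3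
  obtain ⟨r, hr, hra⟩ := exists_potential_ball_le hum hu1 hu (ε := a) (by exact_mod_cast ha.ne')
  have hr0 : ENNReal.ofReal r ≠ 0 := by simpa using hr
  obtain ⟨β, hβ, hβK⟩ := ENNReal.exists_nnreal_pos_mul_lt
    (ENNReal.mul_ne_top hKt (ENNReal.inv_ne_top.2 hr0)) hε3
  obtain ⟨δ, hδ, hδC⟩ := ENNReal.exists_nnreal_pos_mul_lt hC
    (b := ((β / 2 : NNReal) : ℝ≥0∞)) (by exact_mod_cast (half_pos hβ).ne')
  have hN : (0 : ℝ) < N := by exact_mod_cast NeZero.pos N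
  have ht' : (0 : ℝ) < t := by exact_mod_cast ht
  have hδ' : (0 : ℝ) < δ := by exact_mod_cast hδ
  have hβ' : (0 : ℝ) < β := by exact_mod_cast hβ
  obtain ⟨κ, hκ, χ, ψ, E, m, hψ, hχ, hχ1, hmχ, hsep, hnone⟩ :=
    exists_orbital_cells hum hu1 hu N (h := δ * t / (2 * (1 + t))) (by positivity)
      (δ := β / (2 * N)) (by positivity)
  have hmu : ∀ c, ∫⁻ x, χ c x * ‖u x‖ₑ ^ 2 = m c := by
    intro c
    rw [← lintegral_congr_ae (hmχ c), lintegral_const_mul' _ _ ENNReal.coe_ne_top, hψ.norm_one,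
      mul_one]
  have hMχ : ∀ c i, ∫⁻ x, χ c (x i) ∂γ = m c := fun c i => by rw [hM i _ (hχ c), hmu]
  have hm1 : ∑ c, m c = 1 := by
    have : ∑ c, (m c : ℝ≥0∞) = 1 := by
      simp_rw [← hmu]
      rw [← lintegral_finsetSum _ fun c _ => (show Measurable fun x => χ c x * ‖u x‖ₑ ^ 2 from
        (hχ c).mul (hum.enorm.pow_const 2)), ← hu1]
      refine lintegral_congr fun x => ?_
      rw [← Finset.sum_mul, hχ1, one_mul]
    exact_mod_cast this
  have hwsum : ∀ c, ∑ k : Fin N → Option κ, (if k 0 = c then blockWeight γ δ χ k else 0) ≤ m c := by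
    intro c
    rw [← hMχ c 0]
    refine le_trans (Finset.sum_le_sum fun k _ => ?_) (sum_ite_setLIntegral_le (δ := δ) hχ hχ1 0 c)
    split_ifs
    exacts [blockWeight_le k, le_rfl]
  have hwt : ∀ k, blockWeight γ δ χ k ≠ ⊤ := fun k => by
    refine ne_top_of_le_ne_top (ENNReal.coe_ne_top (r := m (k 0))) (le_trans ?_ (hwsum (k 0)))
    refine le_trans (le_of_eq ?_) (Finset.single_le_sum (fun _ _ => zero_le) (Finset.mem_univ k))
    rw [if_pos rfl]
  set w : (Fin N → Option κ) → NNReal := fun k => (blockWeight γ δ χ k).toNNReal with hw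
  have hwc : ∀ k, (w k : ℝ≥0∞) = blockWeight γ δ χ k := fun k => ENNReal.coe_toNNReal (hwt k)
  set p : Option κ → NNReal := fun c => ∑ k, if k 0 = c then w k else 0 with hp
  have hpm : ∀ c, p c ≤ m c := by
    intro c
    rw [← ENNReal.coe_le_coe, hp, ENNReal.ofNNReal_finsetSum]
    refine le_trans (le_of_eq (Finset.sum_congr rfl fun k _ => ?_)) (hwsum c)
    split_ifs
    exacts [hwc k, rfl]
  have hps : ∀ f : Option κ → ℝ≥0∞, ∑ k, (w k : ℝ≥0∞) * f (k 0) = ∑ c, (p c : ℝ≥0∞) * f c := by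
    intro f
    simp_rw [hp, ENNReal.ofNNReal_finsetSum, Finset.sum_mul]
    rw [Finset.sum_comm]
    refine Finset.sum_congr rfl fun k _ => ?_
    rw [Finset.sum_eq_single (k 0)]
    · rw [if_pos rfl]
    · intro c _ hc
      rw [if_neg hc.symm]; simp
    · simp
  -- Filling exactly the deficit of the marginal makes the total weights have marginal `m`, so the
  -- density constraint holds exactly and not just approximately.
  set b : Option κ → NNReal := fun c => m c - p c with hb
  have hpb : ∀ c, p c + b c = m c := fun c => add_tsub_cancel_of_le (hpm c)
  set W : (Fin N → Option κ) → NNReal := fun k => w k + independentWeight b k with hW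
  have hWs : ∀ f : Option κ → ℝ≥0∞, ∑ k, (W k : ℝ≥0∞) * f (k 0) = ∑ c, (m c : ℝ≥0∞) * f c := by
    intro f
    simp_rw [hW, ENNReal.coe_add, add_mul]
    rw [Finset.sum_add_distrib, hps, sum_independentWeight_mul, ← Finset.sum_add_distrib]
    refine Finset.sum_congr rfl fun c _ => ?_
    rw [← add_mul, ← ENNReal.coe_add, hpb]
  have hmuae : ∀ᵐ x, ∑ c, (m c : ℝ≥0∞) * ‖ψ c x‖ₑ ^ 2 = ‖u x‖ₑ ^ 2 := by
    filter_upwards [ae_all_iff.2 hmχ] with x hx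
    simp_rw [hx]
    rw [← Finset.sum_mul, hχ1, one_mul]
  have hWp : ∀ (σ : Equiv.Perm (Fin N)) k, W (k ∘ σ) = W k := fun σ k => by
    simp only [hW, hw]
    rw [blockWeight_comp_perm hχ hS, independentWeight_comp_perm]
  obtain ⟨h1, h2⟩ := isAdmissible_superposition hψ hWp hu1 hρ (by
    filter_upwards [hmuae] with x hx
    rw [hWs fun c => ‖ψ c x‖ₑ ^ 2, hx])
  refine ⟨_, h1, h2, ?_⟩
  have hB : ((∑ c, b c : NNReal) : ℝ≥0∞) ≤ β := by
    have e1 : ∑ k, w k + ∑ c, b c = 1 := by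
      have := hps fun _ => 1
      simp only [mul_one] at this
      have e : ∑ k, w k = ∑ c, p c := by exact_mod_cast this
      rw [e, ← Finset.sum_add_distrib, ← hm1]
      exact Finset.sum_congr rfl fun c _ => hpb c
    -- The deficit equals the mass missed by the blocks: `β / 2` at most for `N` particles with
    -- exceptional mass `β / (2N)` each, and `β / 2` for close configurations.
    have e2 := one_le_sum_blockWeight (γ := γ) (δ := δ) hχ hχ1 (a := m none)
      fun i => (hMχ none i).le
    simp_rw [← hwc] at e2
    rw [← ENNReal.ofNNReal_finsetSum, ← ENNReal.coe_one, ← e1, ENNReal.coe_add,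
      ENNReal.add_le_add_iff_left ENNReal.coe_ne_top] at e2
    refine e2.trans ?_
    have e3 : (N : ℝ≥0∞) * m none ≤ (β / 2 : NNReal) := by
      have : (N : NNReal) * m none ≤ β / 2 := by
        rw [← NNReal.coe_le_coe]
        push_cast
        calc (N : ℝ) * m none ≤ N * (β / (2 * N)) := by gcongr
          _ = β / 2 := by field_simp
      exact_mod_cast this
    have e4 : γ (separated N δ)ᶜ ≤ (β / 2 : NNReal) := by
      refine (measure_compl_separated_le γ hδ').trans ?_
      rw [ENNReal.ofReal_coe_nnreal]
      exact hδC.le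
    refine (add_le_add e3 e4).trans (le_of_eq ?_)
    rw [← ENNReal.coe_add, add_halves]
  rw [interactionEnergy_superposition hψ]
  simp_rw [hW, ENNReal.coe_add, add_mul]
  rw [Finset.sum_add_distrib]
  have hI1 : ∑ k, (w k : ℝ≥0∞) * ∫⁻ X, coulombCost X * blockDensity ψ E k X ≤
      ENNReal.ofReal (1 + t) * transportCost γ := by
    simp_rw [hwc]
    refine sum_blockWeight_interaction_le (m := m) hψ hχ hχ1 ht' (le_of_eq ?_) (fun c hc i => ?_)
      hsep
    · field_simp
    · rw [hMχ, hc, ENNReal.coe_zero]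
  have hI2 := sum_independentWeight_interaction_le (N := N) hψ b (u := u) (r := r) (A := a) (by
    filter_upwards [hmuae] with x hx
    rw [← hx]
    gcongr
    exact tsub_le_self) hra
  calc _ ≤ ENNReal.ofReal (1 + t) * transportCost γ +
        K * (a + (∑ c, b c : NNReal) * (ENNReal.ofReal r)⁻¹) := add_le_add hI1 hI2
    _ ≤ ENNReal.ofReal (1 + t) * transportCost γ + K * (a + β * (ENNReal.ofReal r)⁻¹) := by gcongr
    _ = transportCost γ + (t * transportCost γ + a * K + β * (K * (ENNReal.ofReal r)⁻¹)) := by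
        rw [ENNReal.ofReal_add zero_le_one ht'.le, ENNReal.ofReal_one, ENNReal.ofReal_coe_nnreal]
        ring
    _ ≤ transportCost γ + (ε / 3 + ε / 3 + ε / 3) := by gcongr
    _ = _ := by rw [ENNReal.add_thirds]

end Approximation

/-! ### Plans as invariant measures with a prescribed marginal -/

section Plans

variable {N : ℕ}

theorem measurable_comp_perm (σ : Equiv.Perm (Fin N)) :
    Measurable fun x : Positions N => x ∘ σ :=
  measurable_pi_lambda _ fun i => measurable_pi_apply (σ i)

theorem continuous_comp_perm (σ : Equiv.Perm (Fin N)) :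
    Continuous fun x : Positions N => x ∘ σ :=
  continuous_pi fun i => continuous_apply (σ i)

theorem measurePreserving_comp_perm (σ : Equiv.Perm (Fin N)) :
    MeasurePreserving (fun x : Positions N => x ∘ σ) := by
  have h := volume_measurePreserving_piCongrLeft (fun _ : Fin N => Space) σ.symm
  have e : (fun x : Positions N => x ∘ σ) =
      MeasurableEquiv.piCongrLeft (fun _ : Fin N => Space) σ.symm := by
    funext x
    funext i
    have := MeasurableEquiv.piCongrLeft_apply_apply σ.symm (β := fun _ => Space) x (σ i)
    rw [Equiv.symm_apply_apply] at this
    rw [this]; rfl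
  rw [e]
  exact h

theorem preimage_comp_perm_pi (σ : Equiv.Perm (Fin N)) (A : Fin N → Set Space) :
    (fun x : Positions N => x ∘ σ) ⁻¹' Set.univ.pi (fun i => A (σ i)) = Set.univ.pi A := by
  ext x
  simp only [Set.mem_preimage, Set.mem_univ_pi, Function.comp]
  exact σ.forall_congr_right (q := fun i => x i ∈ A i)

theorem lintegral_comp_perm_of_map_eq {γ : Measure (Positions N)}
    (h : ∀ σ : Equiv.Perm (Fin N), γ.map (fun x => x ∘ σ) = γ) (σ : Equiv.Perm (Fin N))
    {f : Positions N → ℝ≥0∞} (hf : Measurable f) : ∫⁻ x, f (x ∘ σ) ∂γ = ∫⁻ x, f x ∂γ := by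
  conv_rhs => rw [← h σ]
  rw [lintegral_map hf (measurable_comp_perm σ)]

/-- The one-body probability measure with density `u²`. -/
def squareMeasure (u : Space → ℝ) : Measure Space := volume.withDensity fun x => ‖u x‖ₑ ^ 2

theorem lintegral_squareMeasure {u : Space → ℝ} (hum : Measurable u) {f : Space → ℝ≥0∞}
    (hf : Measurable f) : ∫⁻ x, f x ∂squareMeasure u = ∫⁻ x, f x * ‖u x‖ₑ ^ 2 := by
  rw [squareMeasure, lintegral_withDensity_eq_lintegral_mul _ (hum.enorm.pow_const 2) hf]
  exact lintegral_congr fun x => mul_comm _ _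

theorem isProbabilityMeasure_squareMeasure {u : Space → ℝ} (hu1 : ∫⁻ x, ‖u x‖ₑ ^ 2 = 1) :
    IsProbabilityMeasure (squareMeasure u) :=
  ⟨by rw [squareMeasure, withDensity_apply _ .univ, setLIntegral_univ, hu1]⟩

variable [NeZero N] {u ρ : Space → ℝ}

theorem setIntegral_density (hum : Measurable u) (hρ : ρ =ᵐ[volume] fun x => N * u x ^ 2)
    {A : Set Space} (hA : MeasurableSet A) :
    ∫ x in A, ρ x / N = (squareMeasure u A).toReal := by
  have hN : (N : ℝ) ≠ 0 := by exact_mod_cast NeZero.ne N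
  have e : ∫ x in A, ρ x / N = ∫ x in A, u x ^ 2 := by
    refine integral_congr_ae (ae_restrict_of_ae ?_)
    filter_upwards [hρ] with x hx
    rw [hx, mul_div_cancel_left₀ _ hN]
  rw [e, integral_eq_lintegral_of_nonneg_ae (ae_of_all _ fun x => sq_nonneg _)
    (hum.pow_const 2).aestronglyMeasurable, squareMeasure, withDensity_apply _ hA]
  congr 1
  refine lintegral_congr fun x => ?_
  rw [← enorm_pow, Real.enorm_eq_ofReal (sq_nonneg _)]

/-- Plans are the symmetric probability measures with one-body marginal `ρ / N`. -/
theorem isPlan_iff (hum : Measurable u) (hu1 : ∫⁻ x, ‖u x‖ₑ ^ 2 = 1)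
    (hρ : ρ =ᵐ[volume] fun x => N * u x ^ 2) {γ : Measure (Positions N)} [IsProbabilityMeasure γ] :
    IsPlan ρ γ ↔ (∀ σ : Equiv.Perm (Fin N), γ.map (fun x => x ∘ σ) = γ) ∧
      γ.map (fun x => x 0) = squareMeasure u := by
  have hprob := isProbabilityMeasure_squareMeasure hu1
  refine ⟨fun h => ⟨fun σ => ?_, ?_⟩, fun ⟨h1, h2⟩ => ⟨inferInstance, fun A hA σ => ?_,
    fun A hA => ?_⟩⟩
  · have := Measure.isProbabilityMeasure_map (μ := γ) (measurable_comp_perm σ).aemeasurable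
    -- Symmetry is assumed only on boxes; these form a π-system generating the σ-algebra, so it
    -- extends to all measurable sets.
    refine ext_of_generate_finite _ generateFrom_pi.symm isPiSystem_pi ?_ (by simp)
    rintro _ ⟨A, hA, rfl⟩
    have hA' : ∀ i, MeasurableSet (A i) := fun i => hA i (Set.mem_univ i)
    rw [Measure.map_apply (measurable_comp_perm σ) (MeasurableSet.univ_pi hA'),
      h.symm A hA' σ.symm, ← preimage_comp_perm_pi σ fun i => A (σ.symm i)]
    simp_rw [Equiv.symm_apply_apply]
  · have := Measure.isProbabilityMeasure_map (μ := γ)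
      (measurable_pi_apply (0 : Fin N) (X := fun _ => Space)).aemeasurable
    ext A hA
    rw [Measure.map_apply (measurable_pi_apply 0) hA]
    have h3 := h.marginal A hA
    rw [setIntegral_density hum hρ hA] at h3
    have hγ := h.isProbabilityMeasure
    exact (ENNReal.toReal_eq_toReal_iff' (measure_ne_top _ _) (measure_ne_top _ _)).1 h3
  · conv_rhs => rw [← h1 σ]
    rw [Measure.map_apply (measurable_comp_perm σ) (MeasurableSet.univ_pi fun i => hA (σ i)),
      preimage_comp_perm_pi]
  · rw [setIntegral_density hum hρ hA, ← h2, Measure.map_apply (measurable_pi_apply 0) hA]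
    rfl

theorem map_apply_eq_of_map_eq {γ : Measure (Positions N)}
    (h : ∀ σ : Equiv.Perm (Fin N), γ.map (fun x => x ∘ σ) = γ) (i : Fin N) :
    γ.map (fun x => x i) = γ.map (fun x => x 0) := by
  conv_rhs => rw [← h (Equiv.swap 0 i)]
  rw [Measure.map_map (measurable_pi_apply 0) (measurable_comp_perm _)]
  congr 1

end Plans

/-! ### Position densities of wavefunctions as plans -/

section PositionMeasure

variable {N : ℕ}

/-- The distribution of the positions of the particles. -/
def positionMeasure (Ψ : WaveFunction N) : Measure (Positions N) :=
  volume.withDensity fun x => ENNReal.ofReal (positionDensity Ψ x)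

variable {Ψ : WaveFunction N}

theorem IsAdmissible.integrable_positionDensity (hΨ : IsAdmissible Ψ) :
    Integrable (positionDensity Ψ) := by
  by_contra h
  have := hΨ.norm_eq_one
  rw [integral_undef h] at this
  exact zero_ne_one this

theorem IsAdmissible.isProbabilityMeasure (hΨ : IsAdmissible Ψ) :
    IsProbabilityMeasure (positionMeasure Ψ) :=
  ⟨by rw [positionMeasure, withDensity_apply _ .univ, setLIntegral_univ,
    ← ofReal_integral_eq_lintegral_ofReal hΨ.integrable_positionDensity
      (ae_of_all _ (positionDensity_nonneg Ψ)), hΨ.norm_eq_one, ENNReal.ofReal_one]⟩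

theorem IsAdmissible.lintegral_positionMeasure (hΨ : IsAdmissible Ψ) {f : Positions N → ℝ≥0∞}
    (hf : Measurable f) : ∫⁻ x, f x ∂positionMeasure Ψ =
      ∫⁻ x, f x * ENNReal.ofReal (positionDensity Ψ x) := by
  rw [positionMeasure, lintegral_withDensity_eq_lintegral_mul₀
    hΨ.integrable_positionDensity.1.aemeasurable.ennreal_ofReal hf.aemeasurable]
  exact lintegral_congr fun x => mul_comm _ _

theorem IsAdmissible.transportCost_positionMeasure (hΨ : IsAdmissible Ψ) :
    transportCost (positionMeasure Ψ) = interactionEnergy Ψ := by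
  rw [transportCost, hΨ.lintegral_positionMeasure measurable_coulombCost, interactionEnergy]
  simp_rw [ofReal_positionDensity]

theorem IsAdmissible.integral_positionMeasure (hΨ : IsAdmissible Ψ) (f : Positions N → ℝ) :
    ∫ x, f x ∂positionMeasure Ψ = ∫ x, f x * positionDensity Ψ x := by
  rw [positionMeasure, integral_withDensity_eq_integral_toReal_smul₀
    hΨ.integrable_positionDensity.1.aemeasurable.ennreal_ofReal
    (ae_of_all _ fun x => ENNReal.ofReal_lt_top)]
  refine integral_congr_ae (ae_of_all _ fun x => ?_)
  simp only
  rw [ENNReal.toReal_ofReal (positionDensity_nonneg Ψ x), smul_eq_mul, mul_comm]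

theorem IsAdmissible.map_comp_perm_positionMeasure (hΨ : IsAdmissible Ψ) (σ : Equiv.Perm (Fin N)) :
    (positionMeasure Ψ).map (fun x => x ∘ σ) = positionMeasure Ψ := by
  have hpd : ∀ᵐ x, positionDensity Ψ (x ∘ σ) = positionDensity Ψ x := by
    filter_upwards [hΨ.antisymm σ] with x hx
    rw [positionDensity, positionDensity, ← (σ.arrowCongr (Equiv.refl (ZMod 2))).symm.sum_comp]
    refine Finset.sum_congr rfl fun s _ => ?_
    have e : (σ.arrowCongr (Equiv.refl (ZMod 2))).symm s = s ∘ σ := by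
      funext i; simp [Equiv.arrowCongr]
    rw [e, hx s, norm_mul]
    rcases Int.units_eq_one_or (Equiv.Perm.sign σ) with h | h <;> simp [h]
  have hmp := measurePreserving_comp_perm σ
  ext A hA
  have hm : AEMeasurable (A.indicator fun x => ENNReal.ofReal (positionDensity Ψ x)) volume :=
    hΨ.integrable_positionDensity.1.aemeasurable.ennreal_ofReal.indicator hA
  rw [Measure.map_apply (measurable_comp_perm σ) hA, positionMeasure,
    withDensity_apply _ (measurable_comp_perm σ hA), withDensity_apply _ hA,
    ← lintegral_indicator hA, ← lintegral_indicator (measurable_comp_perm σ hA)]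
  conv_rhs => rw [← hmp.map_eq]
  rw [lintegral_map' (by rwa [hmp.map_eq]) hmp.measurable.aemeasurable]
  refine lintegral_congr_ae ?_
  filter_upwards [hpd] with x hx
  by_cases hxA : x ∘ σ ∈ A
  · rw [Set.indicator_of_mem (by exact hxA), Set.indicator_of_mem hxA, hx]
  · rw [Set.indicator_of_notMem (by exact hxA), Set.indicator_of_notMem hxA]

theorem IsAdmissible.map_apply_positionMeasure [NeZero N] (hΨ : IsAdmissible Ψ) {u ρ : Space → ℝ}
    (hρ : ρ =ᵐ[volume] fun x => N * u x ^ 2) (hd : HasDensity Ψ ρ) :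
    (positionMeasure Ψ).map (fun x => x 0) = squareMeasure u := by
  have hN : (N : ℝ) ≠ 0 := by exact_mod_cast NeZero.ne N
  have hmp := measurePreserving_consPosition N
  have hint : Integrable (fun p : Space × ({j : Fin N // j ≠ 0} → Space) =>
      positionDensity Ψ (consPosition p.1 p.2)) (volume.prod volume) :=
    hmp.integrable_comp_of_integrable hΨ.integrable_positionDensity
  have hin : ∀ᵐ x, ∫⁻ y : {j : Fin N // j ≠ 0} → Space,
      ENNReal.ofReal (positionDensity Ψ (consPosition x y)) = ‖u x‖ₑ ^ 2 := by
    filter_upwards [hint.prod_right_ae, hd, hρ] with x hx hdx hρx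
    rw [← ofReal_integral_eq_lintegral_ofReal hx (ae_of_all _ fun y => positionDensity_nonneg Ψ _)]
    rw [hρx, oneBodyDensity] at hdx
    rw [mul_left_cancel₀ hN hdx, ← enorm_pow, Real.enorm_eq_ofReal (sq_nonneg _)]
  ext A hA
  have hA0 : MeasurableSet ((fun x : Positions N => x 0) ⁻¹' A) := measurable_pi_apply 0 hA
  have hm : AEMeasurable (((fun x : Positions N => x 0) ⁻¹' A).indicator
      fun x => ENNReal.ofReal (positionDensity Ψ x)) volume :=
    hΨ.integrable_positionDensity.1.aemeasurable.ennreal_ofReal.indicator hA0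
  rw [Measure.map_apply (measurable_pi_apply 0) hA, positionMeasure, squareMeasure,
    withDensity_apply _ hA0, withDensity_apply _ hA, ← lintegral_indicator hA0,
    ← lintegral_indicator hA]
  conv_lhs => rw [← hmp.map_eq]
  rw [lintegral_map' (by rwa [hmp.map_eq]) hmp.measurable.aemeasurable, lintegral_prod]
  · refine lintegral_congr_ae ?_
    filter_upwards [hin] with x hx
    have h0 : ∀ y : {j : Fin N // j ≠ 0} → Space, consPosition x y 0 = x := fun y => by
      simp [consPosition]
    by_cases hxA : x ∈ A
    · rw [Set.indicator_of_mem hxA, ← hx]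
      refine lintegral_congr fun y => ?_
      rw [Set.indicator_of_mem]
      simpa [h0] using hxA
    · rw [Set.indicator_of_notMem hxA]
      refine (lintegral_congr fun y => ?_).trans lintegral_zero
      rw [Set.indicator_of_notMem]
      simpa [h0] using hxA
  · exact (AEMeasurable.comp_measurable (by rwa [hmp.map_eq]) hmp.measurable)

end PositionMeasure

/-! ### Tightness and lower semicontinuity -/

section Compactness

variable {N : ℕ}

/-- A single measure is tight, and powers of its compact sets serve all couplings at once, by a
union bound over the particles. -/
theorem isTightMeasureSet_of_marginals {S : Set (Measure (Positions N))} {ν : Measure Space}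
    [IsFiniteMeasure ν] (hS : ∀ γ ∈ S, ∀ i, γ.map (fun x : Positions N => x i) = ν) :
    IsTightMeasureSet S := by
  rw [isTightMeasureSet_iff_exists_isCompact_measure_compl_le]
  intro ε hε
  have hν := isTightMeasureSet_singleton (μ := ν)
  rw [isTightMeasureSet_iff_exists_isCompact_measure_compl_le] at hν
  obtain ⟨K, hK, hKε⟩ := hν (ε / N) (ENNReal.div_pos hε.ne' (by simp))
  refine ⟨Set.univ.pi fun _ => K, isCompact_univ_pi fun _ => hK, fun γ hγ => ?_⟩
  have hsub : (Set.univ.pi fun _ : Fin N => K)ᶜ ⊆ ⋃ i, (fun x : Positions N => x i) ⁻¹' Kᶜ := by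
    intro x hx
    simpa using hx
  refine (measure_mono hsub).trans ((measure_iUnion_fintype_le _ _).trans ?_)
  calc ∑ i : Fin N, γ ((fun x : Positions N => x i) ⁻¹' Kᶜ) ≤ ∑ _i : Fin N, ε / N := by
        refine Finset.sum_le_sum fun i _ => ?_
        rw [← Measure.map_apply (measurable_pi_apply i) hK.measurableSet.compl, hS γ hγ i]
        exact hKε ν rfl
    _ ≤ ε := by
        rw [Finset.sum_const, Finset.card_univ, Fintype.card_fin, nsmul_eq_mul]
        exact ENNReal.mul_div_le

theorem continuous_coulombCost : Continuous (coulombCost (N := N)) := by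
  unfold coulombCost
  fun_prop

/-- Lower semicontinuity of the transport cost under weak convergence. -/
theorem transportCost_le_of_tendsto {γ : ℕ → ProbabilityMeasure (Positions N)}
    {γ₀ : ProbabilityMeasure (Positions N)} (hγ : Tendsto γ atTop (𝓝 γ₀)) {a : ℕ → ℝ≥0∞}
    {b : ℝ≥0∞} (ha : Tendsto a atTop (𝓝 b))
    (h : ∀ k, transportCost (γ k : Measure (Positions N)) ≤ a k) :
    transportCost (γ₀ : Measure (Positions N)) ≤ b := by
  -- As an extended-real function the cost is continuous even at collisions, so its truncations are
  -- bounded continuous test functions. Monotone convergence then removes the truncation.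
  have hc : ∀ n : ℕ, Continuous fun x : Positions N => (min (coulombCost x) n).toNNReal := by
    intro n
    refine ENNReal.continuousOn_toNNReal.comp_continuous
      (continuous_coulombCost.min continuous_const) fun x => ?_
    exact ne_top_of_le_ne_top (ENNReal.natCast_ne_top n) (min_le_right _ _)
  have hcoe : ∀ (n : ℕ) (x : Positions N), (((min (coulombCost x) n).toNNReal : NNReal) : ℝ≥0∞) =
      min (coulombCost x) n := fun n x =>
    ENNReal.coe_toNNReal (ne_top_of_le_ne_top (ENNReal.natCast_ne_top n) (min_le_right _ _))
  set g : ℕ → BoundedContinuousFunction (Positions N) NNReal := fun n =>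
    BoundedContinuousFunction.mkOfBound ⟨_, hc n⟩ n fun x y => by
      rw [NNReal.dist_eq, abs_le]
      have hb : ∀ x : Positions N, ((min (coulombCost x) n).toNNReal : ℝ) ≤ n := fun x => by
        have : (min (coulombCost x) n).toNNReal ≤ (n : NNReal) := by
          rw [← ENNReal.coe_le_coe, hcoe]
          exact_mod_cast min_le_right _ _
        exact_mod_cast this
      have h1 := hb x
      have h2 := hb y
      constructor <;> simp only [ContinuousMap.coe_mk] <;>
        linarith [NNReal.coe_nonneg (min (coulombCost x) n).toNNReal,
          NNReal.coe_nonneg (min (coulombCost y) n).toNNReal]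
  have hgx : ∀ (n : ℕ) (x : Positions N), (g n x : ℝ≥0∞) = min (coulombCost x) n := fun n x => hcoe n x
  have hle : ∀ n : ℕ, ∫⁻ x, min (coulombCost x) n ∂(γ₀ : Measure (Positions N)) ≤ b := by
    intro n
    have h1 := ProbabilityMeasure.tendsto_iff_forall_lintegral_tendsto.1 hγ (g n)
    simp_rw [hgx] at h1
    refine le_of_tendsto_of_tendsto' h1 ha fun k => le_trans ?_ (h k)
    exact lintegral_mono fun x => min_le_left _ _
  have hlim : Tendsto (fun n : ℕ => ∫⁻ x, min (coulombCost x) n ∂(γ₀ : Measure (Positions N)))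
      atTop (𝓝 (transportCost (γ₀ : Measure (Positions N)))) := by
    refine lintegral_tendsto_of_tendsto_of_monotone
      (fun n => (measurable_coulombCost.min measurable_const).aemeasurable)
      (ae_of_all _ fun x n m hnm => ?_) (ae_of_all _ fun x => ?_)
    · simp only
      gcongr
    · have := (tendsto_const_nhds (x := coulombCost x)).min ENNReal.tendsto_nat_nhds_top
      rwa [min_eq_left le_top] at this
  exact le_of_tendsto' hlim hle

end Compactness

end HohenbergKohn

end

/-! ### The limit of vanishing kinetic weight -/

theorem theoremB (N : ℕ) [NeZero N] (ρ : HohenbergKohn.Space → ℝ)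
    (hρ : ρ ∈ HohenbergKohn.densityClass N)
    (α : ℕ → ℝ) (hα : ∀ k, 0 < α k) (hα0 : Tendsto α atTop (𝓝 0))
    (Ψ : ℕ → HohenbergKohn.WaveFunction N)
    (hΨ : ∀ k, HohenbergKohn.IsConstrainedMinimizer (α k) ρ (Ψ k)) :
    ∃ (φ : ℕ → ℕ) (γ : Measure (HohenbergKohn.Positions N)),
      StrictMono φ ∧ HohenbergKohn.IsOptimalPlan ρ γ ∧
      ∀ f : BoundedContinuousFunction (HohenbergKohn.Positions N) ℝ,
        Tendsto (fun k => ∫ x, f x * HohenbergKohn.positionDensity (Ψ (φ k)) x) atTop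
          (𝓝 (∫ x, f x ∂γ)) := by
  open HohenbergKohn in
  obtain ⟨u, hum, -, hρu, hu1, hu⟩ := exists_sqrt_density hρ
  have hprob := isProbabilityMeasure_squareMeasure hu1
  have hadm : ∀ k, IsAdmissible (Ψ k) := fun k => (hΨ k).1.1
  have hperm : ∀ k (σ : Equiv.Perm (Fin N)),
      (positionMeasure (Ψ k)).map (fun x => x ∘ σ) = positionMeasure (Ψ k) :=
    fun k => (hadm k).map_comp_perm_positionMeasure
  have hmarg : ∀ k, (positionMeasure (Ψ k)).map (fun x => x 0) = squareMeasure u := fun k =>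
    (hadm k).map_apply_positionMeasure hρu (hΨ k).1.2
  set γ : ℕ → ProbabilityMeasure (Positions N) := fun k =>
    ⟨positionMeasure (Ψ k), (hadm k).isProbabilityMeasure⟩ with hγ
  have hγc : ∀ k, (γ k : Measure (Positions N)) = positionMeasure (Ψ k) := fun _ => rfl
  have htight : IsTightMeasureSet
      {((μ : ProbabilityMeasure (Positions N)) : Measure (Positions N)) | μ ∈ Set.range γ} := by
    refine isTightMeasureSet_of_marginals (ν := squareMeasure u) ?_
    rintro _ ⟨_, ⟨k, rfl⟩, rfl⟩ i
    rw [hγc, map_apply_eq_of_map_eq (hperm k), hmarg]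
  obtain ⟨γ₀, -, φ, hφ, hlim⟩ := (isCompact_closure_of_isTightMeasureSet htight).tendsto_subseq
    fun k => subset_closure (Set.mem_range_self k)
  refine ⟨φ, γ₀, hφ, ⟨(isPlan_iff hum hu1 hρu).2 ⟨fun σ => ?_, ?_⟩, fun γ' hγ' => ?_⟩, fun f => ?_⟩
  · have h1 := ProbabilityMeasure.tendsto_map_of_tendsto_of_continuous _ _ hlim
      (continuous_comp_perm σ)
    have h2 : ∀ k, (γ k).map (continuous_comp_perm σ).measurable.aemeasurable = γ k := fun k =>
      Subtype.ext (hperm k σ)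
    simp only [Function.comp_apply, h2] at h1
    have h3 := tendsto_nhds_unique h1 hlim
    exact congrArg ProbabilityMeasure.toMeasure h3
  · have hc : Continuous fun x : Positions N => x 0 := continuous_apply 0
    have h1 := ProbabilityMeasure.tendsto_map_of_tendsto_of_continuous _ _ hlim hc
    have h2 : ∀ k, (γ k).map hc.measurable.aemeasurable = ⟨squareMeasure u, hprob⟩ := fun k =>
      Subtype.ext (hmarg k)
    simp only [Function.comp_apply, h2] at h1
    have h3 := tendsto_nhds_unique tendsto_const_nhds h1
    exact (congrArg ProbabilityMeasure.toMeasure h3).symm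
  · by_cases hC : transportCost γ' = ⊤
    · rw [hC]; exact le_top
    have hp' := hγ'.isProbabilityMeasure
    obtain ⟨hS, hM⟩ := (isPlan_iff hum hu1 hρu).1 hγ'
    refine ENNReal.le_of_forall_pos_le_add fun ε hε _ => ?_
    obtain ⟨Φ, hΦ, hΦd, hΦV⟩ := exists_wavefunction_interaction_le hum hu1 hu hρu (γ := γ')
      (fun σ f hf => lintegral_comp_perm_of_map_eq hS σ hf) (fun i f hf => by
        rw [← lintegral_squareMeasure hum hf, ← hM, ← map_apply_eq_of_map_eq hS i,
          lintegral_map hf (measurable_pi_apply i)]) hC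
      (ε := ε) (by exact_mod_cast hε.ne')
    refine le_trans ?_ hΦV
    -- The competitor `Φ` depends on `ε` but not on `k`, so its finite kinetic energy drops out as
    -- `α → 0`.
    have ha : Tendsto (fun k => ENNReal.ofReal (α (φ k)) * kineticEnergy Φ + interactionEnergy Φ)
        atTop (𝓝 (interactionEnergy Φ)) := by
      have h1 := (ENNReal.tendsto_ofReal (hα0.comp hφ.tendsto_atTop))
      rw [ENNReal.ofReal_zero] at h1
      have h2 := (ENNReal.Tendsto.mul_const (b := kineticEnergy Φ) h1
        (.inr (kineticEnergy_lt_top hΦ).ne)).add_const (interactionEnergy Φ)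
      rwa [zero_mul, zero_add] at h2
    refine transportCost_le_of_tendsto hlim ha fun k => ?_
    simp only [Function.comp_apply]
    rw [hγc, (hadm _).transportCost_positionMeasure]
    exact le_add_self.trans ((hΨ (φ k)).2 Φ hΦ hΦd)
  · have h1 := ProbabilityMeasure.tendsto_iff_forall_integral_tendsto.1 hlim f
    refine h1.congr fun k => ?_
    rw [Function.comp_apply, hγc, (hadm _).integral_positionMeasure]
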